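/- **Setting.** Let $(\mathfrak g,\mathfrak h_+,\mathfrak h_-)$ be a Manin triple: $\mathfrak g$ is a finite-dimensional real Lie algebra with a non-degenerate symmetric invariant bilinear form $\langle\cdot,\cdot\rangle$, and $\mathfrak h_\pm\subset\mathfrak g$ are isotropic Lie subalgebras with $\mathfrak g=\mathfrak h_+\oplus\mathfrak h_-$ as vector spaces. Let $G,H_+,H_-$ be connected and simply connected Lie groups with Lie algebras $\mathfrak g,\mathfrak h_+,\mathfrak h_-$, and let $\varphi_\pm:H_\pm\to G$ be the Lie group morphisms integrating the inclusions $\mathfrak h_\pm\subset\mathfrak g$. Write $\theta^l,\theta^r$ for left and right Maurer–Cartan forms, and $\langle\xi,\zeta\rangle(v,w)=\langle\xi(v),\zeta(w)\rangle-\langle\xi(w),\zeta(v)\rangle$ for $\mathfrak g$-valued $1$-forms $\xi,\zeta$. **The model $NG_\bullet$.** $NG_\bullet$ is the nerve of $G$, $NG_n=G^n$, with the forms $$\Omega=\langle d_2^*\theta^l,d_0^*\theta^r\rangle\in\Omega^2(NG_2),\qquad \Theta=\tfrac16\langle\theta^l,[\theta^l,\theta^l]\rangle\in\Omega^3(NG_1),\qquad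 \Omega_\bullet=\Omega-\Theta+0 .$$ **The model $\bar\Gamma^{\mathfrak h}_\bullet$.** Let $$\Gamma=\{(h_2,a_2,a_1,h_1)\in H_+\times H_-\times H_-\times H_+ \mid \varphi_+(h_2)\varphi_-(a_1)=\varphi_-(a_2)\varphi_+(h_1)\}$$ be the double Lie group of squares with left edge $h_2$, top edge $a_2$, bottom edge $a_1$ and right edge $h_1$. Let $\bar\Gamma^{\mathfrak h}_\bullet$ be the Artin–Mazur codiagonal of its bisimplicial nerve: an $n$-simplex is a staircase diagram with vertices $(i,j)$, $0\le i\le j\le n$ ($i$ numbering rows, $j$ columns), with horizontal edges in $H_-$ and vertical edges in $H_+$ that are compatible with composition and whose squares are all in $\Gamma$; its smooth structure is that of an embedded submanifold of a product of copies of $H_\pm$. In particular $\bar\Gamma^{\mathfrak h}_0=\mathrm{pt}$, $\bar\Gamma^{\mathfrak h}_1=H_-\times H_+$, $\bar\Gamma^{\mathfrak h}_2=H_-\times\Gamma\times H_+$, and for $\lambda=(a_3,(h_3,a_2,a_1,h_2),h_1)\in\bar\Gamma^{\mathfrak h}_2$ $$d_0\lambda=(a_1,h_1),\qquad d_1\lambda=(a_3a_2,h_2h_1),\qquad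 d_2\lambda=(a_3,h_3).$$ Let $\bar\omega^{\mathfrak h}=\langle h_3^*\theta^l_{H_+},a_1^*\theta^r_{H_-}\rangle-\langle a_2^*\theta^l_{H_-},h_2^*\theta^r_{H_+}\rangle\in\Omega^2(\bar\Gamma^{\mathfrak h}_2)$, where the coordinates of $\lambda$ are seen as maps, let $\bar\omega^{\mathfrak h}_\bullet=\bar\omega^{\mathfrak h}+0+0$, and let $$\beta=\langle\theta^l_{H_-},\theta^r_{H_+}\rangle\in\Omega^2(H_-\times H_+)=\Omega^2(\bar\Gamma^{\mathfrak h}_1),\qquad \beta_\bullet=\beta+0 .$$ **Terminology.** * A local Lie $n$-groupoid is a simplicial manifold $K_\bullet$ whose horn projections $p_{l,j}:K_l\to\mathrm{Hom}(\Lambda[l,j],K)$ are maps to manifolds that are submersions for all $l\ge1$ and injective étale for $l>n$; it is a local Lie $n$-group if $K_0$ is a point. * A morphism $f:K_\bullet\to J_\bullet$ of local Lie $n$-groupoids is a hypercover if the maps $q_i=((d_0,\dots,d_i),f_i):K_i\to\partial_i(K)\times_{\partial_i(J)}J_i$ are maps to manifolds that are submersions for $0\le i<n$ and injective étale for $i=n$,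 where $\partial_i$ denotes the space of boundaries of $i$-simplices and $q_0=f_0$. * The total differential on $\bigoplus_{p,q}\Omega^q(K_p)$ is $D=\delta+(-1)^pd$, with $\delta=\sum_i(-1)^id_i^*$. * An $m$-shifted $k$-form is a sum $\alpha_\bullet=\sum_{i\le m}\alpha_i$ of $\alpha_i\in\Omega^{k+m-i}(K_i)$, each normalised, i.e. vanishing under pullback by all degeneracies. * The tangent complex of $K_\bullet$ at $x\in K_0$ is $\mathcal T_lK=\bigcap_{i<l}\ker Td_i\subset T_xK_l$ (where $x$ is seen in $K_l$ through the degeneracies), with differential $\partial=(-1)^lTd_l$. * An $m$-shifted $2$-form $\alpha_\bullet$ is non-degenerate if at each $x\in K_0$ its IM-form $$\lambda^{\alpha}_x(v,w)=\sum_{\sigma\in\mathrm{Sh}(l,m-l)}(-1)^\sigma\alpha_m\big(T(s_{\sigma(m-1)}\cdots s_{\sigma(l)})v,\;T(s_{\sigma(l-1)}\cdots s_{\sigma(0)})w\big),\quad v\in\mathcal T_lK,\ w\in\mathcal T_{m-l}K,$$ induces non-degenerate pairings $H_l(\mathcal T_xK)\times H_{m-l}(\mathcal T_xK)\to\mathbb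 R$ for all $l\in\mathbb Z$ (so that, in particular, $H_l=0$ for $l>m$). * An $m$-shifted symplectic local Lie $n$-groupoid is a local Lie $n$-groupoid with an $m$-shifted $2$-form $\alpha_\bullet$ that satisfies $D\alpha_\bullet=0$ and is non-degenerate. * A symplectic Morita equivalence between two such pairs $(K_\bullet,\alpha_\bullet)$ and $(J_\bullet,\alpha'_\bullet)$ is a zig-zag of hypercovers $K_\bullet\xleftarrow{f_\bullet}Z_\bullet\xrightarrow{g_\bullet}J_\bullet$, with $Z_\bullet$ a local Lie $n$-groupoid, together with an $(m-1)$-shifted $2$-form $\phi_\bullet$ on $Z_\bullet$ such that $f_\bullet^*\alpha_\bullet-g_\bullet^*\alpha'_\bullet=D\phi_\bullet$. **Theorem.** $\bar\Gamma^{\mathfrak h}_\bullet$ and $NG_\bullet$ are local Lie $2$-groups, and there is a morphism of simplicial manifolds $\Phi_\bullet:\bar\Gamma^{\mathfrak h}_\bullet\to NG_\bullet$ with $$\Phi_1(a,h)=\varphi_-(a)\varphi_+(h),\qquad \Phi_2(\lambda)=\big(\varphi_-(a_3)\varphi_+(h_3),\ \varphi_-(a_1)\varphi_+(h_1)\big),$$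 such that the zig-zag $$\bar\Gamma^{\mathfrak h}_\bullet\xleftarrow{\ \mathrm{id}_\bullet\ }\bar\Gamma^{\mathfrak h}_\bullet\xrightarrow{\ \Phi_\bullet\ }NG_\bullet$$ together with the $1$-shifted $2$-form $\beta_\bullet$ is a symplectic Morita equivalence between the $2$-shifted symplectic local Lie $2$-groups $(\bar\Gamma^{\mathfrak h}_\bullet,\bar\omega^{\mathfrak h}_\bullet)$ and $(NG_\bullet,\Omega_\bullet)$. In particular both pairs are $2$-shifted symplectic, $\mathrm{id}_\bullet$ and $\Phi_\bullet$ are hypercovers, and $\bar\omega^{\mathfrak h}_\bullet-\Phi_\bullet^*\Omega_\bullet=D\beta_\bullet$; explicitly, $$\bar\omega^{\mathfrak h}-\Phi_2^*\Omega=\delta\beta,\qquad \Phi_1^*\Theta=-d\beta .$$ -/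

import Mathlib

open CategoryTheory Opposite
open scoped Manifold ContDiff

universe u

noncomputable section

/-! ### Manifolds -/

/-- A finite-dimensional smooth manifold (Hausdorff, second countable, without boundary). -/
structure Mfd : Type (u + 1) where
  carrier : Type u
  model : Type u
  [normedAddCommGroup : NormedAddCommGroup model]
  [normedSpace : NormedSpace ℝ model]
  [finiteDimensional : FiniteDimensional ℝ model]
  [topologicalSpace : TopologicalSpace carrier]
  [chartedSpace : ChartedSpace model carrier]
  [isManifold : IsManifold 𝓘(ℝ, model) ∞ carrier]
  [t2Space : T2Space carrier]
  [secondCountable : SecondCountableTopology carrier]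

namespace Mfd

instance : CoeSort Mfd.{u} (Type u) := ⟨Mfd.carrier⟩

attribute [instance] normedAddCommGroup normedSpace finiteDimensional topologicalSpace
  chartedSpace isManifold t2Space secondCountable

instance (M : Mfd.{u}) : CompleteSpace M.model := FiniteDimensional.complete ℝ M.model

/-- Smooth maps between manifolds. -/
structure Hom (M N : Mfd.{u}) : Type u where
  fn : M → N
  smooth : ContMDiff 𝓘(ℝ, M.model) 𝓘(ℝ, N.model) ∞ fn

instance : Category Mfd.{u} where
  Hom M N := Hom M N
  id M := ⟨id, contMDiff_id⟩
  comp f g := ⟨g.fn ∘ f.fn, g.smooth.comp f.smooth⟩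

/-- The smooth map underlying a morphism of manifolds. -/
def map {M N : Mfd.{u}} (f : M ⟶ N) : M → N := Hom.fn f

theorem hom_ext {M N : Mfd.{u}} {f g : M ⟶ N} (h : map f = map g) : f = g := by
  match f, g, h with
  | ⟨_, _⟩, ⟨_, _⟩, rfl => rfl

/-- The tangent map `T_x f : T_x M → T_{f x} N`. Following Mathlib, `T_x M` is the model space
of `M`, identified through the preferred chart at `x`. -/
def tmap {M N : Mfd.{u}} (f : M → N) (x : M) : M.model →L[ℝ] N.model :=
  mfderiv 𝓘(ℝ, M.model) 𝓘(ℝ, N.model) f x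

/-- A submersion (locally, in suitable charts, the projection of a product). -/
def Submersion {M N : Mfd.{u}} (f : M → N) : Prop :=
  Manifold.IsSubmersion 𝓘(ℝ, M.model) 𝓘(ℝ, N.model) ∞ f

/-- An injective étale map, i.e. an injective local diffeomorphism. -/
def InjectiveEtale {M N : Mfd.{u}} (f : M → N) : Prop :=
  Function.Injective f ∧ IsLocalDiffeomorph 𝓘(ℝ, M.model) 𝓘(ℝ, N.model) ∞ f

/-- `c` presents `P` as the embedded submanifold `S` of the product of the manifolds `M i`:
the components are smooth, jointly they form a topological embedding with image `S`, and the
derivative of this embedding is injective. -/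
structure IsSubmanifold {ι : Type} {M : ι → Mfd.{u}} (S : Set (∀ i, M i)) (P : Mfd.{u})
    (c : ∀ i, P → M i) : Prop where
  smooth : ∀ i, ContMDiff 𝓘(ℝ, P.model) 𝓘(ℝ, (M i).model) ∞ (c i)
  embedding : Topology.IsEmbedding (fun (x : P) (i : ι) => c i x)
  range_eq : Set.range (fun (x : P) (i : ι) => c i x) = S
  immersion : ∀ (x : P) (v : P.model), (∀ i, tmap (c i) x v = 0) → v = 0

/-- The map `q : X → ∏ i, M i` takes values in `S`, the set `S` is an embedded submanifold of
the product, and `q`, viewed as a map to this submanifold, has the property `R`. -/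
def MapsToSubmanifold {ι : Type} {M : ι → Mfd.{u}} (S : Set (∀ i, M i)) {X : Mfd.{u}}
    (q : ∀ i, X → M i) (R : ∀ {X P : Mfd.{u}}, (X → P) → Prop) : Prop :=
  ∃ (P : Mfd.{u}) (c : ∀ i, P → M i), IsSubmanifold S P c ∧
    ∃ p : X ⟶ P, (∀ i x, c i (map p x) = q i x) ∧ R (map p)

/-! ### Finite powers of a manifold -/

section Power

/-- The product charts on `M ^ n`. -/
@[reducible] def powChartedSpace (M : Mfd.{u}) (n : ℕ) :
    ChartedSpace (Fin n → M.model) (Fin n → M) :=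
  piChartedSpace (fun _ : Fin n => M.model) (fun _ => M.carrier)

theorem powIsManifold (M : Mfd.{u}) (n : ℕ) :
    @IsManifold ℝ _ (Fin n → M.model) _ _ _ _ 𝓘(ℝ, Fin n → M.model) ∞ (Fin n → M) _
      (powChartedSpace M n) := by
  let _ := powChartedSpace M n
  apply isManifold_of_contDiffOn
  rintro _ _ ⟨e, he, rfl⟩ ⟨e', he', rfl⟩
  rw [contDiffOn_pi]
  intro i
  have h := HasGroupoid.compatible (G := contDiffGroupoid ∞ 𝓘(ℝ, M.model))
    (he i trivial) (he' i trivial)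
  rw [contDiffGroupoid, mem_groupoid_of_pregroupoid] at h
  have h1 : ContDiffOn ℝ ∞ ((e i).symm ≫ₕ e' i) ((e i).symm ≫ₕ e' i).source := by
    simpa [contDiffPregroupoid] using h.1
  refine h1.comp (contDiff_apply ℝ M.model i).contDiffOn ?_
  rintro x ⟨hx, -⟩
  simp only [OpenPartialHomeomorph.trans_source, Set.mem_inter_iff, Set.mem_preimage] at hx ⊢
  exact ⟨hx.1 i trivial, hx.2 i trivial⟩

/-- The manifold `M ^ n`. -/
def pow (M : Mfd.{u}) (n : ℕ) : Mfd.{u} where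
  carrier := Fin n → M
  model := Fin n → M.model
  chartedSpace := powChartedSpace M n
  isManifold := powIsManifold M n

theorem contMDiff_pow {M N : Mfd.{u}} {n : ℕ} {f : N → pow M n}
    (h : ∀ i, ContMDiff 𝓘(ℝ, N.model) 𝓘(ℝ, M.model) ∞ (fun x => f x i)) :
    ContMDiff 𝓘(ℝ, N.model) 𝓘(ℝ, (pow M n).model) ∞ f := by
  intro x
  rw [contMDiffAt_iff]
  refine ⟨continuousAt_pi.2 fun i => (h i).continuous.continuousAt, ?_⟩
  refine contDiffWithinAt_pi.2 fun i => ?_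
  exact (contMDiffAt_iff.1 (h i x)).2

theorem contMDiff_coord (M : Mfd.{u}) {n : ℕ} (i : Fin n) :
    ContMDiff 𝓘(ℝ, (pow M n).model) 𝓘(ℝ, M.model) ∞ (fun x : pow M n => x i) := by
  intro x
  rw [contMDiffAt_iff]
  refine ⟨(continuous_apply i).continuousAt, ?_⟩
  have key : ∀ y ∈ (extChartAt 𝓘(ℝ, (pow M n).model) x).target,
      (extChartAt 𝓘(ℝ, M.model) (x i) ∘ (fun x : pow M n => x i) ∘
        (extChartAt 𝓘(ℝ, (pow M n).model) x).symm) y = (fun y : Fin n → M.model => y i) y := by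
    intro y hy
    rw [extChartAt_target] at hy
    exact (chartAt M.model (x i)).right_inv (hy.1 i trivial)
  exact ContDiffWithinAt.congr_of_eventuallyEq
    (contDiff_apply ℝ M.model i).contDiffWithinAt
    (nhdsWithin_le_nhds (Filter.mem_of_superset (extChartAt_target_mem_nhds x) key))
    (key _ (mem_extChartAt_target x))

end Power

end Mfd

/-! ### Differential forms -/

/-- (Not necessarily smooth) differential `k`-forms on `M`. -/
abbrev Form (M : Mfd.{u}) (k : ℕ) : Type u := M → M.model [⋀^Fin k]→L[ℝ] ℝ

namespace Form

/-- The pullback `f^* η`. -/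
def pullback {M N : Mfd.{u}} {k : ℕ} (f : M → N) (η : Form N k) : Form M k := fun x =>
  (η (f x)).compContinuousLinearMap (Mfd.tmap f x)

/-- The coordinate expression of `η` in the preferred chart at `x`, meaningful on the target
of this chart. -/
def inChart {M : Mfd.{u}} {k : ℕ} (η : Form M k) (x : M) :
    M.model → M.model [⋀^Fin k]→L[ℝ] ℝ := fun y =>
  (η ((chartAt M.model x).symm y)).compContinuousLinearMap
    (mfderiv 𝓘(ℝ, M.model) 𝓘(ℝ, M.model) (chartAt M.model x).symm y)

/-- Smoothness of a differential form. -/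
def IsSmooth {M : Mfd.{u}} {k : ℕ} (η : Form M k) : Prop :=
  ∀ x, ContDiffOn ℝ ∞ (inChart η x) (chartAt M.model x).target

/-- The de Rham differential, computed at `x` in the preferred chart at `x`. -/
def deRham {M : Mfd.{u}} {k : ℕ} (η : Form M k) : Form M (k + 1) := fun x =>
  (extDeriv (inChart η x) (chartAt M.model x x)).compContinuousLinearMap
    (mfderiv 𝓘(ℝ, M.model) 𝓘(ℝ, M.model) (chartAt M.model x) x)

end Form

/-! ### Simplicial manifolds, horns and matching spaces -/

/-- Simplicial manifolds. -/
abbrev SMfd : Type (u + 1) := SimplicialObject Mfd.{u}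

namespace SMfd

/-- The manifold `K_l` of `l`-simplices. -/
abbrev lev (K : SMfd.{u}) (l : ℕ) : Mfd.{u} := K.obj (op (SimplexCategory.mk l))

/-- The face maps `d_i : K_{l+1} → K_l`. -/
def face (K : SMfd.{u}) {l : ℕ} (i : Fin (l + 2)) : lev K (l + 1) → lev K l := Mfd.map (K.δ i)

/-- The degeneracy maps `s_i : K_l → K_{l+1}`. -/
def degen (K : SMfd.{u}) {l : ℕ} (i : Fin (l + 1)) : lev K l → lev K (l + 1) := Mfd.map (K.σ i)

/-- The component `f_l : K_l → J_l` of a morphism of simplicial manifolds. -/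
def level {K J : SMfd.{u}} (f : K ⟶ J) (l : ℕ) : lev K l → lev J l := Mfd.map (f.app (op (.mk l)))

/-- The horn space `Hom(Λ[l+1, j], K)`: families `(x_i)_{i ≠ j}` of `l`-simplices with
`d_a x_b = d_{b-1} x_a` for `a < b`. -/
def horn (K : SMfd.{u}) : ∀ (l : ℕ) (j : Fin (l + 2)),
    Set (∀ _ : {i : Fin (l + 2) // i ≠ j}, (lev K l))
  | 0, _ => Set.univ
  | l + 1, j => {x | ∀ (a b : Fin (l + 2)) (_ : a ≤ b) (ha : a.castSucc ≠ j) (hb : b.succ ≠ j),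
      face K a (x ⟨b.succ, hb⟩) = face K b (x ⟨a.castSucc, ha⟩)}

/-- The boundary (matching) space `∂_{l+1}(K)`: families `(x_0, …, x_{l+1})` of `l`-simplices
with `d_a x_b = d_{b-1} x_a` for `a < b`. -/
def boundary (K : SMfd.{u}) : ∀ l : ℕ, Set (Fin (l + 2) → lev K l)
  | 0 => Set.univ
  | l + 1 => {x | ∀ a b : Fin (l + 2), a ≤ b → face K a (x b.succ) = face K b (x a.castSucc)}

/-- The horn projection `p_{l+1,j} : K_{l+1} → Hom(Λ[l+1, j], K)` is a map to a manifold with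
the property `R`. -/
def HornProj (K : SMfd.{u}) (l : ℕ) (j : Fin (l + 2))
    (R : ∀ {X P : Mfd.{u}}, (X → P) → Prop) : Prop :=
  Mfd.MapsToSubmanifold (horn K l j) (X := lev K (l + 1)) (fun i => face K i.1) R

/-- Local Lie `n`-groupoids: the horn projections `p_{l,j}` are submersions for all `l ≥ 1`, and
injective étale for `l > n`. -/
def IsLocalLieGroupoid (n : ℕ) (K : SMfd.{u}) : Prop :=
  ∀ (l : ℕ) (j : Fin (l + 2)),
    HornProj K l j Mfd.Submersion ∧ (n < l + 1 → HornProj K l j Mfd.InjectiveEtale)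

/-- Local Lie `n`-groups: local Lie `n`-groupoids with `K_0` a point. -/
def IsLocalLieGroup (n : ℕ) (K : SMfd.{u}) : Prop :=
  IsLocalLieGroupoid n K ∧ Nonempty (Unique (lev K 0))

/-- The ambient product `K_l^{l+2} × J_{l+1}` of the target of `q_{l+1}`. -/
def matchAmbient (K J : SMfd.{u}) (l : ℕ) : Option (Fin (l + 2)) → Mfd.{u}
  | some _ => lev K l
  | none => lev J (l + 1)

/-- The fibre product `∂_{l+1}(K) ×_{∂_{l+1}(J)} J_{l+1}`. -/
def matchSpace {K J : SMfd.{u}} (f : K ⟶ J) (l : ℕ) : Set (∀ s, matchAmbient K J l s) :=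
  {x | (fun a : Fin (l + 2) => x (some a)) ∈ boundary K l ∧
    ∀ a : Fin (l + 2), level f l (x (some a)) = face J a (x none)}

/-- The components of `q_{l+1} = ((d_0, …, d_{l+1}), f_{l+1})`. -/
def matchMap {K J : SMfd.{u}} (f : K ⟶ J) (l : ℕ) :
    ∀ s, lev K (l + 1) → matchAmbient K J l s
  | some a => face K a
  | none => level f (l + 1)

/-- The map `q_i : K_i → ∂_i(K) ×_{∂_i(J)} J_i` is a map to a manifold with the property `R`;
here `∂_0` is a point, so that `q_0 = f_0`. -/
def MatchProj {K J : SMfd.{u}} (f : K ⟶ J) (i : ℕ)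
    (R : ∀ {X P : Mfd.{u}}, (X → P) → Prop) : Prop :=
  match i with
  | 0 => R (level f 0)
  | l + 1 => Mfd.MapsToSubmanifold (matchSpace f l) (matchMap f l) R

/-- Hypercovers of local Lie `n`-groupoids: `q_i` is a submersion for `i < n` and injective
étale for `i = n`. -/
def IsHypercover {K J : SMfd.{u}} (n : ℕ) (f : K ⟶ J) : Prop :=
  (∀ i < n, MatchProj f i Mfd.Submersion) ∧ MatchProj f n Mfd.InjectiveEtale

/-! ### The de Rham double complex -/

/-- Families of forms `α_{p,q} ∈ Ω^q(K_p)`. -/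
abbrev Cochain (K : SMfd.{u}) : Type u := ∀ p q : ℕ, Form (lev K p) q

/-- The simplicial differential `δ = ∑_i (-1)^i d_i^* : Ω^q(K_p) → Ω^q(K_{p+1})`. -/
def simplicialDiff (K : SMfd.{u}) {p q : ℕ} (η : Form (lev K p) q) : Form (lev K (p + 1)) q :=
  ∑ i : Fin (p + 2), (-1 : ℝ) ^ (i : ℕ) • Form.pullback (face K i) η

/-- The total differential `D = δ + (-1)^p d`. -/
def totalDiff {K : SMfd.{u}} (α : Cochain K) : Cochain K
  | 0, 0 => 0
  | 0, q + 1 => Form.deRham (α 0 q)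
  | p + 1, 0 => simplicialDiff K (α p 0)
  | p + 1, q + 1 =>
      simplicialDiff K (α p (q + 1)) + (-1 : ℝ) ^ (p + 1) • Form.deRham (α (p + 1) q)

/-- The pullback of a family of forms along a morphism of simplicial manifolds. -/
def pullback {K J : SMfd.{u}} (f : K ⟶ J) (α : Cochain J) : Cochain K :=
  fun p q => Form.pullback (level f p) (α p q)

/-- `m`-shifted `k`-forms `∑_{i ≤ m} α_i`: here `α_i ∈ Ω^{k+m-i}(K_i)` is smooth and normalised,
that is, it vanishes under pullback by all degeneracies. -/
structure IsShiftedForm (m k : ℤ) {K : SMfd.{u}} (α : Cochain K) : Prop where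
  smooth : ∀ p q, Form.IsSmooth (α p q)
  support : ∀ p q : ℕ, ¬ ((p : ℤ) ≤ m ∧ (p + q : ℤ) = k + m) → α p q = 0
  normalised : ∀ (p q : ℕ) (i : Fin (p + 1)), Form.pullback (degen K i) (α (p + 1) q) = 0

/-! ### The tangent complex and shifted symplectic forms -/

/-- The point `x ∈ K_0`, seen in `K_l` through the iterated degeneracy. -/
def basePoint (K : SMfd.{u}) (l : ℕ) (x : (lev K 0)) : (lev K l) :=
  Mfd.map (K.map (SimplexCategory.const (.mk l) (.mk 0) 0).op) x

/-- The fibre at `x` of the tangent complex, `𝒯_l K = ker T p_{l,l} = ⋂_{i < l} ker T d_i`. -/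
def tangent (K : SMfd.{u}) (x : (lev K 0)) : ∀ l : ℕ, Submodule ℝ (lev K l).model
  | 0 => ⊤
  | l + 1 => ⨅ i : Fin (l + 1),
      LinearMap.ker (Mfd.tmap (face K i.castSucc) (basePoint K (l + 1) x)).toLinearMap

/-- The differential `∂ = (-1)^{l+1} T d_{l+1}` of the tangent complex. -/
def tangentDiff (K : SMfd.{u}) (x : (lev K 0)) (l : ℕ) :
    (lev K (l + 1)).model →ₗ[ℝ] (lev K l).model :=
  (-1 : ℝ) ^ (l + 1) •
    (Mfd.tmap (face K (Fin.last (l + 1))) (basePoint K (l + 1) x)).toLinearMap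

/-- The cycles of the tangent complex. -/
def cycles (K : SMfd.{u}) (x : (lev K 0)) : ∀ l : ℕ, Submodule ℝ (lev K l).model
  | 0 => tangent K x 0
  | l + 1 => tangent K x (l + 1) ⊓ LinearMap.ker (tangentDiff K x l)

/-- The boundaries of the tangent complex. -/
def boundaries (K : SMfd.{u}) (x : (lev K 0)) (l : ℕ) :
    Submodule ℝ (lev K l).model :=
  (tangent K x (l + 1)).map (tangentDiff K x l)

/-- The operator `[m] → [l]` which sends `k` to the number of elements of `A` below `k`, for a
subset `A` of `{0, …, m-1}` with at most `l` elements. For `A` with `l` elements and complement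
`j_1 < … < j_r` it induces the iterated degeneracy `s_{j_r} ⋯ s_{j_1} : K_l → K_m`. -/
def collapse {m l : ℕ} (A : Finset (Fin m)) (hA : A.card ≤ l) : SimplexCategory.mk m ⟶ SimplexCategory.mk l :=
  SimplexCategory.mkHom
    { toFun := fun k => ⟨(A.filter fun t => t.castSucc < k).card,
        Nat.lt_succ_of_le ((Finset.card_filter_le _ _).trans hA)⟩
      monotone' := fun _ _ h => Fin.mk_le_mk.2 <| Finset.card_le_card <|
        Finset.monotone_filter_right _ fun _ _ ht => lt_of_lt_of_le ht h }

/-- The `(l, m-l)`-shuffles: permutations of `{0, …, m-1}` that are increasing on the first `l`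
elements and on the others. -/
def IsShuffle (l : ℕ) {m : ℕ} (σ : Equiv.Perm (Fin m)) : Prop :=
  (∀ i j : Fin m, i < j → (j : ℕ) < l → σ i < σ j) ∧
    ∀ i j : Fin m, i < j → l ≤ (i : ℕ) → σ i < σ j

/-- The set `{σ(0), …, σ(l-1)}`. -/
def shuffleFst (l : ℕ) {m : ℕ} (σ : Equiv.Perm (Fin m)) : Finset (Fin m) :=
  (Finset.univ.filter fun i : Fin m => (i : ℕ) < l).map σ.toEmbedding

/-- The set `{σ(l), …, σ(m-1)}`. -/
def shuffleSnd (l : ℕ) {m : ℕ} (σ : Equiv.Perm (Fin m)) : Finset (Fin m) :=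
  (Finset.univ.filter fun i : Fin m => l ≤ (i : ℕ)).map σ.toEmbedding

theorem card_shuffleFst (l : ℕ) {m : ℕ} (σ : Equiv.Perm (Fin m)) :
    (shuffleFst l σ).card ≤ l := by
  rw [shuffleFst, Finset.card_map]
  calc _ ≤ (Finset.range l).card :=
        Finset.card_le_card_of_injOn (fun i : Fin m => (i : ℕ)) (by intro i; simp)
          (Fin.val_injective.injOn)
    _ = l := Finset.card_range l

theorem card_shuffleSnd {l r m : ℕ} (h : l + r = m) (σ : Equiv.Perm (Fin m)) :
    (shuffleSnd l σ).card ≤ r := by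
  rw [shuffleSnd, Finset.card_map]
  calc _ ≤ (Finset.Ico l m).card :=
        Finset.card_le_card_of_injOn (fun i : Fin m => (i : ℕ)) (by intro i; simp)
          (Fin.val_injective.injOn)
    _ = r := by simp [← h]

/-- The tangent map `T_x K_l → T_x K_m` of the simplicial operator `θ`, at a point of `K_0`. -/
def tangentOp (K : SMfd.{u}) (x : (lev K 0)) {l m : ℕ} (θ : SimplexCategory.mk m ⟶ SimplexCategory.mk l) :
    (lev K l).model →L[ℝ] (lev K m).model :=
  Mfd.tmap (Mfd.map (K.map θ.op)) (basePoint K l x)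

open Classical in
/-- The IM-form of an `m`-shifted `2`-form with leading term `α_m = η`, for `l + r = m`:
`λ_x(v, w) = ∑_σ (-1)^σ η(T(s_{σ(m-1)} ⋯ s_{σ(l)}) v, T(s_{σ(l-1)} ⋯ s_{σ(0)}) w)`, the sum being
over the `(l, r)`-shuffles. -/
def imForm (K : SMfd.{u}) {l r m : ℕ} (h : l + r = m) (η : Form (lev K m) 2)
    (x : (lev K 0)) (v : (lev K l).model) (w : (lev K r).model) : ℝ :=
  ∑ σ : Equiv.Perm (Fin m) with IsShuffle l σ, ((Equiv.Perm.sign σ : ℤ) : ℝ) *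
    η (basePoint K m x)
      ![tangentOp K x (collapse (shuffleFst l σ) (card_shuffleFst l σ)) v,
        tangentOp K x (collapse (shuffleSnd l σ) (card_shuffleSnd h σ)) w]

/-- Non-degeneracy of an `m`-shifted `2`-form: for every `x ∈ K_0` the IM-form induces
non-degenerate pairings `H_l(𝒯 K) × H_{m-l}(𝒯 K) → ℝ` for all `l ∈ ℤ`. That is, on cycles its
radicals on both sides are exactly the boundaries, and `H_l(𝒯 K) = 0` for `l > m`
(where the other factor is zero). -/
structure IsNondegenerate (m : ℕ) {K : SMfd.{u}} (α : Cochain K) : Prop where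
  left : ∀ (x : (lev K 0)) (l r : ℕ) (h : l + r = m), ∀ v ∈ cycles K x l,
    (∀ w ∈ cycles K x r, imForm K h (α m 2) x v w = 0) ↔ v ∈ boundaries K x l
  right : ∀ (x : (lev K 0)) (l r : ℕ) (h : l + r = m), ∀ w ∈ cycles K x r,
    (∀ v ∈ cycles K x l, imForm K h (α m 2) x v w = 0) ↔ w ∈ boundaries K x r
  above : ∀ (x : (lev K 0)) (l : ℕ), m < l → cycles K x l ≤ boundaries K x l

/-- `m`-shifted symplectic local Lie `n`-groupoids. -/
structure IsShiftedSymplectic (m n : ℕ) (K : SMfd.{u}) (α : Cochain K) : Prop where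
  localLie : IsLocalLieGroupoid n K
  form : IsShiftedForm m 2 α
  closed : totalDiff α = 0
  nondegenerate : IsNondegenerate m α

/-- The zig-zag `(K, α) ← (Z, φ) → (J, α')`, with legs `f` and `g`, is a symplectic Morita
equivalence between the `m`-shifted symplectic local Lie `n`-groupoids `(K, α)` and `(J, α')`. -/
structure IsSymplecticMorita (m n : ℕ) {K J Z : SMfd.{u}} (α : Cochain K) (α' : Cochain J)
    (φ : Cochain Z) (f : Z ⟶ K) (g : Z ⟶ J) : Prop where
  left : IsShiftedSymplectic m n K α
  right : IsShiftedSymplectic m n J α'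
  localLie : IsLocalLieGroupoid n Z
  form : IsShiftedForm ((m : ℤ) - 1) 2 φ
  hypercover_left : IsHypercover n f
  hypercover_right : IsHypercover n g
  eq : pullback f α - pullback g α' = totalDiff φ

end SMfd

/-! ### Lie groups, nerves and Maurer–Cartan forms -/

/-- A (finite-dimensional, real) Lie group. -/
structure LieGrp : Type (u + 1) extends Mfd.{u} where
  [group : Group carrier]
  [lieGroup : LieGroup 𝓘(ℝ, model) ∞ carrier]

namespace LieGrp

instance : CoeSort LieGrp.{u} (Type u) := ⟨fun G => G.carrier⟩

attribute [instance] group lieGroup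

instance (G : LieGrp.{u}) : LieGroup 𝓘(ℝ, G.model) (minSmoothness ℝ 3) G :=
  LieGroup.of_le (n := ∞) (by simpa using ENat.LEInfty.out)

/-- The Lie algebra of `G`: the tangent space at the identity, with the bracket of
left-invariant vector fields. -/
abbrev lie (G : LieGrp.{u}) : Type u := GroupLieAlgebra 𝓘(ℝ, G.model) G

/-- The pullback `f^* θ^l` of the left Maurer–Cartan form, `v ↦ T L_{f(x)⁻¹} (T_x f v)`. -/
def mcLeft (G : LieGrp.{u}) {M : Mfd.{u}} (f : M → G) (x : M) : M.model →ₗ[ℝ] G.lie :=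
  (Mfd.tmap (M := G.toMfd) (N := G.toMfd) (fun y => (f x)⁻¹ * y) (f x)).toLinearMap ∘ₗ
    (Mfd.tmap (N := G.toMfd) f x).toLinearMap

/-- The pullback `f^* θ^r` of the right Maurer–Cartan form, `v ↦ T R_{f(x)⁻¹} (T_x f v)`. -/
def mcRight (G : LieGrp.{u}) {M : Mfd.{u}} (f : M → G) (x : M) : M.model →ₗ[ℝ] G.lie :=
  (Mfd.tmap (M := G.toMfd) (N := G.toMfd) (fun y => y * (f x)⁻¹) (f x)).toLinearMap ∘ₗ
    (Mfd.tmap (N := G.toMfd) f x).toLinearMap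

/-- The action of `θ : [m] → [n]` on the nerve, `(g_1, …, g_n) ↦ (g'_1, …, g'_m)` with
`g'_i = g_{θ(i-1)+1} ⋯ g_{θ(i)}`, written through the partial products of the `g_i`. -/
def nerveOp (G : LieGrp.{u}) {m n : ℕ} (θ : Fin (m + 1) →o Fin (n + 1)) (g : Fin n → G) :
    Fin m → G :=
  fun i => (Fin.partialProd g (θ i.castSucc))⁻¹ * Fin.partialProd g (θ i.succ)

theorem partialProd_nerveOp (G : LieGrp.{u}) {m n : ℕ} (θ : Fin (m + 1) →o Fin (n + 1))
    (g : Fin n → G) (j : Fin (m + 1)) :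
    Fin.partialProd (G.nerveOp θ g) j =
      (Fin.partialProd g (θ 0))⁻¹ * Fin.partialProd g (θ j) := by
  induction j using Fin.induction with
  | zero => simp
  | succ j ih => rw [Fin.partialProd_succ, ih]; simp [nerveOp, mul_assoc]

theorem nerveOp_comp (G : LieGrp.{u}) {l m n : ℕ} (θ : Fin (m + 1) →o Fin (n + 1))
    (θ' : Fin (l + 1) →o Fin (m + 1)) (g : Fin n → G) :
    G.nerveOp (θ.comp θ') g = G.nerveOp θ' (G.nerveOp θ g) := by
  funext i
  rw [nerveOp, nerveOp, partialProd_nerveOp, partialProd_nerveOp]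
  simp [mul_assoc]

theorem contMDiff_partialProd (G : LieGrp.{u}) {n : ℕ} (j : Fin (n + 1)) :
    ContMDiff 𝓘(ℝ, (G.toMfd.pow n).model) 𝓘(ℝ, G.model) ∞
      (fun g : G.toMfd.pow n => Fin.partialProd (M := G) (n := n) g j) := by
  induction j using Fin.induction with
  | zero =>
    have : (fun g : G.toMfd.pow n => Fin.partialProd (M := G) (n := n) g 0) = fun _ => 1 :=
      funext fun g => Fin.partialProd_zero (M := G) (n := n) g
    rw [this]
    exact contMDiff_const
  | succ j ih =>
    have : (fun g : G.toMfd.pow n => Fin.partialProd (M := G) (n := n) g j.succ) =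
        fun g => Fin.partialProd (M := G) (n := n) g j.castSucc * g j :=
      funext fun g => Fin.partialProd_succ (M := G) (n := n) g j
    rw [this]
    exact ih.mul (Mfd.contMDiff_coord G.toMfd j)

/-- The nerve `NG_•`, with `NG_n = G^n`. -/
def nerve (G : LieGrp.{u}) : SMfd.{u} where
  obj X := G.toMfd.pow X.unop.len
  map θ := ⟨G.nerveOp θ.unop.toOrderHom, Mfd.contMDiff_pow fun _ =>
    (G.contMDiff_partialProd _).inv.mul (G.contMDiff_partialProd _)⟩
  map_id _ := Mfd.hom_ext <| funext fun g => funext fun i =>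
    Fin.partialProd_right_inv (G := G) g i
  map_comp θ θ' := Mfd.hom_ext <| funext fun g =>
    G.nerveOp_comp θ.unop.toOrderHom θ'.unop.toOrderHom g

end LieGrp

/-! ### Forms built from the pairing -/

theorem MultilinearMap.continuous_of_finite {E : Type u} [NormedAddCommGroup E] [NormedSpace ℝ E]
    [FiniteDimensional ℝ E] {k : ℕ} (f : MultilinearMap ℝ (fun _ : Fin k => E) ℝ) :
    Continuous f := by
  classical
  have h : ∀ v : Fin k → E, f v = ∑ r : Fin k → Fin (Module.finrank ℝ E),
      (∏ i, (Module.finBasis ℝ E).repr (v i) (r i)) •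
        f (fun i => Module.finBasis ℝ E (r i)) := by
    intro v
    conv_lhs => rw [show v = fun i => ∑ j, (Module.finBasis ℝ E).repr (v i) j •
      Module.finBasis ℝ E j from funext fun i => ((Module.finBasis ℝ E).sum_repr (v i)).symm]
    rw [MultilinearMap.map_sum]
    exact Finset.sum_congr rfl fun r _ => f.map_smul_univ _ _
  rw [show (f : (Fin k → E) → ℝ) = _ from funext h]
  refine continuous_finsetSum _ fun r _ => Continuous.mul ?_ continuous_const
  refine continuous_finsetProd _ fun i _ => ?_
  exact ((Module.finBasis ℝ E).coord (r i)).continuous_of_finiteDimensional.comp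
    (continuous_apply i)

/-- The alternating map `v ↦ ∑_σ (-1)^σ f (v_{σ(0)}, …, v_{σ(k-1)})`. -/
def alternate {E : Type u} [NormedAddCommGroup E] [NormedSpace ℝ E] [FiniteDimensional ℝ E]
    {k : ℕ} (f : MultilinearMap ℝ (fun _ : Fin k => E) ℝ) : E [⋀^Fin k]→L[ℝ] ℝ :=
  { MultilinearMap.alternatization f with
    cont := (MultilinearMap.alternatization f).toMultilinearMap.continuous_of_finite }

section Pairing

variable {𝔤 : Type*} [LieRing 𝔤] [LieAlgebra ℝ 𝔤] (B : LinearMap.BilinForm ℝ 𝔤)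

/-- The `2`-form `⟨ξ, ζ⟩` of two `𝔤`-valued `1`-forms,
`⟨ξ, ζ⟩(v, w) = ⟨ξ(v), ζ(w)⟩ - ⟨ξ(w), ζ(v)⟩`. -/
def pairForm {M : Mfd.{u}} (ξ ζ : ∀ _ : M, M.model →ₗ[ℝ] 𝔤) : Form M 2 := fun x =>
  alternate
    { toFun := fun v => B (ξ x (v 0)) (ζ x (v 1))
      map_update_add' := fun v i a b => by
        obtain rfl | rfl : i = 0 ∨ i = 1 := by omega
        all_goals simp
      map_update_smul' := fun v i c a => by
        obtain rfl | rfl : i = 0 ∨ i = 1 := by omega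
        all_goals simp }

/-- The `3`-form `(1/6) ⟨θ, [θ, θ]⟩` of a `𝔤`-valued `1`-form `θ`, where
`[θ, θ](v, w) = 2 [θ(v), θ(w)]`; that is,
`(u_0, u_1, u_2) ↦ (1/6) ∑_σ (-1)^σ ⟨θ(u_{σ(0)}), [θ(u_{σ(1)}), θ(u_{σ(2)})]⟩`. -/
def cartanForm {M : Mfd.{u}} (θ : ∀ _ : M, M.model →ₗ[ℝ] 𝔤) : Form M 3 := fun x =>
  (1 / 6 : ℝ) • alternate
    { toFun := fun v => B (θ x (v 0)) ⁅θ x (v 1), θ x (v 2)⁆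
      map_update_add' := by
        intro inst v i a b
        obtain rfl : inst = instDecidableEqFin 3 := Subsingleton.elim _ _
        obtain rfl | rfl | rfl : i = 0 ∨ i = 1 ∨ i = 2 := by omega
        all_goals simp
      map_update_smul' := by
        intro inst v i c a
        obtain rfl : inst = instDecidableEqFin 3 := Subsingleton.elim _ _
        obtain rfl | rfl | rfl : i = 0 ∨ i = 1 ∨ i = 2 := by omega
        all_goals simp }

theorem pairForm_apply {M : Mfd.{u}} (ξ ζ : ∀ _ : M, M.model →ₗ[ℝ] 𝔤) (x : M) (v w : M.model) :
    pairForm B ξ ζ x ![v, w] = B (ξ x v) (ζ x w) - B (ξ x w) (ζ x v) := by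
  change MultilinearMap.alternatization _ _ = _
  rw [MultilinearMap.alternatization_apply, Fintype.sum_eq_add (1 : Equiv.Perm (Fin 2))
    (Equiv.swap 0 1) (by decide) fun σ hσ => absurd hσ (by revert σ; decide)]
  simp [sub_eq_add_neg]

end Pairing

/-! ### Manin triples and their integration -/

/-- Manin triples `(𝔤, 𝔥₊, 𝔥₋)`: a quadratic Lie algebra `(𝔤, ⟨·,·⟩)` with two complementary
isotropic Lie subalgebras. -/
structure ManinTriple (𝔤 : Type*) [LieRing 𝔤] [LieAlgebra ℝ 𝔤] where
  B : LinearMap.BilinForm ℝ 𝔤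
  symm : ∀ a b, B a b = B b a
  nondegenerate : B.Nondegenerate
  invariant : ∀ a b c : 𝔤, B ⁅a, b⁆ c + B b ⁅a, c⁆ = 0
  hp : LieSubalgebra ℝ 𝔤
  hm : LieSubalgebra ℝ 𝔤
  isotropic_p : ∀ a ∈ hp, ∀ b ∈ hp, B a b = 0
  isotropic_m : ∀ a ∈ hm, ∀ b ∈ hm, B a b = 0
  isCompl : IsCompl hp.toSubmodule hm.toSubmodule

/-- The connected and simply connected Lie groups `G`, `H₊`, `H₋` integrating a Manin triple,
with the group morphisms `φ± : H± → G` integrating the inclusions `𝔥± ⊂ 𝔤`. -/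
structure Integration {𝔤 : Type*} [LieRing 𝔤] [LieAlgebra ℝ 𝔤] (T : ManinTriple 𝔤) where
  G : LieGrp.{u}
  Hp : LieGrp.{u}
  Hm : LieGrp.{u}
  simplyConnected_G : SimplyConnectedSpace G
  simplyConnected_p : SimplyConnectedSpace Hp
  simplyConnected_m : SimplyConnectedSpace Hm
  lieG : G.lie ≃ₗ⁅ℝ⁆ 𝔤
  liep : Hp.lie ≃ₗ⁅ℝ⁆ T.hp
  liem : Hm.lie ≃ₗ⁅ℝ⁆ T.hm
  φp : Hp →* G
  φm : Hm →* G
  smooth_p : ContMDiff 𝓘(ℝ, Hp.model) 𝓘(ℝ, G.model) ∞ φp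
  smooth_m : ContMDiff 𝓘(ℝ, Hm.model) 𝓘(ℝ, G.model) ∞ φm
  tangent_p : ∀ v : Hp.lie, lieG (Mfd.tmap (M := Hp.toMfd) (N := G.toMfd) φp 1 v) = liep v
  tangent_m : ∀ v : Hm.lie, lieG (Mfd.tmap (M := Hm.toMfd) (N := G.toMfd) φm 1 v) = liem v

namespace Integration

variable {𝔤 : Type*} [LieRing 𝔤] [LieAlgebra ℝ 𝔤] {T : ManinTriple 𝔤} (I : Integration.{u} T)

/-! The `𝔤`-valued pullbacks `f^* θ^l`, `f^* θ^r` of the Maurer–Cartan forms of `G`, `H₊`, `H₋`. -/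

/-- `f^* θ^l_G`. -/
def thetaL {M : Mfd.{u}} (f : M → I.G) (x : M) : M.model →ₗ[ℝ] 𝔤 :=
  I.lieG.toLinearMap ∘ₗ I.G.mcLeft f x

/-- `f^* θ^r_G`. -/
def thetaR {M : Mfd.{u}} (f : M → I.G) (x : M) : M.model →ₗ[ℝ] 𝔤 :=
  I.lieG.toLinearMap ∘ₗ I.G.mcRight f x

/-- `f^* θ^l_{H₊}`. -/
def thetaLp {M : Mfd.{u}} (f : M → I.Hp) (x : M) : M.model →ₗ[ℝ] 𝔤 :=
  T.hp.subtype ∘ₗ I.liep.toLinearMap ∘ₗ I.Hp.mcLeft f x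

/-- `f^* θ^r_{H₊}`. -/
def thetaRp {M : Mfd.{u}} (f : M → I.Hp) (x : M) : M.model →ₗ[ℝ] 𝔤 :=
  T.hp.subtype ∘ₗ I.liep.toLinearMap ∘ₗ I.Hp.mcRight f x

/-- `f^* θ^l_{H₋}`. -/
def thetaLm {M : Mfd.{u}} (f : M → I.Hm) (x : M) : M.model →ₗ[ℝ] 𝔤 :=
  T.hm.subtype ∘ₗ I.liem.toLinearMap ∘ₗ I.Hm.mcLeft f x

/-- `f^* θ^r_{H₋}`. -/
def thetaRm {M : Mfd.{u}} (f : M → I.Hm) (x : M) : M.model →ₗ[ℝ] 𝔤 :=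
  T.hm.subtype ∘ₗ I.liem.toLinearMap ∘ₗ I.Hm.mcRight f x

/-! ### The model `(NG_•, Ω_•)` -/

/-- `Ω = ⟨d_2^* θ^l, d_0^* θ^r⟩ ∈ Ω²(NG_2)`. -/
def Omega : Form (I.G.nerve.lev 2) 2 :=
  pairForm T.B (I.thetaL fun g : I.G.nerve.lev 2 => (I.G.nerve.face 2 g : Fin 1 → I.G) 0)
    (I.thetaR fun g : I.G.nerve.lev 2 => (I.G.nerve.face 0 g : Fin 1 → I.G) 0)

/-- `Θ = (1/6) ⟨θ^l, [θ^l, θ^l]⟩ ∈ Ω³(NG_1)`. -/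
def Theta : Form (I.G.nerve.lev 1) 3 :=
  cartanForm T.B (I.thetaL fun g : I.G.nerve.lev 1 => (show Fin 1 → I.G from g) 0)

/-- `Ω_• = Ω - Θ + 0`. -/
def OmegaTotal : SMfd.Cochain I.G.nerve
  | 2, 2 => I.Omega
  | 1, 3 => -I.Theta
  | _, _ => 0

/-! ### The double Lie group and its codiagonal -/

/-- The set `Γ = {(h₂, a₂, a₁, h₁) ∈ H₊ × H₋ × H₋ × H₊ | φ₊(h₂) φ₋(a₁) = φ₋(a₂) φ₊(h₁)}` of squares
of the double Lie group: `h₂` is the left, `a₂` the top, `a₁` the bottom and `h₁` the right edge. -/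
def Gam : Set (I.Hp × I.Hm × I.Hm × I.Hp) :=
  {ξ | I.φp ξ.1 * I.φm ξ.2.2.1 = I.φm ξ.2.1 * I.φp ξ.2.2.2}

/-- Triples `i ≤ j ≤ k` in `[n]`. -/
@[ext] structure Triple (n : ℕ) : Type where
  i : Fin (n + 1)
  j : Fin (n + 1)
  k : Fin (n + 1)
  hij : i ≤ j
  hjk : j ≤ k

/-- The image of a triple under a simplicial operator. -/
def Triple.map {m n : ℕ} (θ : Fin (m + 1) →o Fin (n + 1)) (t : Triple m) : Triple n :=
  ⟨θ t.i, θ t.j, θ t.k, θ.monotone t.hij, θ.monotone t.hjk⟩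

/-- The `n`-simplices of the Artin–Mazur codiagonal of the (bisimplicial nerve of the) double
group: staircase diagrams of composable squares. The vertices are the pairs `(i, j)` with
`i ≤ j`, where `i` numbers the rows and `j` the columns. For `i ≤ j ≤ k` there is a horizontal edge
`a ⟨i, j, k⟩` from `(i, j)` to `(i, k)` and a vertical edge `h ⟨i, j, k⟩` from `(i, k)` to `(j, k)`;
edges compose, and for `i ≤ j ≤ k ≤ l` the edges between `(i, k)`, `(i, l)`, `(j, k)`, `(j, l)`
form a square in `Γ`. The rows `0, …, p` and columns `p, …, n` form the component `x_p` in
bidegree `(p, n - p)` of the usual description of the codiagonal, `x_p` and `x_{p+1}` being glued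
along rows `0, …, p` and columns `p + 1, …, n`. -/
@[ext] structure Staircase (n : ℕ) : Type u where
  a : Triple n → I.Hm
  h : Triple n → I.Hp
  a_comp : ∀ (i j k l : Fin (n + 1)) (hij : i ≤ j) (hjk : j ≤ k) (hkl : k ≤ l),
    a ⟨i, j, k, hij, hjk⟩ * a ⟨i, k, l, hij.trans hjk, hkl⟩ = a ⟨i, j, l, hij, hjk.trans hkl⟩
  h_comp : ∀ (i j k l : Fin (n + 1)) (hij : i ≤ j) (hjk : j ≤ k) (hkl : k ≤ l),
    h ⟨i, j, l, hij, hjk.trans hkl⟩ * h ⟨j, k, l, hjk, hkl⟩ = h ⟨i, k, l, hij.trans hjk, hkl⟩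
  square : ∀ (i j k l : Fin (n + 1)) (hij : i ≤ j) (hjk : j ≤ k) (hkl : k ≤ l),
    (h ⟨i, j, k, hij, hjk⟩, a ⟨i, k, l, hij.trans hjk, hkl⟩, a ⟨j, k, l, hjk, hkl⟩,
      h ⟨i, j, l, hij, hjk.trans hkl⟩) ∈ I.Gam

/-- The simplicial operators of the codiagonal. -/
def Staircase.map {m n : ℕ} (θ : Fin (m + 1) →o Fin (n + 1)) (s : I.Staircase n) :
    I.Staircase m where
  a t := s.a (t.map θ)
  h t := s.h (t.map θ)
  a_comp _ _ _ _ hij hjk hkl := s.a_comp _ _ _ _ (θ.monotone hij) (θ.monotone hjk) (θ.monotone hkl)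
  h_comp _ _ _ _ hij hjk hkl := s.h_comp _ _ _ _ (θ.monotone hij) (θ.monotone hjk) (θ.monotone hkl)
  square _ _ _ _ hij hjk hkl := s.square _ _ _ _ (θ.monotone hij) (θ.monotone hjk) (θ.monotone hkl)

theorem Staircase.a_self {I : Integration.{u} T} {n : ℕ} (s : I.Staircase n) (i j : Fin (n + 1))
    (hij : i ≤ j) : s.a ⟨i, j, j, hij, le_rfl⟩ = 1 := by
  simpa using s.a_comp i j j j hij le_rfl le_rfl

theorem Staircase.h_self {I : Integration.{u} T} {n : ℕ} (s : I.Staircase n) (i j : Fin (n + 1))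
    (hij : i ≤ j) : s.h ⟨i, i, j, le_rfl, hij⟩ = 1 := by
  simpa using s.h_comp i i i j le_rfl le_rfl hij

/-- The `2`-simplex with coordinates `λ = (a₃, (h₃, a₂, a₁, h₂), h₁) ∈ H₋ × Γ × H₊`. -/
def ofLambda (a₃ : I.Hm) (ξ : I.Gam) (h₁ : I.Hp) : I.Staircase 2 where
  a t :=
    ((![![1, a₃, a₃ * ξ.1.2.1], ![1, 1, ξ.1.2.2.1], ![1, 1, 1]] :
        Fin 3 → Fin 3 → I.Hm) t.i t.j)⁻¹ *
      (![![1, a₃, a₃ * ξ.1.2.1], ![1, 1, ξ.1.2.2.1], ![1, 1, 1]] :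
        Fin 3 → Fin 3 → I.Hm) t.i t.k
  h t :=
    (![![1, 1, 1], ![ξ.1.1, 1, 1], ![ξ.1.2.2.2 * h₁, h₁, 1]] :
        Fin 3 → Fin 3 → I.Hp) t.k t.i *
      ((![![1, 1, 1], ![ξ.1.1, 1, 1], ![ξ.1.2.2.2 * h₁, h₁, 1]] :
        Fin 3 → Fin 3 → I.Hp) t.k t.j)⁻¹
  a_comp _ _ _ _ _ _ _ := by group
  h_comp _ _ _ _ _ _ _ := by group
  square i j k l hij hjk hkl := by
    have hξ := ξ.2
    simp only [Gam, Set.mem_ofPred_eq] at hξ ⊢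
    rcases hij.eq_or_lt with rfl | hij
    · simp
    rcases hkl.eq_or_lt with rfl | hkl
    · simp
    have hij' : i.1 < j.1 := hij
    have hkl' : k.1 < l.1 := hkl
    have hjk' : j.1 ≤ k.1 := hjk
    have hl := l.2
    obtain rfl : i = 0 := Fin.ext (show i.1 = 0 by omega)
    obtain rfl : j = 1 := Fin.ext (show j.1 = 1 by omega)
    obtain rfl : k = 1 := Fin.ext (show k.1 = 1 by omega)
    obtain rfl : l = 2 := Fin.ext (show l.1 = 2 by omega)
    simpa using hξ

/-- The `2`-simplices of the codiagonal are the elements of `H₋ × Γ × H₊`. -/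
theorem lambda_bijective : Function.Bijective (fun s : I.Staircase 2 =>
    ((s.a ⟨0, 0, 1, by decide, by decide⟩,
      ⟨_, s.square 0 1 1 2 (by decide) (by decide) (by decide)⟩,
      s.h ⟨1, 2, 2, by decide, by decide⟩) : I.Hm × I.Gam × I.Hp)) := by
  constructor
  · intro s s' e
    simp only [Prod.mk.injEq, Subtype.mk.injEq] at e
    obtain ⟨e1, ⟨e2, e3, e4, e5⟩, e6⟩ := e
    have c := s.a_comp 0 0 1 2 (by decide) (by decide) (by decide)
    have c' := s'.a_comp 0 0 1 2 (by decide) (by decide) (by decide)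
    have d := s.h_comp 0 1 2 2 (by decide) (by decide) (by decide)
    have d' := s'.h_comp 0 1 2 2 (by decide) (by decide) (by decide)
    ext t
    · obtain ⟨i, j, k, h1, h2⟩ := t
      fin_cases i <;> fin_cases j <;> fin_cases k <;>
        first | (exfalso; revert h1 h2; decide) | skip
      all_goals first
        | exact (s.a_self _ _ _).trans (s'.a_self _ _ _).symm
        | assumption
        | exact c.symm.trans ((congrArg₂ _ e1 e3).trans c')
    · obtain ⟨i, j, k, h1, h2⟩ := t
      fin_cases i <;> fin_cases j <;> fin_cases k <;>
        first | (exfalso; revert h1 h2; decide) | skip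
      all_goals first
        | exact (s.h_self _ _ _).trans (s'.h_self _ _ _).symm
        | assumption
        | exact d.symm.trans ((congrArg₂ _ e5 e6).trans d')
  · rintro ⟨a, ξ, h⟩
    refine ⟨I.ofLambda a ξ h, ?_⟩
    simp [ofLambda]

/-- The ambient product of copies of `H₋` and `H₊`, indexed by the edges. -/
def edgeGroup (n : ℕ) : Triple n ⊕ Triple n → Mfd.{u}
  | .inl _ => I.Hm.toMfd
  | .inr _ => I.Hp.toMfd

/-- The edges of a staircase. -/
def Staircase.edges {n : ℕ} (s : I.Staircase n) : ∀ e, I.edgeGroup n e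
  | .inl t => s.a t
  | .inr t => s.h t

/-- The simplicial manifold `Γ̄_•`: the structure exhibits `K` as the codiagonal, its levels
carrying the smooth structure of embedded submanifolds of the products of copies of `H₋` and `H₊`
in which the edges take values. This determines `K` up to a unique isomorphism. -/
structure GammaBar (K : SMfd.{u}) where
  equiv : ∀ n : ℕ, K.lev n ≃ I.Staircase n
  natural : ∀ {m n : ℕ} (θ : SimplexCategory.mk m ⟶ SimplexCategory.mk n) (x : K.lev n),
    equiv m (Mfd.map (K.map θ.op) x) = (equiv n x).map I θ.toOrderHom
  submanifold : ∀ n : ℕ, Mfd.IsSubmanifold (Set.range (Staircase.edges I (n := n))) (K.lev n)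
    (fun e x => Staircase.edges I (equiv n x) e)

namespace GammaBar

variable {I} {K : SMfd.{u}} (P : I.GammaBar K)

/-- The horizontal edges, as maps `Γ̄_n → H₋`. -/
def a {n : ℕ} (t : Triple n) (x : K.lev n) : I.Hm := (P.equiv n x).a t

/-- The vertical edges, as maps `Γ̄_n → H₊`. -/
def h {n : ℕ} (t : Triple n) (x : K.lev n) : I.Hp := (P.equiv n x).h t

/-! Coordinates `(a, h)` on `Γ̄_1 = H₋ × H₊`. -/

/-- The `H₋`-component of `(a, h) ∈ Γ̄_1`. -/
def a' : K.lev 1 → I.Hm := P.a ⟨0, 0, 1, by decide, by decide⟩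

/-- The `H₊`-component of `(a, h) ∈ Γ̄_1`. -/
def h' : K.lev 1 → I.Hp := P.h ⟨0, 1, 1, by decide, by decide⟩

/-! Coordinates `λ = (a₃, (h₃, a₂, a₁, h₂), h₁)` on `Γ̄_2 = H₋ × Γ × H₊`. -/

/-- The component `a₃` of `λ`. -/
def a₃ : K.lev 2 → I.Hm := P.a ⟨0, 0, 1, by decide, by decide⟩

/-- The component `h₃` of `λ`. -/
def h₃ : K.lev 2 → I.Hp := P.h ⟨0, 1, 1, by decide, by decide⟩

/-- The component `a₂` of `λ`. -/
def a₂ : K.lev 2 → I.Hm := P.a ⟨0, 1, 2, by decide, by decide⟩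

/-- The component `a₁` of `λ`. -/
def a₁ : K.lev 2 → I.Hm := P.a ⟨1, 1, 2, by decide, by decide⟩

/-- The component `h₂` of `λ`. -/
def h₂ : K.lev 2 → I.Hp := P.h ⟨0, 1, 2, by decide, by decide⟩

/-- The component `h₁` of `λ`. -/
def h₁ : K.lev 2 → I.Hp := P.h ⟨1, 2, 2, by decide, by decide⟩

/-! The faces `d_0 λ = (a₁, h₁)`, `d_1 λ = (a₃ a₂, h₂ h₁)`, `d_2 λ = (a₃, h₃)`. -/

theorem face_zero (x : K.lev 2) :
    P.a' (K.face 0 x) = P.a₁ x ∧ P.h' (K.face 0 x) = P.h₁ x := by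
  have e := P.natural (SimplexCategory.δ (0 : Fin 3)) x
  exact ⟨congrArg (fun s => s.a ⟨0, 0, 1, by decide, by decide⟩) e,
    congrArg (fun s => s.h ⟨0, 1, 1, by decide, by decide⟩) e⟩

theorem face_one (x : K.lev 2) :
    P.a' (K.face 1 x) = P.a₃ x * P.a₂ x ∧ P.h' (K.face 1 x) = P.h₂ x * P.h₁ x := by
  have e := P.natural (SimplexCategory.δ (1 : Fin 3)) x
  exact ⟨(congrArg (fun s => s.a ⟨0, 0, 1, by decide, by decide⟩) e).trans
      ((P.equiv 2 x).a_comp 0 0 1 2 (by decide) (by decide) (by decide)).symm,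
    (congrArg (fun s => s.h ⟨0, 1, 1, by decide, by decide⟩) e).trans
      ((P.equiv 2 x).h_comp 0 1 2 2 (by decide) (by decide) (by decide)).symm⟩

theorem face_two (x : K.lev 2) :
    P.a' (K.face 2 x) = P.a₃ x ∧ P.h' (K.face 2 x) = P.h₃ x := by
  have e := P.natural (SimplexCategory.δ (2 : Fin 3)) x
  exact ⟨congrArg (fun s => s.a ⟨0, 0, 1, by decide, by decide⟩) e,
    congrArg (fun s => s.h ⟨0, 1, 1, by decide, by decide⟩) e⟩

/-- `ω̄ = pr_Γ^* ω ∈ Ω²(Γ̄_2)`, where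
`ω = ⟨(t^h)^* θ^l_{H₊}, (s^v)^* θ^r_{H₋}⟩ - ⟨(t^v)^* θ^l_{H₋}, (s^h)^* θ^r_{H₊}⟩`. -/
def omega : Form (K.lev 2) 2 :=
  pairForm T.B (I.thetaLp P.h₃) (I.thetaRm P.a₁) - pairForm T.B (I.thetaLm P.a₂) (I.thetaRp P.h₂)

/-- `ω̄_• = ω̄ + 0 + 0`. -/
def omegaTotal : SMfd.Cochain K
  | 2, 2 => P.omega
  | _, _ => 0

/-- `β = ⟨θ^l_{H₋}, θ^r_{H₊}⟩ ∈ Ω²(Γ̄_1)`. -/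
def beta : Form (K.lev 1) 2 := pairForm T.B (I.thetaLm P.a') (I.thetaRp P.h')

/-- `β_• = β + 0`. -/
def betaTotal : SMfd.Cochain K
  | 1, 2 => P.beta
  | _, _ => 0

end GammaBar

end Integration

end

/-! The theorem rests on one geometric fact and one calculus of forms.

Geometry. Label the segment from `i` to `k` of a staircase by the horizontal edge from `(i,i)` to
`(i,k)` followed by the vertical edge from `(i,k)` to `(k,k)`, an element of `H₋ × H₊`. All edges
are quotients of labels, and the square relations say exactly that the products `φ₋(a) φ₊(h)` of the
labels form a multiplicative cocycle `g_ij g_jk = g_ik`, that is, a simplex of the nerve. Hence the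
staircases are the fibre product of `G^n` with a product of copies of `H₋ × H₊` over the
corresponding product of copies of `G`. Since `𝔤 = 𝔥₊ ⊕ 𝔥₋`, the map `H₋ × H₊ → G` is étale
everywhere (`Integration.etale_mulMap`), so its base change, the cocycle map to `NG_n`, is étale in
every degree (`Staircase.isLocalHomeomorph_nerveMap`). This provides the smooth structure on the
codiagonal and the morphism `Φ`.

In the nerve, horns of dimension at least 2 have unique fillers depending smoothly on the horn.
Local injectivity of étale maps transports the horn and matching conditions along `Φ`
(`SMfd.hornProj_of_etale`, `SMfd.matchProj_of_etale`). The injectivity statements hold because a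
label involves only two vertices, and enough faces contain both of them.

Forms. Everything is written with `polar f g = ⟨f^*θ^l, g^*θ^r⟩` and the pullback `cartan f` of the
Cartan 3-form, for maps `f, g` into `G`. Invariance of the pairing under `Ad` gives the cocycle
identity `polar_cocycle`, and with the Maurer–Cartan equation it gives `d (polar f g) = cartan g -
cartan (f g) + cartan f` (`deRham_polar`). The Jacobi identity gives `d (cartan f) = 0`. Isotropy
makes `polar` vanish on two maps into the same `H±`, and `cartan` vanish on a map into `H±`.
Closedness of `Ω_•` is then immediate, `ω̄ - Φ^*Ω = δβ` is a combination of four cocycle identities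
(`polar_mul_mul`), and `Φ^*Θ = -dβ` is the differential formula for the product `φ₋(a) φ₊(h)`.

Non-degeneracy. Étale horn projections leave only degree 1 in the tangent complex. There both
IM-forms equal `2⟨θ(v), θ(w)⟩`, with `θ` the isomorphism onto `𝔤` induced by an étale map to `G`, so
non-degeneracy of the pairing suffices. -/

noncomputable section

/-! ### Smooth maps and their tangent maps -/

namespace Mfd

variable {M N Q : Mfd.{u}}

/-- Smoothness of a map between manifolds. -/
abbrev Smooth (f : M → N) : Prop := ContMDiff 𝓘(ℝ, M.model) 𝓘(ℝ, N.model) ∞ f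

theorem Smooth.mdifferentiableAt {f : M → N} (hf : Smooth f) (x : M) :
    MDifferentiableAt 𝓘(ℝ, M.model) 𝓘(ℝ, N.model) f x :=
  hf.contMDiffAt.mdifferentiableAt (by simp)

theorem tmap_comp {g : N → Q} {f : M → N} (hg : Smooth g) (hf : Smooth f) (x : M) :
    tmap (fun y => g (f y)) x = (tmap g (f x)).comp (tmap f x) :=
  mfderiv_comp x (hg.mdifferentiableAt _) (hf.mdifferentiableAt x)

theorem tmap_id (x : M) : tmap (fun y : M => y) x = ContinuousLinearMap.id ℝ M.model :=
  mfderiv_id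

theorem tmap_const (c : N) (x : M) : tmap (fun _ : M => c) x = 0 :=
  mfderiv_const

end Mfd

/-! ### The left Maurer–Cartan form on vector spaces, in the chart at the identity -/

namespace LieGrp

variable (G : LieGrp.{u}) {E E' : Type*} [NormedAddCommGroup E] [NormedSpace ℝ E]
  [NormedAddCommGroup E'] [NormedSpace ℝ E']

/-- The left Maurer–Cartan form pulled back to a vector space. -/
def locL (F : E → G) (y : E) : E →L[ℝ] G.model :=
  fderiv ℝ (fun z => chartAt G.model (1 : G) ((F y)⁻¹ * F z)) y

variable {G}

/-- `locL F` is the partial derivative of this two-variable kernel in its second argument, taken on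
the diagonal. Joint smoothness is what makes `locL F` depend smoothly on the point. -/
theorem contDiffAt_kernel {U : Set E} (hU : IsOpen U) {F : E → G}
    (hF : ContMDiffOn 𝓘(ℝ, E) 𝓘(ℝ, G.model) ∞ F U) {y : E} (hy : y ∈ U) :
    ContDiffAt ℝ ∞ (fun p : E × E => chartAt G.model (1 : G) ((F p.1)⁻¹ * F p.2)) (y, y) := by
  rw [← contMDiffAt_iff_contDiffAt]
  have h : ContMDiffAt 𝓘(ℝ, E) 𝓘(ℝ, G.model) ∞ F y := (hF y hy).contMDiffAt (hU.mem_nhds hy)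
  have h1 : ContMDiffAt 𝓘(ℝ, E × E) 𝓘(ℝ, G.model) ∞ (fun p : E × E => F p.1) (y, y) :=
    ContMDiffAt.comp (x := ((y, y) : E × E)) (g := F) (f := Prod.fst) (I' := 𝓘(ℝ, E)) h
      contDiff_fst.contMDiff.contMDiffAt
  have h2 : ContMDiffAt 𝓘(ℝ, E × E) 𝓘(ℝ, G.model) ∞ (fun p : E × E => F p.2) (y, y) :=
    ContMDiffAt.comp (x := ((y, y) : E × E)) (g := F) (f := Prod.snd) (I' := 𝓘(ℝ, E)) h
      contDiff_snd.contMDiff.contMDiffAt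
  have h3 : ContMDiffAt 𝓘(ℝ, G.model) 𝓘(ℝ, G.model) ∞ (chartAt G.model (1 : G))
      ((F y)⁻¹ * F y) := by
    refine (contMDiffOn_chart (I := 𝓘(ℝ, G.model)) (x := (1 : G)) _ ?_).contMDiffAt ?_
    · simp
    · exact (chartAt G.model (1 : G)).open_source.mem_nhds (by simp)
  exact ContMDiffAt.comp (x := ((y, y) : E × E)) (I' := 𝓘(ℝ, G.model)) h3 (h1.inv.mul h2)

theorem contDiffAt_locL {U : Set E} (hU : IsOpen U) {F : E → G}
    (hF : ContMDiffOn 𝓘(ℝ, E) 𝓘(ℝ, G.model) ∞ F U) {y : E} (hy : y ∈ U) :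
    ContDiffAt ℝ ∞ (G.locL F) y :=
  ContDiffAt.fderiv (n := ∞)
    (f := fun y z => chartAt G.model (1 : G) ((F y)⁻¹ * F z)) (g := fun y => y)
    (contDiffAt_kernel hU hF hy) contDiffAt_id (by simp)

/-- A constant left factor cancels in `(F y)⁻¹ * F z`. This allows one to assume `F y = 1`, where
the chart at the identity is available. -/
theorem locL_mul_left (c : G) (F : E → G) : G.locL (fun z => c * F z) = G.locL F := by
  funext y
  simp only [locL, mul_inv_rev]
  congr 1
  funext z
  congr 1
  group

theorem locL_congr {F F' : E → G} {y : E} (h : F =ᶠ[nhds y] F') : G.locL F y = G.locL F' y := by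
  refine Filter.EventuallyEq.fderiv_eq ?_
  filter_upwards [h] with z hz
  rw [hz, h.eq_of_nhds]

theorem hasFDerivAt_kernel {U : Set E} (hU : IsOpen U) {F : E → G}
    (hF : ContMDiffOn 𝓘(ℝ, E) 𝓘(ℝ, G.model) ∞ F U) {y : E} (hy : y ∈ U) :
    HasFDerivAt (fun z => chartAt G.model (1 : G) ((F y)⁻¹ * F z)) (G.locL F y) y := by
  have h := (contDiffAt_kernel hU hF hy).comp y (g := fun p : E × E =>
    chartAt G.model (1 : G) ((F p.1)⁻¹ * F p.2)) (f := fun z => (y, z))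
    (contDiffAt_const.prodMk contDiffAt_id)
  exact (h.differentiableAt (by simp)).hasFDerivAt

theorem locL_comp {U : Set E} (hU : IsOpen U) {F : E → G}
    (hF : ContMDiffOn 𝓘(ℝ, E) 𝓘(ℝ, G.model) ∞ F U) {k : E' → E} {y : E'}
    (hk : DifferentiableAt ℝ k y) (hy : k y ∈ U) :
    G.locL (fun z => F (k z)) y = (G.locL F (k y)).comp (fderiv ℝ k y) :=
  ((hasFDerivAt_kernel hU hF hy).comp y hk.hasFDerivAt).fderiv

variable (G) in
theorem contMDiffOn_chart_one_symm :
    ContMDiffOn 𝓘(ℝ, G.model) 𝓘(ℝ, G.model) ∞ (chartAt G.model (1 : G)).symm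
      (chartAt G.model (1 : G)).target :=
  contMDiffOn_chart_symm

variable (G) in
theorem locL_chart_symm_one : G.locL (chartAt G.model (1 : G)).symm (chartAt G.model (1 : G) 1) =
    ContinuousLinearMap.id ℝ G.model := by
  have : (fun z => chartAt G.model (1 : G) (((chartAt G.model (1 : G)).symm
      (chartAt G.model (1 : G) 1))⁻¹ * (chartAt G.model (1 : G)).symm z)) =ᶠ[nhds
      (chartAt G.model (1 : G) 1)] fun z => z := by
    filter_upwards [(chartAt G.model (1 : G)).open_target.mem_nhds (mem_chart_target _ _)] with z hz
    rw [(chartAt G.model (1 : G)).left_inv (mem_chart_source _ _)]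
    simp [(chartAt G.model (1 : G)).right_inv hz]
  rw [locL, this.fderiv_eq]
  exact fderiv_id

end LieGrp

/-! ### Left-invariant vector fields and the bracket at the identity -/

namespace LieGrp

variable {G : LieGrp.{u}} {E E' : Type*} [NormedAddCommGroup E] [NormedSpace ℝ E]
  [NormedAddCommGroup E'] [NormedSpace ℝ E']

variable (G) in
/-- The left invariant vector field of `w`, read in the preferred chart at the identity. -/
def invField (w : G.lie) : G.model → G.model :=
  VectorField.mpullbackWithin 𝓘(ℝ, G.model) 𝓘(ℝ, G.model)
    (extChartAt 𝓘(ℝ, G.model) (1 : G)).symm (mulInvariantVectorField w)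
    (Set.range 𝓘(ℝ, G.model))

theorem mfderiv_chart_one : mfderiv 𝓘(ℝ, G.model) 𝓘(ℝ, G.model) (chartAt G.model (1 : G)) (1 : G) =
    ContinuousLinearMap.id ℝ G.model := by
  have h := (tangentBundleCore 𝓘(ℝ, G.model) G).coordChange_self (achart G.model (1 : G)) 1
    (mem_chart_source _ _)
  rw [mfderiv_chartAt_eq_tangentCoordChange (mem_chart_source _ _)]
  ext v
  exact h v

theorem smooth_mul_left (g : G) : Mfd.Smooth (M := G.toMfd) (N := G.toMfd) (fun z : G => g * z) :=
  contMDiff_mul_left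

theorem smooth_mul_right (g : G) : Mfd.Smooth (M := G.toMfd) (N := G.toMfd) (fun z : G => z * g) :=
  contMDiff_mul_right

/-- Left-invariant fields are dual to the Maurer–Cartan form. Their derivatives can then be computed
by differentiating `locL`, without unfolding the pullback that defines them. -/
theorem locL_invField (w : G.lie) {p : G.model} (hp : p ∈ (chartAt G.model (1 : G)).target) :
    G.locL (chartAt G.model (1 : G)).symm p (G.invField w p) = w := by
  set φ := chartAt G.model (1 : G) with hφ
  have hp' : p ∈ (extChartAt 𝓘(ℝ, G.model) (1 : G)).target := by simpa using hp
  have h1 := isInvertible_mfderivWithin_extChartAt_symm (I := 𝓘(ℝ, G.model)) hp'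
  have h2 : mfderivWithin 𝓘(ℝ, G.model) 𝓘(ℝ, G.model)
      (extChartAt 𝓘(ℝ, G.model) (1 : G)).symm (Set.range 𝓘(ℝ, G.model)) p =
      mfderiv 𝓘(ℝ, G.model) 𝓘(ℝ, G.model) φ.symm p := by
    simp [mfderivWithin_univ]
    rfl
  have h3 : mfderiv 𝓘(ℝ, G.model) 𝓘(ℝ, G.model) φ.symm p (G.invField w p) =
      mulInvariantVectorField w (φ.symm p) := by
    rw [← h2]
    exact h1.self_apply_inverse _
  have s1 : MDifferentiableAt 𝓘(ℝ, G.model) 𝓘(ℝ, G.model) φ.symm p :=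
    ((G.contMDiffOn_chart_one_symm _ hp).contMDiffAt (φ.open_target.mem_nhds hp)).mdifferentiableAt
      (by simp)
  -- Products such as `g⁻¹ * g` equal `1` only propositionally, while the tangent space depends on
  -- the point; hence the formulation for an arbitrary point equal to `1`.
  have s3 : ∀ x : G, x = 1 → MDifferentiableAt 𝓘(ℝ, G.model) 𝓘(ℝ, G.model) φ x := by
    rintro _ rfl
    exact (contMDiffAt_of_mem_maximalAtlas (I := 𝓘(ℝ, G.model)) (n := ∞)
      (IsManifold.chart_mem_maximalAtlas _) (mem_chart_source _ _)).mdifferentiableAt (by simp)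
  have s2 : MDifferentiableAt 𝓘(ℝ, G.model) 𝓘(ℝ, G.model) (fun z : G => φ ((φ.symm p)⁻¹ * z))
      (φ.symm p) :=
    MDifferentiableAt.comp (φ.symm p) (s3 _ (by simp))
      ((smooth_mul_left (φ.symm p)⁻¹).mdifferentiableAt _)
  have e1 : G.locL φ.symm p = (mfderiv 𝓘(ℝ, G.model) 𝓘(ℝ, G.model)
      (fun z : G => φ ((φ.symm p)⁻¹ * z)) (φ.symm p)).comp
        (mfderiv 𝓘(ℝ, G.model) 𝓘(ℝ, G.model) φ.symm p) := by
    rw [locL, ← mfderiv_eq_fderiv]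
    exact mfderiv_comp p s2 s1
  set D : G.model →L[ℝ] G.model := mfderiv 𝓘(ℝ, G.model) 𝓘(ℝ, G.model)
    (fun z : G => φ ((φ.symm p)⁻¹ * z)) (φ.symm p) with hD
  have e4 : G.locL φ.symm p (G.invField w p) = D (mulInvariantVectorField w (φ.symm p)) :=
    (congrArg (fun A : G.model →L[ℝ] G.model => A (G.invField w p)) e1).trans (congrArg D h3)
  -- The invariant field at `φ.symm p` is the translate of `w`; translating it back composes to the
  -- identity, leaving only the derivative of the chart at `1`.
  have e2 : mfderiv 𝓘(ℝ, G.model) 𝓘(ℝ, G.model) (fun z : G => φ ((φ.symm p)⁻¹ * (φ.symm p * z))) 1 =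
      (mfderiv 𝓘(ℝ, G.model) 𝓘(ℝ, G.model)
      (fun z : G => φ ((φ.symm p)⁻¹ * z)) (φ.symm p * 1)).comp
        (mfderiv 𝓘(ℝ, G.model) 𝓘(ℝ, G.model) (fun z : G => φ.symm p * z) 1) :=
    mfderiv_comp (1 : G) (g := fun z : G => φ ((φ.symm p)⁻¹ * z)) (f := fun z : G => φ.symm p * z)
      (by rw [mul_one]; exact s2) ((smooth_mul_left (φ.symm p)).mdifferentiableAt _)
  have e5 : (mfderiv 𝓘(ℝ, G.model) 𝓘(ℝ, G.model) (fun z : G => φ ((φ.symm p)⁻¹ * z))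
      (φ.symm p * 1) : G.model →L[ℝ] G.model) = D := by
    have : ∀ q : G, q = φ.symm p → (mfderiv 𝓘(ℝ, G.model) 𝓘(ℝ, G.model)
        (fun z : G => φ ((φ.symm p)⁻¹ * z)) q : G.model →L[ℝ] G.model) = D := by
      rintro _ rfl
      rfl
    exact this _ (mul_one _)
  have e6 : (fun z : G => φ ((φ.symm p)⁻¹ * (φ.symm p * z))) = φ :=
    funext fun z => congrArg φ (inv_mul_cancel_left _ _)
  have e7 : mfderiv 𝓘(ℝ, G.model) 𝓘(ℝ, G.model) (fun z : G => φ ((φ.symm p)⁻¹ * (φ.symm p * z))) 1 w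
      = mfderiv 𝓘(ℝ, G.model) 𝓘(ℝ, G.model) φ (1 : G) w :=
    congrArg (fun f : G → G.model => mfderiv 𝓘(ℝ, G.model) 𝓘(ℝ, G.model) f (1 : G) w) e6
  have e3 := congrArg (fun A : G.model →L[ℝ] G.model => A w) (mfderiv_chart_one (G := G))
  have e8 := congrArg (fun A : G.model →L[ℝ] G.model => A w) e2
  exact e4.trans ((congrArg (fun A : G.model →L[ℝ] G.model =>
    A (mulInvariantVectorField w (φ.symm p))) e5).symm.trans (e8.symm.trans (e7.trans e3)))

theorem lie_eq_fderiv_invField (v w : G.lie) : (⁅v, w⁆ : G.lie) =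
    fderiv ℝ (G.invField w) (chartAt G.model (1 : G) 1) (G.invField v (chartAt G.model (1 : G) 1)) -
    fderiv ℝ (G.invField v) (chartAt G.model (1 : G) 1) (G.invField w (chartAt G.model (1 : G) 1)) := by
  rw [GroupLieAlgebra.bracket_def]
  have h := VectorField.mlieBracketWithin_apply (I := 𝓘(ℝ, G.model))
    (V := mulInvariantVectorField v) (W := mulInvariantVectorField w) (s := Set.univ) (x₀ := (1 : G))
  have e : mfderiv 𝓘(ℝ, G.model) 𝓘(ℝ, G.model) (extChartAt 𝓘(ℝ, G.model) (1 : G)) (1 : G) =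
    ContinuousLinearMap.id ℝ G.model := mfderiv_chart_one
  rw [VectorField.mlieBracketWithin_univ] at h
  rw [h]
  have h2 : ((extChartAt 𝓘(ℝ, G.model) (1 : G)).symm ⁻¹' Set.univ ∩ Set.range 𝓘(ℝ, G.model)) =
      Set.univ := by simp
  rw [h2]
  refine (congrArg (fun A : G.model →L[ℝ] G.model => A.inverse _) e).trans ?_
  rw [ContinuousLinearMap.inverse_id]
  exact congrFun (VectorField.lieBracketWithin_univ (𝕜 := ℝ) (V := G.invField v)
    (W := G.invField w)) _

/-- Writing `A` for the Maurer–Cartan form in the chart, differentiate `A (invField w) = w` at the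
identity, where `A` is the identity: the derivative of `invField w` along `v` is `-(dA v) w`.
Antisymmetrising gives minus the bracket. Other points reduce to this one by left translation. -/
theorem locL_chart_symm_antisymm (v w : G.lie) :
    fderiv ℝ (G.locL (chartAt G.model (1 : G)).symm) (chartAt G.model (1 : G) 1) v w -
    fderiv ℝ (G.locL (chartAt G.model (1 : G)).symm) (chartAt G.model (1 : G) 1) w v =
      -(⁅v, w⁆ : G.lie) := by
  set φ := chartAt G.model (1 : G) with hφ
  set p := φ 1
  have hp : p ∈ φ.target := mem_chart_target _ _
  set A := G.locL φ.symm with hA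
  have hA1 : A p = ContinuousLinearMap.id ℝ G.model := G.locL_chart_symm_one
  have hAs : ContDiffAt ℝ ∞ A p := contDiffAt_locL φ.open_target G.contMDiffOn_chart_one_symm hp
  have hAd : HasFDerivAt A (fderiv ℝ A p) p := (hAs.differentiableAt (by simp)).hasFDerivAt
  have key : ∀ w : G.model, G.invField w p = w ∧ ∀ v, fderiv ℝ (G.invField w) p v =
      -fderiv ℝ A p v w := by
    intro w
    have h0 : G.invField w p = w := by
      have := locL_invField w hp
      rw [← hφ, ← hA, hA1] at this
      exact this
    have hinv : ContDiffAt ℝ ∞ (fun q => (A q).inverse) p := by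
      have : ContDiffAt ℝ ∞ ContinuousLinearMap.inverse (A p) := by
        rw [hA1]
        exact contDiffAt_map_inverse (ContinuousLinearEquiv.refl ℝ G.model)
      exact this.comp p hAs
    have hev : G.invField w =ᶠ[nhds p] fun q => (A q).inverse w := by
      have hne : ∀ᶠ q in nhds p, (A q).IsInvertible := by
        have : {B : G.model →L[ℝ] G.model | B.IsInvertible} ∈ nhds (A p) := by
          rw [hA1]
          exact ContinuousLinearEquiv.nhds (ContinuousLinearEquiv.refl ℝ G.model)
        exact hAs.continuousAt this
      filter_upwards [hne, φ.open_target.mem_nhds hp] with q hq hq'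
      have := locL_invField w hq'
      rw [← hφ, ← hA] at this
      rw [← hq.inverse_apply_self (G.invField w q), this]
    have hd : DifferentiableAt ℝ (G.invField w) p :=
      ((hinv.clm_apply contDiffAt_const).differentiableAt (by simp)).congr_of_eventuallyEq hev
    refine ⟨h0, fun v => ?_⟩
    have h1 := hAd.clm_apply hd.hasFDerivAt
    have h2 : HasFDerivAt (fun q => A q (G.invField w q)) (0 : G.model →L[ℝ] G.model) p := by
      refine (hasFDerivAt_const w p).congr_of_eventuallyEq ?_
      filter_upwards [φ.open_target.mem_nhds hp] with q hq
      exact locL_invField w hq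
    have h3 := congrArg (fun B : G.model →L[ℝ] G.model => B v) (h1.unique h2)
    simp only [hA1, h0] at h3
    exact eq_neg_of_add_eq_zero_left h3
  have h := lie_eq_fderiv_invField v w
  rw [← hφ, (key v).1, (key w).1] at h
  refine Eq.trans ?_ (congrArg (fun z : G.model => -z) h).symm
  refine Eq.trans ?_ (congrArg₂ (fun a b : G.model => -(a - b)) ((key w).2 v) ((key v).2 w)).symm
  abel

end LieGrp

/-! ### The Maurer–Cartan equation; derivatives of products and conjugations -/

namespace LieGrp

variable {G : LieGrp.{u}} {E E' : Type*} [NormedAddCommGroup E] [NormedSpace ℝ E]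
  [NormedAddCommGroup E'] [NormedSpace ℝ E']

variable (G) in
/-- The bracket of the Lie algebra of `G`, on the model space. -/
def brk (a b : G.model) : G.model := @Bracket.bracket G.lie G.lie _ a b

theorem contDiffAt_chart_comp {α : E → G} {y : E} (hα : ContMDiffAt 𝓘(ℝ, E) 𝓘(ℝ, G.model) ∞ α y)
    (h : α y = 1) : ContDiffAt ℝ ∞ (fun z => chartAt G.model (1 : G) (α z)) y := by
  rw [← contMDiffAt_iff_contDiffAt]
  have h3 : ContMDiffAt 𝓘(ℝ, G.model) 𝓘(ℝ, G.model) ∞ (chartAt G.model (1 : G)) (α y) := by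
    rw [h]
    exact contMDiffAt_of_mem_maximalAtlas (IsManifold.chart_mem_maximalAtlas _)
      (mem_chart_source _ _)
  exact h3.comp y hα

omit [NormedSpace ℝ E] in
theorem eventually_chart_symm_comp {α : E → G} {y : E} (hα : ContinuousAt α y) (h : α y = 1) :
    ∀ᶠ z in nhds y, (chartAt G.model (1 : G)).symm (chartAt G.model (1 : G) (α z)) = α z := by
  have : (chartAt G.model (1 : G)).source ∈ nhds (α y) := by
    rw [h]
    exact (chartAt G.model (1 : G)).open_source.mem_nhds (mem_chart_source _ _)
  filter_upwards [hα this] with z hz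
  exact (chartAt G.model (1 : G)).left_inv hz

/-- The Maurer–Cartan equation. -/
theorem locL_antisymm {U : Set E} (hU : IsOpen U) {F : E → G}
    (hF : ContMDiffOn 𝓘(ℝ, E) 𝓘(ℝ, G.model) ∞ F U) {y : E} (hy : y ∈ U) (u v : E) :
    fderiv ℝ (G.locL F) y u v - fderiv ℝ (G.locL F) y v u =
      -G.brk (G.locL F y u) (G.locL F y v) := by
  set φ := chartAt G.model (1 : G) with hφ
  set F' : E → G := fun z => (F y)⁻¹ * F z with hF'
  have hF's : ContMDiffOn 𝓘(ℝ, E) 𝓘(ℝ, G.model) ∞ F' U := fun z hz =>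
    ((smooth_mul_left (F y)⁻¹) _).comp_contMDiffWithinAt z (hF z hz)
  have hF'1 : F' y = 1 := by simp [hF']
  have hFa : ∀ z ∈ U, ContMDiffAt 𝓘(ℝ, E) 𝓘(ℝ, G.model) ∞ F' z := fun z hz =>
    (hF's z hz).contMDiffAt (hU.mem_nhds hz)
  set k : E → G.model := fun z => φ (F' z) with hk
  have hks : ContDiffAt ℝ ∞ k y := contDiffAt_chart_comp (hFa y hy) hF'1
  have hky : k y = φ 1 := by simp [hk, hF'1]
  set A := G.locL φ.symm
  have hp : φ 1 ∈ φ.target := mem_chart_target _ _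
  have hA : ContDiffAt ℝ ∞ A (k y) := by
    rw [hky]
    exact contDiffAt_locL φ.open_target G.contMDiffOn_chart_one_symm hp
  have hsrc : ∀ᶠ z in nhds y, F' z ∈ φ.source := by
    have : φ.source ∈ nhds (F' y) := by
      rw [hF'1]
      exact φ.open_source.mem_nhds (mem_chart_source _ _)
    exact (hFa y hy).continuousAt this
  have hkd : ∀ᶠ z in nhds y, DifferentiableAt ℝ k z :=
    ((hks.of_le (m := 1) (by simp)).eventually (by simp)).mono fun z hz =>
      hz.differentiableAt (by simp)
  -- After translation to the identity `F` factors as `φ.symm ∘ k`, so its form is the pullback of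
  -- `A` along `k`. The derivative has two terms: the second derivative of `k`, which is symmetric
  -- and cancels, and the derivative of `A`, already known at the identity.
  have hev : G.locL F =ᶠ[nhds y] fun z => (A (k z)).comp (fderiv ℝ k z) := by
    filter_upwards [hsrc.eventually_nhds, hkd] with z hz hkz
    rw [← locL_mul_left (F y)⁻¹ F, ← locL_comp φ.open_target G.contMDiffOn_chart_one_symm hkz
      (φ.map_source hz.self_of_nhds)]
    refine locL_congr ?_
    filter_upwards [hz] with w hw
    exact (φ.left_inv hw).symm
  have hk2 : HasFDerivAt (fderiv ℝ k) (fderiv ℝ (fderiv ℝ k) y) y :=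
    ((hks.fderiv_right (m := 1) (by rw [one_add_one_eq_two]; exact ENat.LEInfty.out)).differentiableAt (by simp)).hasFDerivAt
  have hAk := (hA.differentiableAt (by simp)).hasFDerivAt.comp y
    (hks.differentiableAt (by simp)).hasFDerivAt
  have hd := (hAk.clm_comp hk2).congr_of_eventuallyEq hev
  have hA1 : A (k y) = ContinuousLinearMap.id ℝ G.model := by
    rw [hky]
    exact G.locL_chart_symm_one
  have hsymm : fderiv ℝ (fderiv ℝ k) y u v = fderiv ℝ (fderiv ℝ k) y v u :=
    (hks.of_le (m := 2) ENat.LEInfty.out).isSymmSndFDerivAt (by simp) u v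
  have hFy : G.locL F y = fderiv ℝ k y := by rw [hev.eq_of_nhds, hA1]; rfl
  have hmc := locL_chart_symm_antisymm (G := G) (fderiv ℝ k y u) (fderiv ℝ k y v)
  rw [hd.fderiv, hFy]
  simp only [hA1, Function.comp_apply, add_apply,
    ContinuousLinearMap.comp_apply, ContinuousLinearMap.compL_apply,
    ContinuousLinearMap.flip_apply, ContinuousLinearMap.id_apply, hsymm]
  rw [add_sub_add_left_eq_sub, hky]
  exact hmc

/-- The derivative of the multiplication at `(1, 1)` exists by smoothness, so it is determined on
the two axes, where one factor is `1` and the product is the identity map. -/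
theorem hasFDerivAt_chart_mul : HasFDerivAt
    (fun p : G.model × G.model => chartAt G.model (1 : G)
      ((chartAt G.model (1 : G)).symm p.1 * (chartAt G.model (1 : G)).symm p.2))
    (ContinuousLinearMap.fst ℝ G.model G.model + ContinuousLinearMap.snd ℝ G.model G.model)
    (chartAt G.model (1 : G) 1, chartAt G.model (1 : G) 1) := by
  set φ := chartAt G.model (1 : G) with hφ
  have hp : φ 1 ∈ φ.target := mem_chart_target _ _
  have hs : ContMDiffAt 𝓘(ℝ, G.model) 𝓘(ℝ, G.model) ∞ φ.symm (φ 1) :=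
    (G.contMDiffOn_chart_one_symm _ hp).contMDiffAt (φ.open_target.mem_nhds hp)
  have e1 : φ.symm (φ 1) = 1 := φ.left_inv (mem_chart_source _ _)
  have h1 : ContMDiffAt 𝓘(ℝ, G.model × G.model) 𝓘(ℝ, G.model) ∞
      (fun p : G.model × G.model => φ.symm p.1) (φ 1, φ 1) :=
    ContMDiffAt.comp (x := ((φ 1, φ 1) : G.model × G.model)) (g := φ.symm) (f := Prod.fst)
      (I' := 𝓘(ℝ, G.model)) hs contDiff_fst.contMDiff.contMDiffAt
  have h2 : ContMDiffAt 𝓘(ℝ, G.model × G.model) 𝓘(ℝ, G.model) ∞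
      (fun p : G.model × G.model => φ.symm p.2) (φ 1, φ 1) :=
    ContMDiffAt.comp (x := ((φ 1, φ 1) : G.model × G.model)) (g := φ.symm) (f := Prod.snd)
      (I' := 𝓘(ℝ, G.model)) hs contDiff_snd.contMDiff.contMDiffAt
  have h3 := contDiffAt_chart_comp (h1.mul h2) (by simp [e1])
  have h4 := (h3.differentiableAt (by simp)).hasFDerivAt
  have ht : ∀ᶠ z in nhds (φ 1), φ (φ.symm z) = z := by
    filter_upwards [φ.open_target.mem_nhds hp] with z hz
    exact φ.right_inv hz
  refine h4.congr_fderiv (Eq.symm ?_)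
  refine ContinuousLinearMap.prod_ext (R := ℝ) (M := G.model) (M₂ := G.model) (M₃ := G.model) ?_ ?_
  · have h5 := h4.comp (φ 1) (f := fun z => (z, φ 1))
      ((hasFDerivAt_id (𝕜 := ℝ) (φ 1)).prodMk (hasFDerivAt_const (𝕜 := ℝ) (φ 1) (φ 1)))
    have h6 := (hasFDerivAt_id (𝕜 := ℝ) (φ 1)).congr_of_eventuallyEq
      (f₁ := fun z => φ (φ.symm z * φ.symm (φ 1)))
      (by filter_upwards [ht] with z hz; simp [e1, hz])
    have h7 := h6.unique h5
    ext v
    have := congrArg (fun A : G.model →L[ℝ] G.model => A v) h7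
    simpa using this
  · have h5 := h4.comp (φ 1) (f := fun z => (φ 1, z))
      ((hasFDerivAt_const (𝕜 := ℝ) (φ 1) (φ 1)).prodMk (hasFDerivAt_id (𝕜 := ℝ) (φ 1)))
    have h6 := (hasFDerivAt_id (𝕜 := ℝ) (φ 1)).congr_of_eventuallyEq
      (f₁ := fun z => φ (φ.symm (φ 1) * φ.symm z))
      (by filter_upwards [ht] with z hz; simp [e1, hz])
    have h7 := h6.unique h5
    ext v
    have := congrArg (fun A : G.model →L[ℝ] G.model => A v) h7
    simpa using this

theorem fderiv_chart_mul {α γ : E → G} {y : E}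
    (hα : ContMDiffAt 𝓘(ℝ, E) 𝓘(ℝ, G.model) ∞ α y) (hα1 : α y = 1)
    (hγ : ContMDiffAt 𝓘(ℝ, E) 𝓘(ℝ, G.model) ∞ γ y) (hγ1 : γ y = 1) :
    fderiv ℝ (fun z => chartAt G.model (1 : G) (α z * γ z)) y =
      fderiv ℝ (fun z => chartAt G.model (1 : G) (α z)) y +
      fderiv ℝ (fun z => chartAt G.model (1 : G) (γ z)) y := by
  have h1 := ((contDiffAt_chart_comp hα hα1).differentiableAt (by simp)).hasFDerivAt
  have h2 := ((contDiffAt_chart_comp hγ hγ1).differentiableAt (by simp)).hasFDerivAt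
  have h3 := hasFDerivAt_chart_mul (G := G)
  have h4 : HasFDerivAt
      (fun p : G.model × G.model => chartAt G.model (1 : G)
        ((chartAt G.model (1 : G)).symm p.1 * (chartAt G.model (1 : G)).symm p.2))
      (ContinuousLinearMap.fst ℝ G.model G.model + ContinuousLinearMap.snd ℝ G.model G.model)
      (chartAt G.model (1 : G) (α y), chartAt G.model (1 : G) (γ y)) := by
    rw [hα1, hγ1]
    exact h3
  have h5 := (h4.comp y (h1.prodMk h2)).congr_of_eventuallyEq
    (f₁ := fun z => chartAt G.model (1 : G) (α z * γ z)) (by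
      filter_upwards [eventually_chart_symm_comp hα.continuousAt hα1,
        eventually_chart_symm_comp hγ.continuousAt hγ1] with z hz hz'
      simp [hz, hz'])
  rw [h5.fderiv]
  ext v
  simp

variable (G) in
/-- The adjoint action, in the preferred chart at the identity. -/
def Ad (c : G) : G.model →L[ℝ] G.model :=
  fderiv ℝ (fun p => chartAt G.model (1 : G) (c * (chartAt G.model (1 : G)).symm p * c⁻¹))
    (chartAt G.model (1 : G) 1)

theorem fderiv_chart_conj (c : G) {α : E → G} {y : E}
    (hα : ContMDiffAt 𝓘(ℝ, E) 𝓘(ℝ, G.model) ∞ α y) (hα1 : α y = 1) :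
    fderiv ℝ (fun z => chartAt G.model (1 : G) (c * α z * c⁻¹)) y =
      (G.Ad c).comp (fderiv ℝ (fun z => chartAt G.model (1 : G) (α z)) y) := by
  set φ := chartAt G.model (1 : G) with hφ
  have hp : φ 1 ∈ φ.target := mem_chart_target _ _
  have e1 : φ.symm (φ 1) = 1 := φ.left_inv (mem_chart_source _ _)
  have hs : ContMDiffAt 𝓘(ℝ, G.model) 𝓘(ℝ, G.model) ∞ φ.symm (φ 1) :=
    (G.contMDiffOn_chart_one_symm _ hp).contMDiffAt (φ.open_target.mem_nhds hp)
  have hc : ContMDiffAt 𝓘(ℝ, G.model) 𝓘(ℝ, G.model) ∞ (fun z => c * φ.symm z * c⁻¹) (φ 1) :=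
    (contMDiffAt_const.mul hs).mul contMDiffAt_const
  have hd : HasFDerivAt (fun z => φ (c * φ.symm z * c⁻¹)) (G.Ad c) (φ (α y)) := by
    rw [hα1]
    exact ((contDiffAt_chart_comp hc (by simp [e1])).differentiableAt (by simp)).hasFDerivAt
  have h1 := ((contDiffAt_chart_comp hα hα1).differentiableAt (by simp)).hasFDerivAt
  refine ((hd.comp y h1).congr_of_eventuallyEq ?_).fderiv
  filter_upwards [eventually_chart_symm_comp hα.continuousAt hα1] with z hz
  rw [← hφ] at hz
  simp [← hφ, hz]

end LieGrp

/-! ### The adjoint action and invariant bilinear forms -/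

namespace LieGrp

variable {G : LieGrp.{u}} {E E' : Type*} [NormedAddCommGroup E] [NormedSpace ℝ E]
  [NormedAddCommGroup E'] [NormedSpace ℝ E']

variable (G) in
theorem contMDiffAt_chart_one_symm {p : G.model} (hp : p ∈ (chartAt G.model (1 : G)).target) :
    ContMDiffAt 𝓘(ℝ, G.model) 𝓘(ℝ, G.model) ∞ (chartAt G.model (1 : G)).symm p :=
  (G.contMDiffOn_chart_one_symm _ hp).contMDiffAt
    ((chartAt G.model (1 : G)).open_target.mem_nhds hp)

variable (G) in
theorem Ad_one : G.Ad 1 = ContinuousLinearMap.id ℝ G.model := by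
  have : (fun z => chartAt G.model (1 : G) (1 * (chartAt G.model (1 : G)).symm z * 1⁻¹))
      =ᶠ[nhds (chartAt G.model (1 : G) 1)] fun z => z := by
    filter_upwards [(chartAt G.model (1 : G)).open_target.mem_nhds (mem_chart_target _ _)] with z hz
    simp [(chartAt G.model (1 : G)).right_inv hz]
  rw [Ad, this.fderiv_eq]
  exact fderiv_id

theorem Ad_mul (c d : G) : G.Ad (c * d) = (G.Ad c).comp (G.Ad d) := by
  have h := fderiv_chart_conj c (α := fun p => d * (chartAt G.model (1 : G)).symm p * d⁻¹)
    (y := chartAt G.model (1 : G) 1)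
    ((contMDiffAt_const.mul (G.contMDiffAt_chart_one_symm (mem_chart_target _ _))).mul
      contMDiffAt_const) (by simp)
  simp only [← mul_assoc] at h
  rw [Ad, Ad, Ad, mul_inv_rev]
  simp only [← mul_assoc]
  exact h

theorem Ad_mul_apply (c d : G) (v : G.model) : G.Ad (c * d) v = G.Ad c (G.Ad d v) := by
  rw [Ad_mul]
  rfl

theorem Ad_apply_Ad_inv (c : G) (v : G.model) : G.Ad c (G.Ad c⁻¹ v) = v := by
  rw [← Ad_mul_apply, mul_inv_cancel, Ad_one]
  rfl

theorem contMDiffAt_left_translate {F : E → G} {y : E}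
    (hF : ContMDiffAt 𝓘(ℝ, E) 𝓘(ℝ, G.model) ∞ F y) :
    ContMDiffAt 𝓘(ℝ, E) 𝓘(ℝ, G.model) ∞ (fun z => (F y)⁻¹ * F z) y :=
  contMDiffAt_const.mul hF

/-- The element `(F F')(y)⁻¹ (F F')(z)` is the conjugate of `F(y)⁻¹ F(z)` by `F'(y)⁻¹`, times
`F'(y)⁻¹ F'(z)`. Both factors are `1` at `z = y`, where the derivative of a product is a sum. -/
theorem locL_mul {F F' : E → G} {y : E} (hF : ContMDiffAt 𝓘(ℝ, E) 𝓘(ℝ, G.model) ∞ F y)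
    (hF' : ContMDiffAt 𝓘(ℝ, E) 𝓘(ℝ, G.model) ∞ F' y) :
    G.locL (fun z => F z * F' z) y = (G.Ad (F' y)⁻¹).comp (G.locL F y) + G.locL F' y := by
  have h := fderiv_chart_mul (α := fun z => (F' y)⁻¹ * ((F y)⁻¹ * F z) * ((F' y)⁻¹)⁻¹)
    ((contMDiffAt_const.mul (contMDiffAt_left_translate hF)).mul contMDiffAt_const) (by simp)
    (contMDiffAt_left_translate hF') (by simp)
  rw [fderiv_chart_conj (F' y)⁻¹ (contMDiffAt_left_translate hF) (by simp)] at h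
  simp only [locL]
  rw [← h]
  congr 1
  funext z
  congr 1
  group

theorem locL_const (c : G) (y : E) : G.locL (fun _ : E => c) y = 0 := by
  simp [locL]

theorem locL_inv {F : E → G} {y : E} (hF : ContMDiffAt 𝓘(ℝ, E) 𝓘(ℝ, G.model) ∞ F y) :
    G.locL (fun z => (F z)⁻¹) y = -(G.Ad (F y)).comp (G.locL F y) := by
  have h := locL_mul hF hF.inv
  simp only [mul_inv_cancel, locL_const, inv_inv] at h
  exact (neg_eq_of_add_eq_zero_right h.symm).symm

theorem fderiv_chart_right {F : E → G} {y : E}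
    (hF : ContMDiffAt 𝓘(ℝ, E) 𝓘(ℝ, G.model) ∞ F y) :
    fderiv ℝ (fun z => chartAt G.model (1 : G) (F z * (F y)⁻¹)) y =
      (G.Ad (F y)).comp (G.locL F y) := by
  have h := fderiv_chart_conj (F y) (contMDiffAt_left_translate hF) (by simp)
  rw [locL, ← h]
  congr 1
  funext z
  congr 1
  group

theorem locL_conj (c : G) {F : E → G} {y : E}
    (hF : ContMDiffAt 𝓘(ℝ, E) 𝓘(ℝ, G.model) ∞ F y) :
    G.locL (fun z => c * F z * c⁻¹) y = (G.Ad c).comp (G.locL F y) := by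
  have h := fderiv_chart_conj c (contMDiffAt_left_translate hF) (by simp)
  rw [locL, locL, ← h]
  congr 1
  funext z
  congr 1
  group

/-- Conjugation by `c` composes the Maurer–Cartan form with the constant map `Ad c`. Comparing the
Maurer–Cartan equations of `φ.symm` and of its conjugate at the identity gives the claim. -/
theorem Ad_brk (c : G) (v w : G.model) : G.Ad c (G.brk v w) = G.brk (G.Ad c v) (G.Ad c w) := by
  set φ := chartAt G.model (1 : G) with hφ
  have hp : φ 1 ∈ φ.target := mem_chart_target _ _
  have hs := G.contMDiffOn_chart_one_symm
  rw [← hφ] at hs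
  have h1 := locL_antisymm φ.open_target hs hp v w
  have hs' : ContMDiffOn 𝓘(ℝ, G.model) 𝓘(ℝ, G.model) ∞ (fun z => c * φ.symm z * c⁻¹) φ.target :=
    (contMDiffOn_const.mul hs).mul contMDiffOn_const
  have h2 := locL_antisymm φ.open_target hs' hp v w
  have hev : G.locL (fun z => c * φ.symm z * c⁻¹) =ᶠ[nhds (φ 1)]
      fun z => (G.Ad c).comp (G.locL φ.symm z) := by
    filter_upwards [φ.open_target.mem_nhds hp] with z hz
    exact locL_conj c (G.contMDiffAt_chart_one_symm hz)
  have hd : HasFDerivAt (G.locL φ.symm) (fderiv ℝ (G.locL φ.symm) (φ 1)) (φ 1) :=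
    ((contDiffAt_locL φ.open_target hs hp).differentiableAt (by simp)).hasFDerivAt
  have hd2 := ((hasFDerivAt_const (G.Ad c) (φ 1)).clm_comp hd).congr_of_eventuallyEq hev
  have e1 : G.locL φ.symm (φ 1) = ContinuousLinearMap.id ℝ G.model := G.locL_chart_symm_one
  rw [hd2.fderiv, hev.eq_of_nhds, e1] at h2
  rw [e1] at h1
  simp only [ContinuousLinearMap.comp_id, ContinuousLinearMap.comp_zero, add_zero,
    ContinuousLinearMap.comp_apply, ContinuousLinearMap.compL_apply] at h2
  rw [← map_sub, h1] at h2
  simpa using h2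

/-- The Maurer–Cartan equation for the two-variable product `P`, on the vectors `(u, 0)` and `(0,
v)` at `(1, q)`, is the formula for the derivative of `Ad`: the value of the form on `(u, 0)` is `Ad
(φ.symm q)⁻¹ u`, and on `(0, v)` it is the Maurer–Cartan form of the second factor. -/
theorem hasFDerivAt_Ad_inv (u : G.model) {q : G.model}
    (hq : q ∈ (chartAt G.model (1 : G)).target) :
    ∃ A : G.model →L[ℝ] G.model,
      HasFDerivAt (fun q => G.Ad ((chartAt G.model (1 : G)).symm q)⁻¹ u) A q ∧
      ∀ v, A v = G.brk (G.Ad ((chartAt G.model (1 : G)).symm q)⁻¹ u)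
        (G.locL (chartAt G.model (1 : G)).symm q v) := by
  set φ := chartAt G.model (1 : G) with hφ
  have hp : φ 1 ∈ φ.target := mem_chart_target _ _
  have hs := G.contMDiffOn_chart_one_symm
  rw [← hφ] at hs
  have ht : IsOpen (φ.target ×ˢ φ.target) := φ.open_target.prod φ.open_target
  have hm : ((φ 1, q) : G.model × G.model) ∈ φ.target ×ˢ φ.target := ⟨hp, hq⟩
  have h1 : ContMDiffOn 𝓘(ℝ, G.model × G.model) 𝓘(ℝ, G.model) ∞
      (fun p : G.model × G.model => φ.symm p.1) (φ.target ×ˢ φ.target) :=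
    hs.comp (contDiff_fst.contMDiff.contMDiffOn) fun z hz => hz.1
  have h2 : ContMDiffOn 𝓘(ℝ, G.model × G.model) 𝓘(ℝ, G.model) ∞
      (fun p : G.model × G.model => φ.symm p.2) (φ.target ×ˢ φ.target) :=
    hs.comp (contDiff_snd.contMDiff.contMDiffOn) fun z hz => hz.2
  set P : G.model × G.model → G := fun p => φ.symm p.1 * φ.symm p.2 with hP
  have hPs : ContMDiffOn 𝓘(ℝ, G.model × G.model) 𝓘(ℝ, G.model) ∞ P (φ.target ×ˢ φ.target) :=
    h1.mul h2
  have hval : ∀ z ∈ φ.target ×ˢ φ.target, ∀ u v : G.model, G.locL P z (u, v) =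
      G.Ad (φ.symm z.2)⁻¹ (G.locL φ.symm z.1 u) + G.locL φ.symm z.2 v := by
    intro z hz u v
    have e1 := locL_comp φ.open_target hs (k := fun z : G.model × G.model => z.1)
      (y := z) differentiableAt_fst hz.1
    have e2 := locL_comp φ.open_target hs (k := fun z : G.model × G.model => z.2)
      (y := z) differentiableAt_snd hz.2
    rw [hP, locL_mul ((h1 z hz).contMDiffAt (ht.mem_nhds hz)) ((h2 z hz).contMDiffAt (ht.mem_nhds hz)),
      e1, e2, show fderiv ℝ (fun z : G.model × G.model => z.1) z = _ from fderiv_fst,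
      show fderiv ℝ (fun z : G.model × G.model => z.2) z = _ from fderiv_snd]
    simp
  have e1 : G.locL φ.symm (φ 1) = ContinuousLinearMap.id ℝ G.model := G.locL_chart_symm_one
  have hd : HasFDerivAt (G.locL P) (fderiv ℝ (G.locL P) (φ 1, q)) (φ 1, q) :=
    ((contDiffAt_locL ht hPs hm).differentiableAt (by simp)).hasFDerivAt
  have hmc := fun v : G.model => locL_antisymm ht hPs hm (u, 0) (0, v)
  have hev : (fun q => G.Ad (φ.symm q)⁻¹ u) =ᶠ[nhds q] fun q => G.locL P (φ 1, q) (u, 0) := by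
    filter_upwards [φ.open_target.mem_nhds hq] with z hz
    rw [hval (φ 1, z) ⟨hp, hz⟩, e1]
    simp
  have hd1 : HasFDerivAt (fun z => G.locL P (φ 1, z) (u, 0)) _ q :=
    (hd.comp q (f := fun z => (φ 1, z)) ((hasFDerivAt_const (𝕜 := ℝ) (φ 1) q).prodMk
      (hasFDerivAt_id (𝕜 := ℝ) q))).clm_apply
      (hasFDerivAt_const (𝕜 := ℝ) ((u, 0) : G.model × G.model) q)
  refine ⟨_, hd1.congr_of_eventuallyEq hev, fun v => ?_⟩
  -- On `(0, v)` the form of `P` does not depend on the first variable, by left invariance, so one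
  -- of the two mixed derivatives vanishes.
  have hz : fderiv ℝ (G.locL P) (φ 1, q) (u, 0) (0, v) = 0 := by
    have hd2 : HasFDerivAt (fun z => G.locL P (z, q) (0, v)) _ (φ 1) :=
      (hd.comp (φ 1) (f := fun z => (z, q)) ((hasFDerivAt_id (𝕜 := ℝ) (φ 1)).prodMk
        (hasFDerivAt_const (𝕜 := ℝ) q (φ 1)))).clm_apply
        (hasFDerivAt_const (𝕜 := ℝ) ((0, v) : G.model × G.model) (φ 1))
    have hev2 : (fun z => G.locL P (z, q) (0, v)) =ᶠ[nhds (φ 1)] fun _ => G.locL φ.symm q v := by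
      filter_upwards [φ.open_target.mem_nhds hp] with z hz
      rw [hval (z, q) ⟨hz, hq⟩]
      simp
    have h0 := congrArg (fun A : G.model →L[ℝ] G.model => A u)
      (hd2.unique ((hasFDerivAt_const (𝕜 := ℝ) (G.locL φ.symm q v) (φ 1)).congr_of_eventuallyEq
        hev2))
    simpa using h0
  have hmc' := hmc v
  rw [hz, zero_sub, neg_inj, hval _ hm, hval _ hm, e1] at hmc'
  simpa using hmc'

variable (G) in
-- By the derivative formula for `Ad`, the hypothesis on `β` says that `β (Ad g⁻¹ x) (Ad g⁻¹ y)` has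
-- zero derivative in the chart, hence is constant on a ball around the identity.
theorem exists_nhds_Ad_invariant (β : G.model →L[ℝ] G.model →L[ℝ] ℝ)
    (hβ : ∀ a b c, β (G.brk b a) c + β b (G.brk c a) = 0) :
    ∀ᶠ g : G in nhds 1, ∀ x y, β (G.Ad g⁻¹ x) (G.Ad g⁻¹ y) = β x y := by
  set φ := chartAt G.model (1 : G) with hφ
  have hp : φ 1 ∈ φ.target := mem_chart_target _ _
  obtain ⟨ε, hε, hball⟩ := Metric.isOpen_iff.1 φ.open_target _ hp
  have hsrc : ∀ᶠ g : G in nhds 1, g ∈ φ.source ∧ φ g ∈ Metric.ball (φ 1) ε :=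
    Filter.Eventually.and (φ.open_source.mem_nhds (mem_chart_source _ _))
      ((φ.continuousAt (mem_chart_source _ _)) (Metric.ball_mem_nhds _ hε))
  filter_upwards [hsrc] with g hg x y
  have hder : ∀ q ∈ Metric.ball (φ 1) ε, HasFDerivAt
      (fun q => β (G.Ad (φ.symm q)⁻¹ x) (G.Ad (φ.symm q)⁻¹ y)) (0 : G.model →L[ℝ] ℝ) q := by
    intro q hq
    obtain ⟨A, hA, hA'⟩ := hasFDerivAt_Ad_inv x (hball hq)
    obtain ⟨A₂, hA₂, hA₂'⟩ := hasFDerivAt_Ad_inv y (hball hq)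
    refine ((β.hasFDerivAt.comp q hA).clm_apply hA₂).congr_fderiv ?_
    ext v
    have := hβ (G.locL φ.symm q v) (G.Ad (φ.symm q)⁻¹ x) (G.Ad (φ.symm q)⁻¹ y)
    rw [hφ, ← hA' v, ← hA₂' v] at this
    simp [← hφ]
    rw [add_comm]
    exact this
  have := Metric.isOpen_ball.is_const_of_fderiv_eq_zero (𝕜 := ℝ)
    (convex_ball (φ 1) ε).isPreconnected
    (fun q hq => (hder q hq).differentiableAt.differentiableWithinAt)
    (fun q hq => (hder q hq).fderiv) hg.2 (Metric.mem_ball_self hε)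
  rw [φ.left_inv hg.1, φ.left_inv (mem_chart_source _ _)] at this
  rw [this, inv_one, Ad_one]
  rfl

variable (G) in
/-- An `ad`-invariant bilinear form on the Lie algebra of a connected group is `Ad`-invariant. -/
theorem Ad_invariant [PreconnectedSpace G] (β : G.model →L[ℝ] G.model →L[ℝ] ℝ)
    (hβ : ∀ a b c, β (G.brk b a) c + β b (G.brk c a) = 0) (g : G) (x y : G.model) :
    β (G.Ad g x) (G.Ad g y) = β x y := by
  have : IsTopologicalGroup G := topologicalGroup_of_lieGroup 𝓘(ℝ, G.model) ∞
  -- The elements whose adjoint action preserves `β` form a subgroup containing a neighbourhood of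
  -- `1`. It is open, hence also closed, hence all of the connected group.
  let S : Subgroup G :=
    { carrier := {g | ∀ x y, β (G.Ad g x) (G.Ad g y) = β x y}
      mul_mem' := fun {a b} ha hb x y => by rw [Ad_mul_apply, Ad_mul_apply, ha, hb]
      one_mem' := fun x y => by rw [Ad_one]; rfl
      inv_mem' := fun {a} ha x y => by
        rw [← ha, Ad_apply_Ad_inv, Ad_apply_Ad_inv] }
  have hS : IsOpen (S : Set G) := by
    refine S.isOpen_of_mem_nhds (g := 1) ?_
    filter_upwards [G.exists_nhds_Ad_invariant β hβ] with g hg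
    have : g⁻¹ ∈ S := hg
    exact (S.inv_mem_iff).1 this
  have hS' : IsClosed (S : Set G) := S.isClosed_of_isOpen hS
  have : g ∈ (S : Set G) := by
    rw [IsClopen.eq_univ ⟨hS', hS⟩ ⟨1, S.one_mem⟩]
    trivial
  exact this x y

end LieGrp

/-! ### Smoothness and exterior derivative of forms in the preferred charts -/

theorem contDiffOn_alternating {E E' : Type u} [NormedAddCommGroup E] [NormedSpace ℝ E]
    [FiniteDimensional ℝ E] [NormedAddCommGroup E'] [NormedSpace ℝ E'] {k : ℕ}
    {η : E' → E [⋀^Fin k]→L[ℝ] ℝ} {s : Set E'}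
    (h : ∀ v, ContDiffOn ℝ ∞ (fun y => η y v) s) : ContDiffOn ℝ ∞ η s := by
  let b := Module.finBasis ℝ E
  -- Evaluation on tuples of basis vectors is injective; a linear left inverse recovers the form
  -- from finitely many scalar functions, each smooth by hypothesis.
  let ev : (E [⋀^Fin k]→L[ℝ] ℝ) →ₗ[ℝ] ((Fin k → Fin (Module.finrank ℝ E)) → ℝ) :=
    { toFun := fun η' r => η' fun i => b (r i)
      map_add' := fun _ _ => rfl
      map_smul' := fun _ _ => rfl }
  have hinj : LinearMap.ker ev = ⊥ := by
    rw [LinearMap.ker_eq_bot]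
    intro η₁ η₂ he
    have : η₁.toAlternatingMap = η₂.toAlternatingMap :=
      b.ext_alternating fun v _ => congrFun he v
    ext v
    exact congrArg (fun f : E [⋀^Fin k]→ₗ[ℝ] ℝ => f v) this
  obtain ⟨g, hg⟩ := ev.exists_leftInverse_of_injective hinj
  have e : η = fun y => g.toContinuousLinearMap (ev (η y)) :=
    funext fun y => (congrArg (fun f : _ →ₗ[ℝ] _ => f (η y)) hg).symm
  rw [e]
  refine g.toContinuousLinearMap.contDiff.comp_contDiffOn (contDiffOn_pi.2 fun r => h _)

namespace Mfd

variable {M N Q : Mfd.{u}}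

theorem mfderiv_chart_self (x : M) : mfderiv 𝓘(ℝ, M.model) 𝓘(ℝ, M.model) (chartAt M.model x) x =
    ContinuousLinearMap.id ℝ M.model := by
  have h := (tangentBundleCore 𝓘(ℝ, M.model) M).coordChange_self (achart M.model x) x
    (mem_chart_source _ _)
  rw [mfderiv_chartAt_eq_tangentCoordChange (mem_chart_source _ _)]
  ext v
  exact h v

theorem mfderiv_chart_symm_self (x : M) :
    mfderiv 𝓘(ℝ, M.model) 𝓘(ℝ, M.model) (chartAt M.model x).symm (chartAt M.model x x) =
      ContinuousLinearMap.id ℝ M.model := by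
  have h := (mdifferentiable_chart (I := 𝓘(ℝ, M.model)) x).comp_symm_deriv (mem_chart_target _ x)
  set A : M.model →L[ℝ] M.model :=
    mfderiv 𝓘(ℝ, M.model) 𝓘(ℝ, M.model) (chartAt M.model x).symm (chartAt M.model x x)
  have e : ∀ z : M, z = x → (mfderiv 𝓘(ℝ, M.model) 𝓘(ℝ, M.model) (chartAt M.model x) z :
      M.model →L[ℝ] M.model) = ContinuousLinearMap.id ℝ M.model := by
    rintro _ rfl
    exact mfderiv_chart_self _
  have e' := e _ ((chartAt M.model x).left_inv (mem_chart_source _ _))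
  have h' := congrArg (fun B : M.model →L[ℝ] M.model => B.comp A) e'
  exact (h'.symm.trans h)

theorem contMDiffAt_chart_symm {x : M} {y : M.model} (hy : y ∈ (chartAt M.model x).target) :
    ContMDiffAt 𝓘(ℝ, M.model) 𝓘(ℝ, M.model) ∞ (chartAt M.model x).symm y :=
  (contMDiffOn_chart_symm _ hy).contMDiffAt ((chartAt M.model x).open_target.mem_nhds hy)

theorem Smooth.comp_chart_symm {f : M → N} (hf : Smooth f) (x : M) :
    ContMDiffOn 𝓘(ℝ, M.model) 𝓘(ℝ, N.model) ∞ (fun y => f ((chartAt M.model x).symm y))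
      (chartAt M.model x).target :=
  fun y hy => ((hf _).comp y (contMDiffAt_chart_symm hy)).contMDiffWithinAt

end Mfd

namespace Form

variable {M : Mfd.{u}} {k : ℕ}

theorem deRham_eq (η : Form M k) (x : M) :
    deRham η x = extDeriv (inChart η x) (chartAt M.model x x) := by
  ext v
  have := Mfd.mfderiv_chart_self x
  exact congrArg (fun A : M.model →L[ℝ] M.model =>
    extDeriv (inChart η x) (chartAt M.model x x) fun i => A (v i)) this

theorem deRham_apply {η : Form M k} (hη : IsSmooth η) (x : M) (v : Fin (k + 1) → M.model) :
    deRham η x v = ∑ i : Fin (k + 1), (-1) ^ (i : ℕ) • fderiv ℝ (fun y => inChart η x y (i.removeNth v))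
      (chartAt M.model x x) (v i) := by
  rw [deRham_eq, extDeriv_apply]
  exact ((hη x _ (mem_chart_target _ _)).contDiffAt
    ((chartAt M.model x).open_target.mem_nhds (mem_chart_target _ _))).differentiableAt (by simp)

end Form

/-! ### Maurer–Cartan forms on manifolds and their chart expressions -/

namespace LieGrp

variable {G : LieGrp.{u}} {M N : Mfd.{u}}

/-- This links intrinsic tangent maps with Fréchet derivatives: the translation `t` brings the point
to `1`, where the preferred chart has identity derivative. It is applied with `t` a left or a right
translation. -/
theorem fderiv_chart_translate {f : M → G} (hf : Mfd.Smooth (N := G.toMfd) f) {t : G → G}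
    (ht : Mfd.Smooth (M := G.toMfd) (N := G.toMfd) t) (x : M) {y : M.model}
    (hy : y ∈ (chartAt M.model x).target) (h : t (f ((chartAt M.model x).symm y)) = 1)
    (v : M.model) :
    fderiv ℝ (fun z => chartAt G.model (1 : G) (t (f ((chartAt M.model x).symm z)))) y v =
      Mfd.tmap (M := G.toMfd) (N := G.toMfd) t (f ((chartAt M.model x).symm y))
        (Mfd.tmap (N := G.toMfd) f ((chartAt M.model x).symm y)
        ((mfderiv 𝓘(ℝ, M.model) 𝓘(ℝ, M.model) (chartAt M.model x).symm y :
          M.model →L[ℝ] M.model) v)) := by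
  set ψ := chartAt M.model x
  have s0 : MDifferentiableAt 𝓘(ℝ, M.model) 𝓘(ℝ, M.model) ψ.symm y :=
    (Mfd.contMDiffAt_chart_symm hy).mdifferentiableAt (by simp)
  have s1 : MDifferentiableAt 𝓘(ℝ, M.model) 𝓘(ℝ, G.model) (fun z => f (ψ.symm z)) y :=
    (hf.mdifferentiableAt _).comp y s0
  have s2 : MDifferentiableAt 𝓘(ℝ, M.model) 𝓘(ℝ, G.model) (fun z => t (f (ψ.symm z))) y :=
    (ht.mdifferentiableAt _).comp y s1
  have s3 : ∀ q : G, q = 1 → MDifferentiableAt 𝓘(ℝ, G.model) 𝓘(ℝ, G.model)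
        (chartAt G.model (1 : G)) q ∧
      (mfderiv 𝓘(ℝ, G.model) 𝓘(ℝ, G.model) (chartAt G.model (1 : G)) q :
        G.model →L[ℝ] G.model) = ContinuousLinearMap.id ℝ G.model := by
    rintro _ rfl
    exact ⟨(contMDiffAt_of_mem_maximalAtlas (I := 𝓘(ℝ, G.model)) (n := ∞)
      (IsManifold.chart_mem_maximalAtlas _) (mem_chart_source _ _)).mdifferentiableAt (by simp),
      mfderiv_chart_one⟩
  obtain ⟨s4, s5⟩ := s3 _ h
  have c1 := mfderiv_comp y (hf.mdifferentiableAt (ψ.symm y)) s0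
  have c2 := mfderiv_comp y (ht.mdifferentiableAt (f (ψ.symm y))) s1
  have c3 := mfderiv_comp y s4 s2
  rw [← mfderiv_eq_fderiv]
  refine (congrArg (fun A : M.model →L[ℝ] G.model => A v) c3).trans ?_
  refine (congrArg (fun A : G.model →L[ℝ] G.model => A _) s5).trans ?_
  refine (congrArg (fun A : M.model →L[ℝ] G.model => A v) c2).trans ?_
  exact congrArg (fun A : M.model →L[ℝ] G.model =>
    Mfd.tmap (M := G.toMfd) (N := G.toMfd) t (f (ψ.symm y)) (A v)) c1

theorem mcLeft_chart {f : M → G} (hf : Mfd.Smooth (N := G.toMfd) f) (x : M) {y : M.model}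
    (hy : y ∈ (chartAt M.model x).target) (v : M.model) :
    G.mcLeft f ((chartAt M.model x).symm y)
        ((mfderiv 𝓘(ℝ, M.model) 𝓘(ℝ, M.model) (chartAt M.model x).symm y :
          M.model →L[ℝ] M.model) v) =
      G.locL (fun z => f ((chartAt M.model x).symm z)) y v :=
  (fderiv_chart_translate hf (smooth_mul_left _) x hy (inv_mul_cancel _) v).symm

theorem mcRight_chart {f : M → G} (hf : Mfd.Smooth (N := G.toMfd) f) (x : M) {y : M.model}
    (hy : y ∈ (chartAt M.model x).target) (v : M.model) :
    G.mcRight f ((chartAt M.model x).symm y)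
        ((mfderiv 𝓘(ℝ, M.model) 𝓘(ℝ, M.model) (chartAt M.model x).symm y :
          M.model →L[ℝ] M.model) v) =
      G.Ad (f ((chartAt M.model x).symm y)) (G.locL (fun z => f ((chartAt M.model x).symm z)) y v) := by
  refine (fderiv_chart_translate hf (smooth_mul_right _) x hy (mul_inv_cancel _) v).symm.trans ?_
  have h := fderiv_chart_right ((hf.comp_chart_symm x y hy).contMDiffAt
    ((chartAt M.model x).open_target.mem_nhds hy))
  exact congrArg (fun A : M.model →L[ℝ] G.model => A v) h

theorem mcLeft_eq_locL {f : M → G} (hf : Mfd.Smooth (N := G.toMfd) f) (x : M) (v : M.model) :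
    G.mcLeft f x v = G.locL (fun z => f ((chartAt M.model x).symm z)) (chartAt M.model x x) v := by
  rw [← mcLeft_chart hf x (mem_chart_target _ _) v]
  have e := (chartAt M.model x).left_inv (mem_chart_source _ x)
  rw [e]
  exact congrArg (fun A : M.model →L[ℝ] M.model => G.mcLeft f x (A v))
    (Mfd.mfderiv_chart_symm_self x).symm

theorem mcRight_eq_Ad {f : M → G} (hf : Mfd.Smooth (N := G.toMfd) f) (x : M) (v : M.model) :
    G.mcRight f x v = G.Ad (f x) (G.mcLeft f x v) := by
  have h := mcRight_chart hf x (mem_chart_target _ x) v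
  have e := (chartAt M.model x).left_inv (mem_chart_source _ x)
  rw [← mcLeft_eq_locL hf x v, e] at h
  rw [← h]
  exact congrArg (fun A : M.model →L[ℝ] M.model => G.mcRight f x (A v))
    (Mfd.mfderiv_chart_symm_self x).symm

theorem smooth_mul {f g : M → G} (hf : Mfd.Smooth (N := G.toMfd) f)
    (hg : Mfd.Smooth (N := G.toMfd) g) : Mfd.Smooth (N := G.toMfd) fun z => f z * g z :=
  ContMDiff.mul hf hg

theorem smooth_inv {f : M → G} (hf : Mfd.Smooth (N := G.toMfd) f) :
    Mfd.Smooth (N := G.toMfd) fun z => (f z)⁻¹ :=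
  ContMDiff.inv hf

theorem mcLeft_mul {f g : M → G} (hf : Mfd.Smooth (N := G.toMfd) f)
    (hg : Mfd.Smooth (N := G.toMfd) g) (x : M) (v : M.model) :
    G.mcLeft (fun z => f z * g z) x v =
      @HAdd.hAdd G.model G.model G.model _ (G.Ad (g x)⁻¹ (G.mcLeft f x v)) (G.mcLeft g x v) := by
  have hp := mem_chart_target M.model x
  have hn := (chartAt M.model x).open_target.mem_nhds hp
  have h := locL_mul ((hf.comp_chart_symm x _ hp).contMDiffAt hn)
    ((hg.comp_chart_symm x _ hp).contMDiffAt hn)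
  rw [mcLeft_eq_locL (smooth_mul hf hg), mcLeft_eq_locL hf, mcLeft_eq_locL hg, h,
    (chartAt M.model x).left_inv (mem_chart_source _ x)]
  rfl

theorem mcLeft_const (c : G) (x : M) : G.mcLeft (fun _ : M => c) x = 0 := by
  rw [mcLeft, show Mfd.tmap (N := G.toMfd) (fun _ : M => c) x = 0 from Mfd.tmap_const (N := G.toMfd) c x]
  ext v
  exact map_zero (Mfd.tmap (M := G.toMfd) (N := G.toMfd) (fun y => c⁻¹ * y) c)

theorem mcLeft_comp {f : M → G} (hf : Mfd.Smooth (N := G.toMfd) f) {k : N → M}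
    (hk : Mfd.Smooth k) (x : N) (v : N.model) :
    G.mcLeft (fun z => f (k z)) x v = G.mcLeft f (k x) (Mfd.tmap k x v) := by
  have := Mfd.tmap_comp (Q := G.toMfd) hf hk x
  exact congrArg (fun A : N.model →L[ℝ] G.model =>
    Mfd.tmap (M := G.toMfd) (N := G.toMfd) (fun y => (f (k x))⁻¹ * y) (f (k x)) (A v)) this

/-- A homomorphism intertwines left translations, so only its derivative at the identity remains. -/
theorem mcLeft_hom {H : LieGrp.{u}} (φ : H →* G)
    (hφ : Mfd.Smooth (M := H.toMfd) (N := G.toMfd) φ) {f : M → H}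
    (hf : Mfd.Smooth (N := H.toMfd) f) (x : M) (v : M.model) :
    G.mcLeft (fun z => φ (f z)) x v =
      Mfd.tmap (M := H.toMfd) (N := G.toMfd) φ 1 (H.mcLeft f x v) := by
  have c1 := Mfd.tmap_comp (Q := G.toMfd) (N := H.toMfd) hφ hf x
  have c2 := Mfd.tmap_comp (Q := G.toMfd) (N := G.toMfd) (M := H.toMfd)
    (g := fun y => (φ (f x))⁻¹ * y) (smooth_mul_left (φ (f x))⁻¹) hφ (f x)
  have c3 := Mfd.tmap_comp (Q := G.toMfd) (N := H.toMfd) (M := H.toMfd)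
    (f := fun y => (f x)⁻¹ * y) hφ (smooth_mul_left (f x)⁻¹) (f x)
  have e : (fun y : H => (φ (f x))⁻¹ * φ y) = fun y => φ ((f x)⁻¹ * y) := by
    funext y
    simp
  have c4 : Mfd.tmap (M := H.toMfd) (N := G.toMfd) φ ((f x)⁻¹ * f x) =
    Mfd.tmap (M := H.toMfd) (N := G.toMfd) φ 1 := by rw [inv_mul_cancel]
  have c5 := c2.symm.trans ((congrArg (fun k : H → G =>
    Mfd.tmap (M := H.toMfd) (N := G.toMfd) k (f x)) e).trans c3)
  rw [c4] at c5
  have c6 : G.mcLeft (fun z => φ (f z)) x v = Mfd.tmap (M := G.toMfd) (N := G.toMfd)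
      (fun y => (φ (f x))⁻¹ * y) (φ (f x)) (Mfd.tmap (M := H.toMfd) (N := G.toMfd) φ (f x)
        (Mfd.tmap (N := H.toMfd) f x v)) :=
    congrArg (fun A : M.model →L[ℝ] G.model => Mfd.tmap (M := G.toMfd) (N := G.toMfd)
      (fun y => (φ (f x))⁻¹ * y) (φ (f x)) (A v)) c1
  exact c6.trans (congrArg (fun A : H.model →L[ℝ] G.model => A (Mfd.tmap (N := H.toMfd) f x v)) c5)

end LieGrp

/-! ### The right Maurer–Cartan form -/

namespace LieGrp

variable {G : LieGrp.{u}} {M N : Mfd.{u}} {E : Type*} [NormedAddCommGroup E] [NormedSpace ℝ E]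

variable (G) in
/-- The right Maurer–Cartan form pulled back to a vector space. -/
def locR (F : E → G) (y : E) : E →L[ℝ] G.model := -G.locL (fun z => (F z)⁻¹) y

theorem locR_eq_Ad {F : E → G} {y : E} (hF : ContMDiffAt 𝓘(ℝ, E) 𝓘(ℝ, G.model) ∞ F y) :
    G.locR F y = (G.Ad (F y)).comp (G.locL F y) := by
  rw [locR, locL_inv hF, neg_neg]

theorem contDiffAt_locR {U : Set E} (hU : IsOpen U) {F : E → G}
    (hF : ContMDiffOn 𝓘(ℝ, E) 𝓘(ℝ, G.model) ∞ F U) {y : E} (hy : y ∈ U) :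
    ContDiffAt ℝ ∞ (G.locR F) y :=
  (contDiffAt_locL hU hF.inv hy).neg

theorem brk_neg_neg (a b : G.model) : G.brk (-a) (-b) = G.brk a b := by
  have h1 := neg_lie (L := G.lie) (M := G.lie) a (-b : G.model)
  have h2 := lie_neg (L := G.lie) (M := G.lie) a b
  exact h1.trans ((congrArg (fun z : G.lie => -z) h2).trans (neg_neg _))

/-- The right form is minus the left form of the inverse map. The two signs inside the bracket
cancel, so the outer sign is opposite to that of the left equation. -/
theorem locR_antisymm {U : Set E} (hU : IsOpen U) {F : E → G}
    (hF : ContMDiffOn 𝓘(ℝ, E) 𝓘(ℝ, G.model) ∞ F U) {y : E} (hy : y ∈ U) (u v : E) :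
    fderiv ℝ (G.locR F) y u v - fderiv ℝ (G.locR F) y v u =
      G.brk (G.locR F y u) (G.locR F y v) := by
  have h := locL_antisymm hU hF.inv hy u v
  have e : fderiv ℝ (G.locR F) y = -fderiv ℝ (G.locL fun z => (F z)⁻¹) y :=
    fderiv_fun_neg
  rw [e]
  simp only [locR, neg_apply, brk_neg_neg]
  rw [neg_sub_neg, ← neg_sub, h, neg_neg]

theorem mcRight_eq_neg {f : M → G} (hf : Mfd.Smooth (N := G.toMfd) f) (x : M) (v : M.model) :
    G.mcRight f x v = @Neg.neg G.model _ (G.mcLeft (fun z => (f z)⁻¹) x v) := by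
  rw [mcRight_eq_Ad hf, mcLeft_eq_locL hf, mcLeft_eq_locL (smooth_inv hf),
    locL_inv ((hf.comp_chart_symm x _ (mem_chart_target _ x)).contMDiffAt
      ((chartAt M.model x).open_target.mem_nhds (mem_chart_target _ x))),
      (chartAt M.model x).left_inv (mem_chart_source _ x)]
  exact (neg_neg (G.Ad (f x) (G.locL (fun z => f ((chartAt M.model x).symm z))
    (chartAt M.model x x) v))).symm

theorem mcRight_comp {f : M → G} (hf : Mfd.Smooth (N := G.toMfd) f) {k : N → M}
    (hk : Mfd.Smooth k) (x : N) (v : N.model) :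
    G.mcRight (fun z => f (k z)) x v = G.mcRight f (k x) (Mfd.tmap k x v) := by
  have hk' : Mfd.Smooth (N := G.toMfd) fun z => f (k z) := hf.comp hk
  rw [mcRight_eq_neg hk', mcRight_eq_neg hf]
  exact congrArg (fun a : G.model => -a) (mcLeft_comp (smooth_inv hf) hk x v)

theorem mcRight_hom {H : LieGrp.{u}} (φ : H →* G)
    (hφ : Mfd.Smooth (M := H.toMfd) (N := G.toMfd) φ) {f : M → H}
    (hf : Mfd.Smooth (N := H.toMfd) f) (x : M) (v : M.model) :
    G.mcRight (fun z => φ (f z)) x v =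
      Mfd.tmap (M := H.toMfd) (N := G.toMfd) φ 1 (H.mcRight f x v) := by
  have hk' : Mfd.Smooth (N := G.toMfd) fun z => φ (f z) := hφ.comp hf
  rw [mcRight_eq_neg hk', mcRight_eq_neg hf]
  have h := mcLeft_hom φ hφ (smooth_inv hf) x v
  simp only [map_inv] at h
  refine (congrArg (fun a : G.model => -a) h).trans ?_
  exact ((Mfd.tmap (M := H.toMfd) (N := G.toMfd) φ 1).map_neg _).symm

end LieGrp

/-! ### The invariant trilinear form and the evaluation of the pairing forms -/

namespace ManinTriple

variable {𝔤 : Type*} [LieRing 𝔤] [LieAlgebra ℝ 𝔤] (T : ManinTriple 𝔤)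

/-- The invariant trilinear form `⟨a, [b, c]⟩`. -/
def tri (a b c : 𝔤) : ℝ := T.B a ⁅b, c⁆

theorem tri_swap_right (a b c : 𝔤) : T.tri a c b = -T.tri a b c := by
  rw [tri, tri, ← lie_skew, map_neg]

theorem B_lie_left (a b c : 𝔤) : T.B ⁅a, b⁆ c = T.tri a b c := by
  have h := T.invariant b a c
  rw [← lie_skew, map_neg, LinearMap.neg_apply] at h
  rw [tri]
  linarith

theorem tri_swap_left (a b c : 𝔤) : T.tri b a c = -T.tri a b c := by
  have h := T.invariant a b c
  rw [B_lie_left] at h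
  rw [tri]
  linarith

theorem tri_of_mem_hp {a b c : 𝔤} (ha : a ∈ T.hp) (hb : b ∈ T.hp) (hc : c ∈ T.hp) :
    T.tri a b c = 0 :=
  T.isotropic_p _ ha _ (T.hp.lie_mem hb hc)

theorem tri_of_mem_hm {a b c : 𝔤} (ha : a ∈ T.hm) (hb : b ∈ T.hm) (hc : c ∈ T.hm) :
    T.tri a b c = 0 :=
  T.isotropic_m _ ha _ (T.hm.lie_mem hb hc)

/-- Invariance moves all brackets into the second argument of the pairing with `a`, where the Jacobi
identity applies. This is what closes the Cartan form. -/
theorem tri_jacobi (a b c d : 𝔤) :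
    T.tri ⁅a, b⁆ c d - T.tri ⁅a, c⁆ b d + T.tri ⁅a, d⁆ b c = 0 := by
  have h : ∀ x y z : 𝔤, T.tri ⁅a, x⁆ y z = T.B a ⁅x, ⁅y, z⁆⁆ := fun x y z => T.B_lie_left a x ⁅y, z⁆
  rw [h, h, h, ← map_sub, ← map_add, leibniz_lie b c d, ← lie_skew d]
  simp

end ManinTriple

theorem pairForm_apply' {𝔤 : Type*} [LieRing 𝔤] [LieAlgebra ℝ 𝔤] (B : LinearMap.BilinForm ℝ 𝔤)
    {M : Mfd.{u}} (ξ ζ : ∀ _ : M, M.model →ₗ[ℝ] 𝔤) (x : M) (v : Fin 2 → M.model) :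
    pairForm B ξ ζ x v = B (ξ x (v 0)) (ζ x (v 1)) - B (ξ x (v 1)) (ζ x (v 0)) := by
  rw [← pairForm_apply]
  congr 1
  ext i
  fin_cases i <;> rfl

/-- The trilinear form is already alternating by invariance, so alternatization multiplies it by `3!
= 6`, which cancels the factor `1/6`. -/
theorem cartanForm_apply {𝔤 : Type*} [LieRing 𝔤] [LieAlgebra ℝ 𝔤] (T : ManinTriple 𝔤)
    {M : Mfd.{u}} (θ : ∀ _ : M, M.model →ₗ[ℝ] 𝔤) (x : M) (v : Fin 3 → M.model) :
    cartanForm T.B θ x v = T.tri (θ x (v 0)) (θ x (v 1)) (θ x (v 2)) := by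
  have key : ∀ m : MultilinearMap ℝ (fun _ : Fin 3 => M.model) ℝ,
      (∀ w, m w = T.tri (θ x (w 0)) (θ x (w 1)) (θ x (w 2))) →
      MultilinearMap.alternatization m v = 6 * T.tri (θ x (v 0)) (θ x (v 1)) (θ x (v 2)) := by
    intro m hm
    let A : M.model [⋀^Fin 3]→ₗ[ℝ] ℝ :=
      { m with
        map_eq_zero_of_eq' := by
          intro w i j hij hne
          have h1 := fun a b : 𝔤 => T.tri_swap_left a a b
          have h2 := fun a b : 𝔤 => T.tri_swap_right a b b
          have h3 := fun a b : 𝔤 => T.tri_swap_left a b a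
          change m w = 0
          rw [hm]
          fin_cases i <;> fin_cases j <;> simp only [Fin.zero_eta, Fin.mk_one, Fin.reduceFinMk,
            ne_eq, not_true] at hij hne ⊢ <;> rw [hij] <;>
            first
              | linarith [h1 (θ x (w 1)) (θ x (w 2))]
              | linarith [h1 (θ x (w 0)) (θ x (w 2))]
              | linarith [h2 (θ x (w 0)) (θ x (w 1))]
              | linarith [h2 (θ x (w 0)) (θ x (w 2))]
              | linarith [h3 (θ x (w 2)) (θ x (w 1)), h2 (θ x (w 1)) (θ x (w 2))]
              | linarith [h3 (θ x (w 0)) (θ x (w 1)), h2 (θ x (w 1)) (θ x (w 0))] }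
    have h := AlternatingMap.coe_alternatization A
    have h' := congrArg (fun f : M.model [⋀^Fin 3]→ₗ[ℝ] ℝ => f v) h
    rw [← hm v]
    refine Eq.trans (show _ = MultilinearMap.alternatization (A : MultilinearMap ℝ _ ℝ) v from rfl)
      (h'.trans ?_)
    simp [Nat.factorial]
    rfl
  refine (congrArg (fun r : ℝ => (1 / 6 : ℝ) • r) (key _ fun w => rfl)).trans ?_
  simp

/-! ### The adjoint action on `𝔤` and the `𝔤`-valued Maurer–Cartan forms -/

namespace Integration

variable {𝔤 : Type*} [LieRing 𝔤] [LieAlgebra ℝ 𝔤] {T : ManinTriple 𝔤} (I : Integration.{u} T)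
  {M N : Mfd.{u}}

/-- The adjoint action of `G` on `𝔤`. -/
def adj (g : I.G) : 𝔤 →ₗ[ℝ] 𝔤 :=
  I.lieG.toLinearEquiv.toLinearMap ∘ₗ (I.G.Ad g).toLinearMap ∘ₗ I.lieG.toLinearEquiv.symm.toLinearMap

theorem adj_lieG (g : I.G) (a : I.G.model) : I.adj g (I.lieG a) = I.lieG (I.G.Ad g a) := by
  have : I.lieG.toLinearEquiv.symm (I.lieG a) = a := I.lieG.toLinearEquiv.symm_apply_apply a
  exact congrArg (fun b : I.G.model => I.lieG (I.G.Ad g b)) this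

theorem exists_lieG (a : 𝔤) : ∃ b : I.G.model, I.lieG b = a :=
  I.lieG.toLinearEquiv.surjective a

theorem lieG_add (a b : I.G.model) : I.lieG (a + b : I.G.model) = I.lieG a + I.lieG b :=
  I.lieG.toLinearEquiv.map_add a b

theorem lieG_neg (a : I.G.model) : I.lieG (-a : I.G.model) = -I.lieG a :=
  I.lieG.toLinearEquiv.map_neg a

theorem lieG_brk (a b : I.G.model) : I.lieG (I.G.brk a b) = ⁅I.lieG a, I.lieG b⁆ :=
  LieHom.map_lie I.lieG.toLieHom a b

theorem adj_mul (g h : I.G) (a : 𝔤) : I.adj (g * h) a = I.adj g (I.adj h a) := by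
  obtain ⟨a, rfl⟩ := I.exists_lieG a
  rw [adj_lieG, adj_lieG, adj_lieG, LieGrp.Ad_mul_apply]

theorem adj_one (a : 𝔤) : I.adj 1 a = a := by
  obtain ⟨a, rfl⟩ := I.exists_lieG a
  rw [adj_lieG, LieGrp.Ad_one]
  rfl

theorem adj_lie (g : I.G) (a b : 𝔤) : I.adj g ⁅a, b⁆ = ⁅I.adj g a, I.adj g b⁆ := by
  obtain ⟨a, rfl⟩ := I.exists_lieG a
  obtain ⟨b, rfl⟩ := I.exists_lieG b
  rw [← lieG_brk, adj_lieG, adj_lieG, adj_lieG, LieGrp.Ad_brk, lieG_brk]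

/-- The pairing on the model space of `G`. -/
def clmB : I.G.model →L[ℝ] I.G.model →L[ℝ] ℝ :=
  LinearMap.toContinuousLinearMap
    ((LinearMap.toContinuousLinearMap (𝕜 := ℝ) (E := I.G.model) (F' := ℝ)).toLinearMap ∘ₗ
      LinearMap.compl₁₂ T.B (I.lieG.toLinearEquiv.toLinearMap : I.G.model →ₗ[ℝ] 𝔤)
        (I.lieG.toLinearEquiv.toLinearMap : I.G.model →ₗ[ℝ] 𝔤))

theorem clmB_apply (a b : I.G.model) : I.clmB a b = T.B (I.lieG a) (I.lieG b) := rfl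

/-- The bracket of `G`, as a continuous bilinear map. -/
def clmBrk : I.G.model →L[ℝ] I.G.model →L[ℝ] I.G.model :=
  LinearMap.toContinuousLinearMap
    ((LinearMap.toContinuousLinearMap (𝕜 := ℝ) (E := I.G.model) (F' := I.G.model)).toLinearMap ∘ₗ
      LinearMap.mk₂ ℝ I.G.brk (add_lie (L := I.G.lie) (M := I.G.lie))
        (smul_lie (L := I.G.lie) (M := I.G.lie)) (lie_add (L := I.G.lie) (M := I.G.lie))
        (lie_smul (L := I.G.lie) (M := I.G.lie)))

theorem clmBrk_apply (a b : I.G.model) : I.clmBrk a b = I.G.brk a b := rfl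

/-- Infinitesimal invariance of the pairing integrates to invariance under `Ad` because `G` is
connected. -/
theorem B_adj (g : I.G) (a b : 𝔤) : T.B (I.adj g a) (I.adj g b) = T.B a b := by
  have := I.simplyConnected_G
  obtain ⟨a, rfl⟩ := I.exists_lieG a
  obtain ⟨b, rfl⟩ := I.exists_lieG b
  rw [adj_lieG, adj_lieG, ← clmB_apply, ← clmB_apply]
  refine I.G.Ad_invariant I.clmB (fun a b c => ?_) g a b
  rw [clmB_apply, clmB_apply, lieG_brk, lieG_brk, T.B_lie_left, T.tri_swap_right]
  exact neg_add_cancel _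

theorem tri_adj (g : I.G) (a b c : 𝔤) :
    T.tri (I.adj g a) (I.adj g b) (I.adj g c) = T.tri a b c := by
  rw [ManinTriple.tri, ManinTriple.tri, ← adj_lie, B_adj]

theorem adj_inv_adj (g : I.G) (a : 𝔤) : I.adj g⁻¹ (I.adj g a) = a := by
  rw [← adj_mul, inv_mul_cancel, adj_one]

theorem adj_adj_inv (g : I.G) (a : 𝔤) : I.adj g (I.adj g⁻¹ a) = a := by
  rw [← adj_mul, mul_inv_cancel, adj_one]

theorem B_adj_left (g : I.G) (a b : 𝔤) : T.B (I.adj g a) b = T.B a (I.adj g⁻¹ b) := by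
  rw [← I.B_adj g⁻¹, adj_inv_adj]

variable {I} {f g : M → I.G}

theorem thetaL_mul (hf : Mfd.Smooth (N := I.G.toMfd) f) (hg : Mfd.Smooth (N := I.G.toMfd) g)
    (x : M) (v : M.model) :
    I.thetaL (fun z => f z * g z) x v = I.adj (g x)⁻¹ (I.thetaL f x v) + I.thetaL g x v := by
  refine (congrArg I.lieG (LieGrp.mcLeft_mul hf hg x v)).trans ?_
  refine (I.lieG_add _ _).trans ?_
  exact congrArg (· + I.thetaL g x v) (I.adj_lieG (g x)⁻¹ (I.G.mcLeft f x v)).symm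

theorem thetaR_eq (hf : Mfd.Smooth (N := I.G.toMfd) f) (x : M) (v : M.model) :
    I.thetaR f x v = I.adj (f x) (I.thetaL f x v) := by
  exact (congrArg I.lieG (LieGrp.mcRight_eq_Ad hf x v)).trans
    (I.adj_lieG (f x) (I.G.mcLeft f x v)).symm

theorem thetaL_eq (hf : Mfd.Smooth (N := I.G.toMfd) f) (x : M) (v : M.model) :
    I.thetaL f x v = I.adj (f x)⁻¹ (I.thetaR f x v) := by
  rw [thetaR_eq hf, adj_inv_adj]

theorem thetaR_mul (hf : Mfd.Smooth (N := I.G.toMfd) f) (hg : Mfd.Smooth (N := I.G.toMfd) g)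
    (x : M) (v : M.model) :
    I.thetaR (fun z => f z * g z) x v = I.thetaR f x v + I.adj (f x) (I.thetaR g x v) := by
  rw [thetaR_eq (LieGrp.smooth_mul hf hg), thetaL_mul hf hg, thetaR_eq hf, thetaR_eq hg, map_add,
    adj_mul, adj_adj_inv, adj_mul]

theorem thetaL_const (c : I.G) (x : M) : I.thetaL (fun _ : M => c) x = 0 := by
  rw [thetaL, LieGrp.mcLeft_const, LinearMap.comp_zero]

theorem thetaR_const (c : I.G) (x : M) : I.thetaR (fun _ : M => c) x = 0 := by
  ext v
  rw [thetaR_eq (f := fun _ : M => c) contMDiff_const, thetaL_const]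
  simp

theorem thetaL_comp (hf : Mfd.Smooth (N := I.G.toMfd) f) {k : N → M} (hk : Mfd.Smooth k) (x : N)
    (v : N.model) : I.thetaL (fun z => f (k z)) x v = I.thetaL f (k x) (Mfd.tmap k x v) :=
  congrArg I.lieG (LieGrp.mcLeft_comp hf hk x v)

theorem thetaR_comp (hf : Mfd.Smooth (N := I.G.toMfd) f) {k : N → M} (hk : Mfd.Smooth k) (x : N)
    (v : N.model) : I.thetaR (fun z => f (k z)) x v = I.thetaR f (k x) (Mfd.tmap k x v) :=
  congrArg I.lieG (LieGrp.mcRight_comp hf hk x v)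

/-- Since `φ₊` integrates the inclusion, the forms of `H₊` become forms of `G` along `φ₊`. With the
three analogues that follow, every later computation concerns maps into `G` only. -/
theorem thetaLp_eq {f : M → I.Hp} (hf : Mfd.Smooth (N := I.Hp.toMfd) f) :
    I.thetaLp f = I.thetaL fun z => I.φp (f z) := by
  funext x
  ext v
  exact ((congrArg I.lieG (LieGrp.mcLeft_hom I.φp I.smooth_p hf x v)).trans
    (I.tangent_p (I.Hp.mcLeft f x v))).symm

theorem thetaRp_eq {f : M → I.Hp} (hf : Mfd.Smooth (N := I.Hp.toMfd) f) :
    I.thetaRp f = I.thetaR fun z => I.φp (f z) := by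
  funext x
  ext v
  exact ((congrArg I.lieG (LieGrp.mcRight_hom I.φp I.smooth_p hf x v)).trans
    (I.tangent_p (I.Hp.mcRight f x v))).symm

theorem thetaLm_eq {f : M → I.Hm} (hf : Mfd.Smooth (N := I.Hm.toMfd) f) :
    I.thetaLm f = I.thetaL fun z => I.φm (f z) := by
  funext x
  ext v
  exact ((congrArg I.lieG (LieGrp.mcLeft_hom I.φm I.smooth_m hf x v)).trans
    (I.tangent_m (I.Hm.mcLeft f x v))).symm

theorem thetaRm_eq {f : M → I.Hm} (hf : Mfd.Smooth (N := I.Hm.toMfd) f) :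
    I.thetaRm f = I.thetaR fun z => I.φm (f z) := by
  funext x
  ext v
  exact ((congrArg I.lieG (LieGrp.mcRight_hom I.φm I.smooth_m hf x v)).trans
    (I.tangent_m (I.Hm.mcRight f x v))).symm

theorem thetaL_p_mem {f : M → I.Hp} (hf : Mfd.Smooth (N := I.Hp.toMfd) f) (x : M) (v : M.model) :
    I.thetaL (fun z => I.φp (f z)) x v ∈ T.hp := by
  rw [← thetaLp_eq hf]
  exact (I.liep (I.Hp.mcLeft f x v)).2

theorem thetaR_p_mem {f : M → I.Hp} (hf : Mfd.Smooth (N := I.Hp.toMfd) f) (x : M) (v : M.model) :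
    I.thetaR (fun z => I.φp (f z)) x v ∈ T.hp := by
  rw [← thetaRp_eq hf]
  exact (I.liep (I.Hp.mcRight f x v)).2

theorem thetaL_m_mem {f : M → I.Hm} (hf : Mfd.Smooth (N := I.Hm.toMfd) f) (x : M) (v : M.model) :
    I.thetaL (fun z => I.φm (f z)) x v ∈ T.hm := by
  rw [← thetaLm_eq hf]
  exact (I.liem (I.Hm.mcLeft f x v)).2

theorem thetaR_m_mem {f : M → I.Hm} (hf : Mfd.Smooth (N := I.Hm.toMfd) f) (x : M) (v : M.model) :
    I.thetaR (fun z => I.φm (f z)) x v ∈ T.hm := by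
  rw [← thetaRm_eq hf]
  exact (I.liem (I.Hm.mcRight f x v)).2

end Integration

namespace ManinTriple

variable {𝔤 : Type*} [LieRing 𝔤] [LieAlgebra ℝ 𝔤] (T : ManinTriple 𝔤)

theorem tri_add (a a' b b' c c' : 𝔤) : T.tri (a + a') (b + b') (c + c') =
    T.tri a b c + T.tri a b c' + T.tri a b' c + T.tri a b' c' +
      T.tri a' b c + T.tri a' b c' + T.tri a' b' c + T.tri a' b' c' := by
  simp only [tri, add_lie, lie_add, map_add, LinearMap.add_apply]
  ring

theorem tri_sub_left (a a' b c : 𝔤) : T.tri (a - a') b c = T.tri a b c - T.tri a' b c := by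
  simp [tri]

theorem tri_neg_left (a b c : 𝔤) : T.tri (-a) b c = -T.tri a b c := by
  simp [tri]

end ManinTriple

/-! ### The forms `polar` and `cartan`: vanishing, cocycle identity, differentials -/

namespace Integration

variable {𝔤 : Type*} [LieRing 𝔤] [LieAlgebra ℝ 𝔤] {T : ManinTriple 𝔤} {I : Integration.{u} T}
  {M N : Mfd.{u}} {f g h : M → I.G}

variable (I) in
/-- The `2`-form `⟨f^* θ^l, g^* θ^r⟩`. -/
def polar (f g : M → I.G) : Form M 2 := pairForm T.B (I.thetaL f) (I.thetaR g)

variable (I) in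
/-- The pullback by `f` of the Cartan `3`-form. -/
def cartan (f : M → I.G) : Form M 3 := cartanForm T.B (I.thetaL f)

theorem polar_apply (f g : M → I.G) (x : M) (v : Fin 2 → M.model) : I.polar f g x v =
    T.B (I.thetaL f x (v 0)) (I.thetaR g x (v 1)) - T.B (I.thetaL f x (v 1)) (I.thetaR g x (v 0)) :=
  pairForm_apply' _ _ _ _ _

theorem cartan_apply (f : M → I.G) (x : M) (v : Fin 3 → M.model) : I.cartan f x v =
    T.tri (I.thetaL f x (v 0)) (I.thetaL f x (v 1)) (I.thetaL f x (v 2)) :=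
  cartanForm_apply _ _ _ _

theorem pullback_polar (hf : Mfd.Smooth (N := I.G.toMfd) f) (hg : Mfd.Smooth (N := I.G.toMfd) g)
    {k : N → M} (hk : Mfd.Smooth k) :
    Form.pullback k (I.polar f g) = I.polar (fun z => f (k z)) (fun z => g (k z)) := by
  funext x
  ext v
  refine Eq.trans (show _ = I.polar f g (k x) (fun i => Mfd.tmap k x (v i)) from rfl) ?_
  rw [polar_apply, polar_apply, thetaL_comp hf hk, thetaL_comp hf hk, thetaR_comp hg hk,
    thetaR_comp hg hk]

theorem pullback_cartan (hf : Mfd.Smooth (N := I.G.toMfd) f) {k : N → M} (hk : Mfd.Smooth k) :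
    Form.pullback k (I.cartan f) = I.cartan (fun z => f (k z)) := by
  funext x
  ext v
  refine Eq.trans (show _ = I.cartan f (k x) (fun i => Mfd.tmap k x (v i)) from rfl) ?_
  rw [cartan_apply, cartan_apply, thetaL_comp hf hk, thetaL_comp hf hk, thetaL_comp hf hk]

theorem polar_const_left (c : I.G) (g : M → I.G) : I.polar (fun _ => c) g = 0 := by
  funext x
  ext v
  rw [polar_apply, thetaL_const]
  simp

theorem polar_const_right (c : I.G) (f : M → I.G) : I.polar f (fun _ => c) = 0 := by
  funext x
  ext v
  rw [polar_apply, thetaR_const]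
  simp

theorem cartan_const (c : I.G) : I.cartan (fun _ : M => c) = 0 := by
  funext x
  ext v
  rw [cartan_apply, thetaL_const]
  simp [ManinTriple.tri]

theorem polar_p_p {f g : M → I.Hp} (hf : Mfd.Smooth (N := I.Hp.toMfd) f)
    (hg : Mfd.Smooth (N := I.Hp.toMfd) g) :
    I.polar (fun z => I.φp (f z)) (fun z => I.φp (g z)) = 0 := by
  funext x
  ext v
  rw [polar_apply, T.isotropic_p _ (thetaL_p_mem hf _ _) _ (thetaR_p_mem hg _ _),
    T.isotropic_p _ (thetaL_p_mem hf _ _) _ (thetaR_p_mem hg _ _), sub_zero]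
  rfl

theorem polar_m_m {f g : M → I.Hm} (hf : Mfd.Smooth (N := I.Hm.toMfd) f)
    (hg : Mfd.Smooth (N := I.Hm.toMfd) g) :
    I.polar (fun z => I.φm (f z)) (fun z => I.φm (g z)) = 0 := by
  funext x
  ext v
  rw [polar_apply, T.isotropic_m _ (thetaL_m_mem hf _ _) _ (thetaR_m_mem hg _ _),
    T.isotropic_m _ (thetaL_m_mem hf _ _) _ (thetaR_m_mem hg _ _), sub_zero]
  rfl

theorem cartan_p {f : M → I.Hp} (hf : Mfd.Smooth (N := I.Hp.toMfd) f) :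
    I.cartan (fun z => I.φp (f z)) = 0 := by
  funext x
  ext v
  rw [cartan_apply]
  exact T.tri_of_mem_hp (thetaL_p_mem hf _ _) (thetaL_p_mem hf _ _) (thetaL_p_mem hf _ _)

theorem cartan_m {f : M → I.Hm} (hf : Mfd.Smooth (N := I.Hm.toMfd) f) :
    I.cartan (fun z => I.φm (f z)) = 0 := by
  funext x
  ext v
  rw [cartan_apply]
  exact T.tri_of_mem_hm (thetaL_m_mem hf _ _) (thetaL_m_mem hf _ _) (thetaL_m_mem hf _ _)

/-- The Polyakov–Wiegmann cocycle identity. -/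
theorem polar_cocycle (hf : Mfd.Smooth (N := I.G.toMfd) f) (hg : Mfd.Smooth (N := I.G.toMfd) g)
    (hh : Mfd.Smooth (N := I.G.toMfd) h) :
    I.polar g h - I.polar (fun z => f z * g z) h + I.polar f (fun z => g z * h z) -
      I.polar f g = 0 := by
  funext x
  ext v
  change I.polar g h x v - I.polar (fun z => f z * g z) h x v +
    I.polar f (fun z => g z * h z) x v - I.polar f g x v = 0
  -- Expanding the products leaves two mixed terms in `f` and `h`, one with `Ad g⁻¹` on the left
  -- argument and one with `Ad g` on the right; invariance identifies them.
  simp only [polar_apply, thetaL_mul hf hg, thetaR_mul hg hh, map_add, LinearMap.add_apply,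
    I.B_adj_left, inv_inv]
  ring

/-- The local expression of `f^* θ^l` in the preferred chart at `x`. -/
abbrev chartL (f : M → I.G) (x : M) : M.model → M.model →L[ℝ] I.G.model :=
  I.G.locL fun z => f ((chartAt M.model x).symm z)

/-- The local expression of `f^* θ^r` in the preferred chart at `x`. -/
abbrev chartR (f : M → I.G) (x : M) : M.model → M.model →L[ℝ] I.G.model :=
  I.G.locR fun z => f ((chartAt M.model x).symm z)

theorem contDiffAt_chartL (hf : Mfd.Smooth (N := I.G.toMfd) f) (x : M) {y : M.model}
    (hy : y ∈ (chartAt M.model x).target) : ContDiffAt ℝ ∞ (I.chartL f x) y :=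
  LieGrp.contDiffAt_locL (chartAt M.model x).open_target (hf.comp_chart_symm x) hy

theorem contDiffAt_chartR (hf : Mfd.Smooth (N := I.G.toMfd) f) (x : M) {y : M.model}
    (hy : y ∈ (chartAt M.model x).target) : ContDiffAt ℝ ∞ (I.chartR f x) y :=
  LieGrp.contDiffAt_locR (chartAt M.model x).open_target (hf.comp_chart_symm x) hy

theorem thetaL_chart (hf : Mfd.Smooth (N := I.G.toMfd) f) (x : M) {y : M.model}
    (hy : y ∈ (chartAt M.model x).target) (v : M.model) :
    I.thetaL f ((chartAt M.model x).symm y)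
      ((mfderiv 𝓘(ℝ, M.model) 𝓘(ℝ, M.model) (chartAt M.model x).symm y :
          M.model →L[ℝ] M.model) v) = I.lieG (I.chartL f x y v) :=
  congrArg I.lieG (LieGrp.mcLeft_chart hf x hy v)

theorem thetaR_chart (hf : Mfd.Smooth (N := I.G.toMfd) f) (x : M) {y : M.model}
    (hy : y ∈ (chartAt M.model x).target) (v : M.model) :
    I.thetaR f ((chartAt M.model x).symm y)
      ((mfderiv 𝓘(ℝ, M.model) 𝓘(ℝ, M.model) (chartAt M.model x).symm y :
          M.model →L[ℝ] M.model) v) = I.lieG (I.chartR f x y v) := by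
  refine (congrArg I.lieG (LieGrp.mcRight_chart hf x hy v)).trans ?_
  rw [chartR, LieGrp.locR_eq_Ad ((hf.comp_chart_symm x _ hy).contMDiffAt
    ((chartAt M.model x).open_target.mem_nhds hy))]
  rfl

theorem inChart_polar (hf : Mfd.Smooth (N := I.G.toMfd) f) (hg : Mfd.Smooth (N := I.G.toMfd) g)
    (x : M) {y : M.model} (hy : y ∈ (chartAt M.model x).target) (v : Fin 2 → M.model) :
    Form.inChart (I.polar f g) x y v =
      I.clmB (I.chartL f x y (v 0)) (I.chartR g x y (v 1)) -
      I.clmB (I.chartL f x y (v 1)) (I.chartR g x y (v 0)) := by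
  refine (polar_apply f g _ fun i => (mfderiv 𝓘(ℝ, M.model) 𝓘(ℝ, M.model)
    (chartAt M.model x).symm y : M.model →L[ℝ] M.model) (v i)).trans ?_
  rw [thetaL_chart hf x hy, thetaL_chart hf x hy, thetaR_chart hg x hy, thetaR_chart hg x hy]
  rfl

theorem inChart_cartan (hf : Mfd.Smooth (N := I.G.toMfd) f)
    (x : M) {y : M.model} (hy : y ∈ (chartAt M.model x).target) (v : Fin 3 → M.model) :
    Form.inChart (I.cartan f) x y v =
      I.clmB (I.chartL f x y (v 0)) (I.clmBrk (I.chartL f x y (v 1)) (I.chartL f x y (v 2))) := by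
  have key : ∀ A : M.model →L[ℝ] M.model, (∀ w, I.thetaL f ((chartAt M.model x).symm y) (A w) =
      I.lieG (I.chartL f x y w)) → I.cartan f ((chartAt M.model x).symm y) (fun i => A (v i)) =
      I.clmB (I.chartL f x y (v 0))
        (I.clmBrk (I.chartL f x y (v 1)) (I.chartL f x y (v 2))) := by
    intro A hA
    rw [cartan_apply, hA, hA, hA]
    exact congrArg (T.B (I.lieG (I.chartL f x y (v 0)))) (I.lieG_brk _ _).symm
  exact key _ (thetaL_chart hf x hy)

theorem isSmooth_polar (hf : Mfd.Smooth (N := I.G.toMfd) f) (hg : Mfd.Smooth (N := I.G.toMfd) g) :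
    Form.IsSmooth (I.polar f g) := by
  intro x
  refine contDiffOn_alternating fun v => ?_
  refine ContDiffOn.congr (fun y hy => ContDiffAt.contDiffWithinAt ?_)
    fun y hy => inChart_polar hf hg x hy v
  have hL := contDiffAt_chartL hf x hy
  have hR := contDiffAt_chartR hg x hy
  exact ((contDiffAt_const.clm_apply (hL.clm_apply contDiffAt_const)).clm_apply
    (hR.clm_apply contDiffAt_const)).sub
    ((contDiffAt_const.clm_apply (hL.clm_apply contDiffAt_const)).clm_apply
    (hR.clm_apply contDiffAt_const))

theorem isSmooth_cartan (hf : Mfd.Smooth (N := I.G.toMfd) f) : Form.IsSmooth (I.cartan f) := by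
  intro x
  refine contDiffOn_alternating fun v => ?_
  refine ContDiffOn.congr (fun y hy => ContDiffAt.contDiffWithinAt ?_)
    fun y hy => inChart_cartan hf x hy v
  have hL := contDiffAt_chartL hf x hy
  exact (contDiffAt_const.clm_apply (hL.clm_apply contDiffAt_const)).clm_apply
    ((contDiffAt_const.clm_apply (hL.clm_apply contDiffAt_const)).clm_apply
      (hL.clm_apply contDiffAt_const))

theorem fderiv_inChart_polar (hf : Mfd.Smooth (N := I.G.toMfd) f)
    (hg : Mfd.Smooth (N := I.G.toMfd) g) (x : M) (v : Fin 2 → M.model) (w : M.model) :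
    fderiv ℝ (fun y => Form.inChart (I.polar f g) x y v) (chartAt M.model x x) w =
      I.clmB (fderiv ℝ (I.chartL f x) (chartAt M.model x x) w (v 0))
        (I.chartR g x (chartAt M.model x x) (v 1)) +
      I.clmB (I.chartL f x (chartAt M.model x x) (v 0))
        (fderiv ℝ (I.chartR g x) (chartAt M.model x x) w (v 1)) -
      (I.clmB (fderiv ℝ (I.chartL f x) (chartAt M.model x x) w (v 1))
        (I.chartR g x (chartAt M.model x x) (v 0)) +
      I.clmB (I.chartL f x (chartAt M.model x x) (v 1))
        (fderiv ℝ (I.chartR g x) (chartAt M.model x x) w (v 0))) := by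
  set p := chartAt M.model x x
  have hp : p ∈ (chartAt M.model x).target := mem_chart_target _ x
  have hL := ((contDiffAt_chartL hf x hp).differentiableAt (by simp)).hasFDerivAt
  have hR := ((contDiffAt_chartR hg x hp).differentiableAt (by simp)).hasFDerivAt
  have hev : (fun y => Form.inChart (I.polar f g) x y v) =ᶠ[nhds p] fun y =>
      I.clmB (I.chartL f x y (v 0)) (I.chartR g x y (v 1)) -
      I.clmB (I.chartL f x y (v 1)) (I.chartR g x y (v 0)) := by
    filter_upwards [(chartAt M.model x).open_target.mem_nhds hp] with y hy
    exact inChart_polar hf hg x hy v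
  have hL' := fun a : M.model => hL.clm_apply (hasFDerivAt_const a p)
  have hR' := fun a : M.model => hR.clm_apply (hasFDerivAt_const a p)
  have hd := ((I.clmB.hasFDerivAt.comp p (hL' (v 0))).clm_apply (hR' (v 1))).sub
    ((I.clmB.hasFDerivAt.comp p (hL' (v 1))).clm_apply (hR' (v 0)))
  rw [(hd.congr_of_eventuallyEq hev).fderiv]
  simp
  ring

/-- Let `ξ = f^*θ^l` and `ζ = g^*θ^r`. The left form of `f g` is `Ad g⁻¹ (ξ + ζ)`, so by invariance
`cartan (f g)` is the trilinear form on `ξ + ζ`. Its pure terms are `cartan f` and `cartan g`; by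
the left and right Maurer–Cartan equations its mixed terms are minus the differential of `⟨ξ, ζ⟩`.
-/
theorem deRham_polar (hf : Mfd.Smooth (N := I.G.toMfd) f)
    (hg : Mfd.Smooth (N := I.G.toMfd) g) : Form.deRham (I.polar f g) =
      I.cartan g - I.cartan (fun z => f z * g z) + I.cartan f := by
  funext x
  ext v
  change _ = I.cartan g x v - I.cartan (fun z => f z * g z) x v + I.cartan f x v
  rw [Form.deRham_apply (isSmooth_polar hf hg), Fin.sum_univ_three]
  simp only [fderiv_inChart_polar hf hg]
  set p := chartAt M.model x x
  have hp : p ∈ (chartAt M.model x).target := mem_chart_target _ x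
  have el : ∀ u, I.thetaL f x u = I.lieG (I.chartL f x p u) := fun u =>
    congrArg I.lieG (LieGrp.mcLeft_eq_locL hf x u)
  have er : ∀ u, I.thetaR g x u = I.lieG (I.chartR g x p u) := fun u => by
    have h1 := LieGrp.mcRight_eq_Ad hg x u
    rw [LieGrp.mcLeft_eq_locL hg] at h1
    refine (congrArg I.lieG h1).trans ?_
    rw [chartR, LieGrp.locR_eq_Ad ((hg.comp_chart_symm x _ hp).contMDiffAt
      ((chartAt M.model x).open_target.mem_nhds hp)), (chartAt M.model x).left_inv
      (mem_chart_source _ x)]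
    rfl
  have hξ : ∀ u v z, I.clmB (fderiv ℝ (I.chartL f x) p u v) (I.chartR g x p z) -
      I.clmB (fderiv ℝ (I.chartL f x) p v u) (I.chartR g x p z) =
      -T.tri (I.thetaL f x u) (I.thetaL f x v) (I.thetaR g x z) := by
    intro u v z
    have h1 := LieGrp.locL_antisymm (chartAt M.model x).open_target (hf.comp_chart_symm x) hp u v
    rw [← sub_apply, ← map_sub, h1, map_neg, el, el, er, ← T.B_lie_left, ← lieG_brk]
    rfl
  have hζ : ∀ u v z, I.clmB (I.chartL f x p z) (fderiv ℝ (I.chartR g x) p u v) -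
      I.clmB (I.chartL f x p z) (fderiv ℝ (I.chartR g x) p v u) =
      T.tri (I.thetaL f x z) (I.thetaR g x u) (I.thetaR g x v) := by
    intro u v z
    have h1 := LieGrp.locR_antisymm (chartAt M.model x).open_target (hg.comp_chart_symm x) hp u v
    rw [← map_sub, h1, el, er, er, ManinTriple.tri, ← lieG_brk]
    rfl
  have hm : ∀ u, I.thetaL (fun z => f z * g z) x u =
      I.adj (g x)⁻¹ (I.thetaL f x u + I.thetaR g x u) := fun u => by
    rw [thetaL_mul hf hg, thetaL_eq hg, map_add]
  have hg' : I.cartan g x v = T.tri (I.thetaR g x (v 0)) (I.thetaR g x (v 1))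
      (I.thetaR g x (v 2)) := by
    rw [cartan_apply, thetaL_eq hg, thetaL_eq hg, thetaL_eq hg, tri_adj]
  rw [hg', cartan_apply, cartan_apply, hm, hm, hm, tri_adj, T.tri_add]
  have r0 : ∀ i : Fin 3, ∀ j : Fin 2, i.removeNth v j = v (i.succAbove j) := fun _ _ => rfl
  have e00 : (0 : Fin 3).succAbove (0 : Fin 2) = 1 := rfl
  have e01 : (0 : Fin 3).succAbove (1 : Fin 2) = 2 := rfl
  have e10 : (1 : Fin 3).succAbove (0 : Fin 2) = 0 := rfl
  have e11 : (1 : Fin 3).succAbove (1 : Fin 2) = 2 := rfl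
  have e20 : (2 : Fin 3).succAbove (0 : Fin 2) = 0 := rfl
  have e21 : (2 : Fin 3).succAbove (1 : Fin 2) = 1 := rfl
  simp only [r0, e00, e01, e10, e11, e20, e21, Fin.val_zero, Fin.val_one, Fin.val_two, pow_zero,
    pow_one, even_two, Even.neg_pow, one_pow, one_smul, neg_smul]
  have a1 := hξ (v 0) (v 1) (v 2)
  have a2 := hξ (v 0) (v 2) (v 1)
  have a3 := hξ (v 1) (v 2) (v 0)
  have b1 := hζ (v 0) (v 2) (v 1)
  have b2 := hζ (v 0) (v 1) (v 2)
  have b3 := hζ (v 1) (v 2) (v 0)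
  -- Antisymmetry in adjacent slots lines up the mixed terms of the expansion with those produced by
  -- the Maurer–Cartan equations.
  have c1 := T.tri_swap_right (I.thetaL f x (v 0)) (I.thetaR g x (v 1)) (I.thetaL f x (v 2))
  have c2 := T.tri_swap_left (I.thetaR g x (v 0)) (I.thetaL f x (v 1)) (I.thetaL f x (v 2))
  have c3 := T.tri_swap_right (I.thetaL f x (v 1)) (I.thetaR g x (v 0)) (I.thetaL f x (v 2))
  have c4 := T.tri_swap_left (I.thetaR g x (v 0)) (I.thetaL f x (v 1)) (I.thetaR g x (v 2))
  have c5 := T.tri_swap_right (I.thetaR g x (v 0)) (I.thetaL f x (v 2)) (I.thetaR g x (v 1))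
  have c6 := T.tri_swap_left (I.thetaR g x (v 0)) (I.thetaL f x (v 2)) (I.thetaR g x (v 1))
  linarith

/-- The derivative of each factor enters only through its antisymmetric part, which the
Maurer–Cartan equation turns into a bracket; the resulting sum vanishes by the Jacobi identity. -/
theorem deRham_cartan (hf : Mfd.Smooth (N := I.G.toMfd) f) : Form.deRham (I.cartan f) = 0 := by
  funext x
  ext v
  rw [Form.deRham_apply (isSmooth_cartan hf), Fin.sum_univ_four]
  set p := chartAt M.model x x
  have hp : p ∈ (chartAt M.model x).target := mem_chart_target _ x
  have hL := ((contDiffAt_chartL hf x hp).differentiableAt (by simp)).hasFDerivAt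
  set l : M.model → 𝔤 := fun u => I.lieG (I.chartL f x p u) with hl
  set D : M.model → M.model → 𝔤 := fun u v =>
    I.lieG (fderiv ℝ (I.chartL f x) p u v) with hD
  have hd : ∀ (v : Fin 3 → M.model) (w : M.model),
      fderiv ℝ (fun y => Form.inChart (I.cartan f) x y v) p w =
        T.tri (D w (v 0)) (l (v 1)) (l (v 2)) - T.tri (D w (v 1)) (l (v 0)) (l (v 2)) +
          T.tri (D w (v 2)) (l (v 0)) (l (v 1)) := by
    intro v w
    have hev : (fun y => Form.inChart (I.cartan f) x y v) =ᶠ[nhds p] fun y =>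
        I.clmB (I.chartL f x y (v 0)) (I.clmBrk (I.chartL f x y (v 1)) (I.chartL f x y (v 2))) := by
      filter_upwards [(chartAt M.model x).open_target.mem_nhds hp] with y hy
      exact inChart_cartan hf x hy v
    have hL' := fun a : M.model => hL.clm_apply (hasFDerivAt_const a p)
    have hd := (I.clmB.hasFDerivAt.comp p (hL' (v 0))).clm_apply
      ((I.clmBrk.hasFDerivAt.comp p (hL' (v 1))).clm_apply (hL' (v 2)))
    rw [(hd.congr_of_eventuallyEq hev).fderiv]
    simp [clmB_apply, clmBrk_apply, lieG_brk]
    change T.tri (l (v 0)) (l (v 1)) (D w (v 2)) + T.tri (l (v 0)) (D w (v 1)) (l (v 2)) +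
      T.tri (D w (v 0)) (l (v 1)) (l (v 2)) = _
    linarith [T.tri_swap_right (l (v 0)) (D w (v 2)) (l (v 1)),
      T.tri_swap_left (D w (v 2)) (l (v 0)) (l (v 1)),
      T.tri_swap_left (D w (v 1)) (l (v 0)) (l (v 2))]
  have ha : ∀ u v a b, T.tri (D u v) a b - T.tri (D v u) a b = -T.tri ⁅l u, l v⁆ a b := by
    intro u v a b
    have h1 := LieGrp.locL_antisymm (chartAt M.model x).open_target (hf.comp_chart_symm x) hp u v
    rw [← T.tri_sub_left, ← T.tri_neg_left, hl, ← lieG_brk, ← lieG_neg, ← h1, hD]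
    exact congrArg (fun z => T.tri z a b) (I.lieG.toLinearEquiv.map_sub _ _).symm
  simp only [hd]
  have r0 : ∀ i : Fin 4, ∀ j : Fin 3, i.removeNth v j = v (i.succAbove j) := fun _ _ => rfl
  have e00 : (0 : Fin 4).succAbove (0 : Fin 3) = 1 := rfl
  have e01 : (0 : Fin 4).succAbove (1 : Fin 3) = 2 := rfl
  have e02 : (0 : Fin 4).succAbove (2 : Fin 3) = 3 := rfl
  have e10 : (1 : Fin 4).succAbove (0 : Fin 3) = 0 := rfl
  have e11 : (1 : Fin 4).succAbove (1 : Fin 3) = 2 := rfl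
  have e12 : (1 : Fin 4).succAbove (2 : Fin 3) = 3 := rfl
  have e20 : (2 : Fin 4).succAbove (0 : Fin 3) = 0 := rfl
  have e21 : (2 : Fin 4).succAbove (1 : Fin 3) = 1 := rfl
  have e22 : (2 : Fin 4).succAbove (2 : Fin 3) = 3 := rfl
  have e30 : (3 : Fin 4).succAbove (0 : Fin 3) = 0 := rfl
  have e31 : (3 : Fin 4).succAbove (1 : Fin 3) = 1 := rfl
  have e32 : (3 : Fin 4).succAbove (2 : Fin 3) = 2 := rfl
  have e3 : (-1 : ℤ) ^ ((3 : Fin 4) : ℕ) = -1 := rfl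
  have j := T.tri_jacobi (l (v 0)) (l (v 1)) (l (v 2)) (l (v 3))
  -- The six terms are pairings of two brackets, hence symmetric under exchanging the brackets; they
  -- reduce to three terms, each occurring twice, whose sum is the Jacobi expression `j`.
  have s1 : T.tri ⁅l (v 2), l (v 3)⁆ (l (v 0)) (l (v 1)) =
    T.tri ⁅l (v 0), l (v 1)⁆ (l (v 2)) (l (v 3)) := T.symm _ _
  have s2 : T.tri ⁅l (v 1), l (v 3)⁆ (l (v 0)) (l (v 2)) =
    T.tri ⁅l (v 0), l (v 2)⁆ (l (v 1)) (l (v 3)) := T.symm _ _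
  have s3 : T.tri ⁅l (v 1), l (v 2)⁆ (l (v 0)) (l (v 3)) =
    T.tri ⁅l (v 0), l (v 3)⁆ (l (v 1)) (l (v 2)) := T.symm _ _
  simp only [r0, e00, e01, e02, e10, e11, e12, e20, e21, e22, e30, e31, e32, e3, Fin.val_zero,
    Fin.val_one, Fin.val_two, pow_zero,
    pow_one, even_two, Even.neg_pow, one_pow, one_smul, neg_smul]
  change _ = (0 : ℝ)
  linarith [ha (v 0) (v 1) (l (v 2)) (l (v 3)), ha (v 0) (v 2) (l (v 1)) (l (v 3)),
    ha (v 0) (v 3) (l (v 1)) (l (v 2)), ha (v 1) (v 2) (l (v 0)) (l (v 3)),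
    ha (v 1) (v 3) (l (v 0)) (l (v 2)), ha (v 2) (v 3) (l (v 0)) (l (v 1))]

end Integration

/-! ### Étale maps: inverse function theorem, lifting, submersions -/

namespace Mfd

variable {M N Q : Mfd.{u}}

/-- Local diffeomorphisms. -/
def Etale (f : M → N) : Prop := IsLocalDiffeomorph 𝓘(ℝ, M.model) 𝓘(ℝ, N.model) ∞ f

theorem Etale.smooth {f : M → N} (hf : Etale f) : Smooth f := hf.contMDiff

theorem Etale.isLocalHomeomorph {f : M → N} (hf : Etale f) : IsLocalHomeomorph f :=
  IsLocalDiffeomorph.isLocalHomeomorph hf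

/-- The tangent map of a local diffeomorphism. -/
def Etale.tequiv {f : M → N} (hf : Etale f) (x : M) : M.model ≃L[ℝ] N.model :=
  (hf x).mfderivToContinuousLinearEquiv (by simp)

theorem Etale.tequiv_apply {f : M → N} (hf : Etale f) (x : M) (v : M.model) :
    hf.tequiv x v = tmap f x v :=
  congrArg (fun A : M.model →L[ℝ] N.model => A v)
    ((hf x).mfderivToContinuousLinearEquiv_coe (by simp))

theorem Etale.tmap_bijective {f : M → N} (hf : Etale f) (x : M) :
    Function.Bijective (tmap f x) := by
  have : (tmap f x : M.model → N.model) = hf.tequiv x := funext fun v => (hf.tequiv_apply x v).symm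
  rw [this]
  exact (hf.tequiv x).bijective

theorem Etale.eq_zero {f : M → N} (hf : Etale f) {x : M} {v : M.model} (h : tmap f x v = 0) :
    v = 0 :=
  (hf.tmap_bijective x).1 (h.trans (map_zero _).symm)

/-- A local homeomorphism with smooth local inverses is a local diffeomorphism. -/
theorem etale_of_isLocalHomeomorph {f : M → N} (h : IsLocalHomeomorph f) (hf : Smooth f)
    (ht : ∀ x, Function.Bijective (tmap f x)) : Etale f := by
  intro x
  obtain ⟨e, hx, rfl⟩ := h x
  refine ⟨⟨e.toPartialEquiv, e.open_source, e.open_target, hf.contMDiffOn, ?_⟩, hx,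
    fun _ _ => rfl⟩
  intro y hy
  refine ContMDiffAt.contMDiffWithinAt ?_
  set z := e.symm y with hz
  have hzs : z ∈ e.source := e.map_target hy
  have hzy : e z = y := e.right_inv hy
  let c := chartAt M.model z
  let c' := chartAt N.model y
  -- The local homeomorphism read in charts: its inverse is smooth at a point because the derivative
  -- there is invertible, and inverting charts recovers smoothness of `e.symm`.
  let F : OpenPartialHomeomorph M.model N.model := (c.symm ≫ₕ e) ≫ₕ c'
  have hF : c z ∈ F.source := by
    simp only [F, OpenPartialHomeomorph.trans_source, OpenPartialHomeomorph.symm_source,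
      Set.mem_inter_iff, Set.mem_preimage, OpenPartialHomeomorph.coe_trans, Function.comp_apply]
    rw [c.left_inv (mem_chart_source _ z), hzy]
    exact ⟨⟨mem_chart_target _ z, hzs⟩, mem_chart_source _ y⟩
  have hFz : F (c z) = c' y := by
    simp only [F, OpenPartialHomeomorph.coe_trans, Function.comp_apply]
    rw [c.left_inv (mem_chart_source _ z), hzy]
  have hd : ContDiffAt ℝ ∞ F (c z) := by
    have h1 := (contMDiffAt_iff.1 (hf z)).2
    rw [show (e : M → N) z = y from hzy] at h1
    simp only [extChartAt_coe, extChartAt_coe_symm, modelWithCornersSelf_coe,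
      modelWithCornersSelf_coe_symm, Set.range_id, contDiffWithinAt_univ, Function.comp_def,
      id_eq] at h1
    exact h1
  have hd' : fderiv ℝ F (c z) = tmap e z := by
    have h1 := (hf.mdifferentiableAt z).mfderiv
    have h2 : (e : M → N) z = y := hzy
    rw [tmap, h1]
    simp only [writtenInExtChartAt, h2]
    simp [F, c, c']
  have hb : Function.Bijective (fderiv ℝ F (c z)) := by
    rw [hd']
    exact ht z
  let L : M.model ≃L[ℝ] N.model :=
    (LinearEquiv.ofBijective (fderiv ℝ F (c z)).toLinearMap hb).toContinuousLinearEquiv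
  have hL : HasFDerivAt F (L : M.model →L[ℝ] N.model) (c z) := by
    have h1 := (hd.differentiableAt (by simp)).hasFDerivAt
    exact h1
  have hs : F.symm (c' y) = c z := by rw [← hFz, F.left_inv hF]
  have hi : ContDiffAt ℝ ∞ F.symm (c' y) :=
    F.contDiffAt_symm (hFz ▸ F.map_source hF) (hs.symm ▸ hL) (hs.symm ▸ hd)
  rw [contMDiffAt_iff]
  refine ⟨e.continuousAt_symm hy, ?_⟩
  have : ContDiffWithinAt ℝ ∞ F.symm (Set.range 𝓘(ℝ, N.model)) (c' y) := hi.contDiffWithinAt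
  simpa [F, Function.comp_assoc] using this

/-- The inverse function theorem. -/
theorem etale_of_bijective {f : M → N} (hf : Smooth f)
    (ht : ∀ x, Function.Bijective (tmap f x)) : Etale f := by
  refine etale_of_isLocalHomeomorph (IsLocalHomeomorph.mk f fun x => ?_) hf ht
  let c := chartAt M.model x
  let c' := chartAt N.model (f x)
  let F : M.model → N.model := c' ∘ f ∘ c.symm
  have hd : ContDiffAt ℝ ∞ F (c x) := by
    have h1 := (contMDiffAt_iff.1 (hf x)).2
    simpa [contDiffWithinAt_univ] using h1
  have hd' : fderiv ℝ F (c x) = tmap f x := by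
    have h1 := (hf.mdifferentiableAt x).mfderiv
    rw [tmap, h1]
    simp [F, c, c', writtenInExtChartAt]
  have hb : Function.Bijective (fderiv ℝ F (c x)) := by
    rw [hd']
    exact ht x
  let L : M.model ≃L[ℝ] N.model :=
    (LinearEquiv.ofBijective (fderiv ℝ F (c x)).toLinearMap hb).toContinuousLinearEquiv
  have hL : HasFDerivAt F (L : M.model →L[ℝ] N.model) (c x) := by
    have h1 := (hd.differentiableAt (by simp)).hasFDerivAt
    exact h1
  let E := hd.toOpenPartialHomeomorph F hL (by simp)
  -- Outside the preimage of the chart domain, `c'.symm (c' (f z))` need not be `f z`; the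
  -- restriction makes `e` agree with `f` on its whole source.
  let e := ((c ≫ₕ E) ≫ₕ c'.symm).restrOpen (f ⁻¹' c'.source)
    (c'.open_source.preimage hf.continuous)
  have he : ∀ z ∈ e.source, c.symm (c z) = z ∧ f z ∈ c'.source := by
    intro z hz
    simp only [e, OpenPartialHomeomorph.restrOpen_source, OpenPartialHomeomorph.trans_source] at hz
    exact ⟨c.left_inv hz.1.1.1, hz.2⟩
  have hEF : ∀ z, E z = F z := fun z => rfl
  refine ⟨e, ?_, fun z hz => ?_⟩
  · have h1 : c x ∈ E.source := hd.mem_toOpenPartialHomeomorph_source hL (by simp)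
    have h2 : F (c x) = c' (f x) := congrArg (fun z => c' (f z)) (c.left_inv (mem_chart_source _ x))
    simp only [e, OpenPartialHomeomorph.restrOpen_source, OpenPartialHomeomorph.trans_source]
    refine ⟨⟨⟨mem_chart_source _ x, h1⟩, ?_⟩, mem_chart_source _ (f x)⟩
    simp only [Set.mem_preimage, OpenPartialHomeomorph.coe_trans, Function.comp_apply, hEF, h2]
    exact c'.map_source (mem_chart_source _ (f x))
  · obtain ⟨h1, h2⟩ := he z hz
    change f z = c'.symm (c' (f (c.symm (c z))))
    rw [h1, c'.left_inv h2]

theorem Etale.id : Etale (fun x : M => x) :=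
  etale_of_bijective contMDiff_id fun x => by
    rw [tmap_id]
    exact Function.bijective_id

theorem Etale.comp {g : N → Q} {f : M → N} (hg : Etale g) (hf : Etale f) :
    Etale (fun x => g (f x)) :=
  etale_of_bijective (hg.smooth.comp hf.smooth) fun x => by
    rw [tmap_comp hg.smooth hf.smooth]
    exact (hg.tmap_bijective _).comp (hf.tmap_bijective _)

/-- A continuous lift of a smooth map along a local diffeomorphism is smooth. -/
theorem Etale.smooth_lift {g : N → Q} (hg : Etale g) {f : M → N} (hf : Continuous f)
    (h : Smooth fun x => g (f x)) : Smooth f := by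
  intro x
  obtain ⟨Φ, hx, hΦ⟩ := hg (f x)
  have h1 : ContMDiffAt 𝓘(ℝ, Q.model) 𝓘(ℝ, N.model) ∞ Φ.symm (g (f x)) := by
    rw [hΦ hx]
    exact (Φ.symm.contMDiffOn _ (Φ.map_source hx)).contMDiffAt
      (Φ.open_target.mem_nhds (Φ.map_source hx))
  refine (h1.comp x (h x)).congr_of_eventuallyEq ?_
  filter_upwards [(Φ.open_source.preimage hf).mem_nhds hx] with y hy
  simp only [Function.comp_apply, hΦ hy]
  exact (Φ.left_inv hy).symm

theorem Etale.lift {g : N → Q} (hg : Etale g) {f : M → N} (hf : Continuous f)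
    (h : Etale fun x => g (f x)) : Etale f := by
  have hs := hg.smooth_lift hf h.smooth
  refine etale_of_bijective hs fun x => ?_
  have := h.tmap_bijective x
  rw [tmap_comp hg.smooth hs] at this
  exact ((hg.tmap_bijective _).of_comp_iff' _).1 this

theorem Etale.submersion {f : M → N} (hf : Etale f) : Submersion f := by
  refine Manifold.IsSubmersionOfComplement.isSubmersion (F := PUnit.{u + 1}) fun x => ?_
  obtain ⟨Φ, hx, hΦ⟩ := hf x
  let c := chartAt N.model (f x)
  let L := hf.tequiv x
  -- The chart of the target, pulled back along the local diffeomorphism, serves as chart of the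
  -- source; `L` only corrects the model space. In these charts the map is linear, with the
  -- one-point space as complement.
  let e := (Φ.toOpenPartialHomeomorph ≫ₕ c) ≫ₕ L.symm.toHomeomorph.toOpenPartialHomeomorph
  have he : ∀ z, e z = L.symm (c (Φ z)) := fun _ => rfl
  have hes : ∀ y, e.symm y = Φ.symm (c.symm (L y)) := fun _ => rfl
  have hsource : ∀ z, z ∈ e.source ↔ z ∈ Φ.source ∧ Φ z ∈ c.source := fun z => by
    simp [e]
  have htarget : ∀ y, y ∈ e.target ↔ L y ∈ c.target ∧ c.symm (L y) ∈ Φ.target := fun y => by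
    simp [e]
  have h1 : ContMDiffOn 𝓘(ℝ, M.model) 𝓘(ℝ, M.model) ∞ e e.source := fun z hz => by
    obtain ⟨h1, h2⟩ := (hsource z).1 hz
    refine ContMDiffAt.contMDiffWithinAt ?_
    have h3 := (Φ.contMDiffOn z h1).contMDiffAt (Φ.open_source.mem_nhds h1)
    have h4 := (contMDiffOn_chart (I := 𝓘(ℝ, N.model)) (n := ∞) (x := f x) _ h2).contMDiffAt
      (c.open_source.mem_nhds h2)
    exact (L.symm.contDiff.contMDiff.contMDiffAt).comp z (h4.comp z h3)
  have h2 : ContMDiffOn 𝓘(ℝ, M.model) 𝓘(ℝ, M.model) ∞ e.symm e.target := fun y hy => by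
    obtain ⟨h1, h2⟩ := (htarget y).1 hy
    refine ContMDiffAt.contMDiffWithinAt ?_
    have h3 := contMDiffAt_chart_symm (x := f x) h1
    have h4 := (Φ.symm.contMDiffOn _ h2).contMDiffAt (Φ.open_target.mem_nhds h2)
    have h5 : ContMDiffAt 𝓘(ℝ, M.model) 𝓘(ℝ, N.model) ∞ L y :=
      L.contDiff.contMDiff.contMDiffAt
    exact ContMDiffAt.comp (I' := 𝓘(ℝ, N.model)) (g := fun z => Φ.symm (c.symm z)) (f := L) y
      (h4.comp (L y) h3) h5
  refine Manifold.IsSubmersionAtOfComplement.mk_of_continuousAt hf.smooth.continuous.continuousAt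
    (L.trans (ContinuousLinearEquiv.prodUnique ℝ N.model PUnit.{u + 1}).symm) e c
    ((hsource x).2 ⟨hx, hΦ hx ▸ mem_chart_source _ (f x)⟩) (mem_chart_source _ (f x))
    (e.mem_maximalAtlas_of_contMDiffOn h1 h2) (IsManifold.chart_mem_maximalAtlas _) ?_
  intro y hy
  have hy' : y ∈ e.target := by simpa using hy
  obtain ⟨h3, h4⟩ := (htarget y).1 hy'
  change c (f (e.symm y)) = L y
  rw [hes, hΦ (Φ.symm.map_source h4)]
  exact (congrArg c (Φ.right_inv h4)).trans (c.right_inv h3)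

theorem submersion_of_subsingleton {f : M → N} [Subsingleton N.model] (hf : Continuous f) :
    Submersion f := by
  refine Manifold.IsSubmersionOfComplement.isSubmersion (F := M.model) fun x => ?_
  let _ : Unique N.model := @Unique.mk' _ ⟨0⟩ _
  exact Manifold.IsSubmersionAtOfComplement.mk_of_continuousAt hf.continuousAt
    (ContinuousLinearEquiv.uniqueProd ℝ M.model N.model).symm
    (chartAt M.model x) (chartAt N.model (f x)) (mem_chart_source _ x) (mem_chart_source _ (f x))
    (IsManifold.chart_mem_maximalAtlas _) (IsManifold.chart_mem_maximalAtlas _)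
    fun y _ => Subsingleton.elim _ _

end Mfd

/-! ### Local homeomorphisms: base change, products, diagonals -/

section Topology

variable {Q A B P : Type*} [TopologicalSpace Q] [TopologicalSpace A] [TopologicalSpace B]
  [TopologicalSpace P]

/-- Base change of a local homeomorphism along an embedding. -/
theorem IsLocalHomeomorph.of_embedding {j : Q → A} {E : A → B} {c : P → B} {π : Q → P}
    (hE : IsLocalHomeomorph E) (hj : Topology.IsEmbedding j) (hc : Topology.IsEmbedding c)
    (h : ∀ q, c (π q) = E (j q)) {U : Set A} (hU : IsOpen U) (hjU : ∀ q, j q ∈ U)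
    (hr : ∀ m ∈ U, E m ∈ Set.range c → m ∈ Set.range j) : IsLocalHomeomorph π := by
  rw [isLocalHomeomorph_iff_isOpenEmbedding_restrict]
  intro q
  obtain ⟨e, he, rfl⟩ := hE (j q)
  let W : Set Q := j ⁻¹' (e.source ∩ U)
  have hW : IsOpen W := (e.open_source.inter hU).preimage hj.continuous
  have hπ : Continuous π := by
    rw [hc.continuous_iff]
    have : c ∘ π = e ∘ j := funext h
    rw [this]
    exact hE.continuous.comp hj.continuous
  refine ⟨W, hW.mem_nhds ⟨he, hjU q⟩, ?_, ?_⟩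
  · refine Topology.IsEmbedding.of_comp (hπ.comp continuous_subtype_val) hc.continuous ?_
    have h1 : c ∘ W.domRestrict π = e.source.domRestrict e ∘
        fun w : W => ⟨j w, w.2.1⟩ := funext fun w => h w
    rw [h1]
    refine e.isOpenEmbedding_restrict.isEmbedding.comp ?_
    refine Topology.IsEmbedding.of_comp ?_ continuous_subtype_val ?_
    · exact (hj.continuous.comp continuous_subtype_val).subtype_mk _
    · exact hj.comp Topology.IsEmbedding.subtypeVal
  -- Hypothesis `hr` says that a point of `U` whose image lies in `P` comes from `Q`. The image of
  -- `W` is therefore the trace on `P` of an open set, hence open.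
  · have h2 : Set.range (W.domRestrict π) = c ⁻¹' (e '' (e.source ∩ U)) := by
      ext p
      constructor
      · rintro ⟨w, rfl⟩
        exact ⟨j w, w.2, (h w).symm⟩
      · rintro ⟨m, hm, hp⟩
        obtain ⟨q', rfl⟩ := hr m hm.2 ⟨p, hp.symm⟩
        exact ⟨⟨q', hm⟩, hc.injective ((h q').trans hp)⟩
    rw [h2]
    exact (e.isOpen_image_of_subset_source (e.open_source.inter hU)
      Set.inter_subset_left).preimage hc.continuous

theorem IsLocalHomeomorph.piMap {ι : Type*} [Finite ι] {X Y : ι → Type*}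
    [∀ i, TopologicalSpace (X i)] [∀ i, TopologicalSpace (Y i)] {f : ∀ i, X i → Y i}
    (hf : ∀ i, IsLocalHomeomorph (f i)) :
    IsLocalHomeomorph fun (x : ∀ i, X i) i => f i (x i) := by
  intro x
  choose e he hfe using fun i => hf i (x i)
  refine ⟨OpenPartialHomeomorph.pi e, fun i _ => he i, ?_⟩
  funext y i
  exact congrFun (hfe i) (y i)

/-- The diagonal is open in the fibre product of a locally injective map with itself. -/
theorem IsLocalHomeomorph.exists_isOpen_diagonal {f : A → B} (hf : IsLocalHomeomorph f) :
    ∃ V : Set (A × A), IsOpen V ∧ (∀ x, (x, x) ∈ V) ∧ ∀ x y, (x, y) ∈ V → f x = f y → x = y := by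
  choose e he hfe using hf
  refine ⟨⋃ x, (e x).source ×ˢ (e x).source, isOpen_iUnion fun x =>
    (e x).open_source.prod (e x).open_source, fun x => Set.mem_iUnion.2 ⟨x, he x, he x⟩, ?_⟩
  intro x y hxy h
  obtain ⟨z, hx, hy⟩ := Set.mem_iUnion.1 hxy
  rw [hfe z] at h
  exact (e z).injOn hx hy h

end Topology

/-! ### Pulled-back smooth structures, products, presentations of submanifolds -/

namespace Mfd

variable {M N Q : Mfd.{u}}

/-- Projections, coordinates and pulled-back étale maps are all linear in the preferred charts; this
and the next lemma give their smoothness and tangent maps together. -/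
theorem contMDiffAt_of_chart {f : M → N} (hf : Continuous f) {x : M} (L : M.model →L[ℝ] N.model)
    (h : ∀ y ∈ (chartAt M.model x).target,
      chartAt N.model (f x) (f ((chartAt M.model x).symm y)) = L y) :
    ContMDiffAt 𝓘(ℝ, M.model) 𝓘(ℝ, N.model) ∞ f x := by
  rw [contMDiffAt_iff]
  refine ⟨hf.continuousAt, ?_⟩
  refine ContDiffWithinAt.congr_of_eventuallyEq (f := L) L.contDiff.contDiffWithinAt ?_ ?_
  · exact nhdsWithin_le_nhds (Filter.mem_of_superset
      ((chartAt M.model x).open_target.mem_nhds (mem_chart_target _ x)) h)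
  · exact h _ (mem_chart_target _ x)

theorem tmap_of_chart {f : M → N} (hf : Continuous f) {x : M} (L : M.model →L[ℝ] N.model)
    (h : ∀ y ∈ (chartAt M.model x).target,
      chartAt N.model (f x) (f ((chartAt M.model x).symm y)) = L y) : tmap f x = L := by
  have h1 := (contMDiffAt_of_chart hf L h).mdifferentiableAt (by simp)
  rw [tmap, h1.mfderiv]
  simp only [modelWithCornersSelf_coe, Set.range_id, fderivWithin_univ]
  have h2 : writtenInExtChartAt 𝓘(ℝ, M.model) 𝓘(ℝ, N.model) x f =ᶠ[nhds (chartAt M.model x x)] L :=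
    Filter.mem_of_superset ((chartAt M.model x).open_target.mem_nhds (mem_chart_target _ x)) h
  exact h2.fderiv_eq.trans L.fderiv

section LocalHomeomorph

variable {Q : Type u} [TopologicalSpace Q] {π : Q → N} (hπ : IsLocalHomeomorph π)

/-- The charts pulled back along a local homeomorphism. -/
@[reducible] def pullChartedSpace : ChartedSpace N.model Q where
  atlas := {e | ∃ (ε : OpenPartialHomeomorph Q N) (c : OpenPartialHomeomorph N N.model),
    π = ε ∧ c ∈ atlas N.model N.carrier ∧ e = ε ≫ₕ c}
  chartAt q := (hπ q).choose ≫ₕ chartAt N.model (π q)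
  mem_chart_source q := by
    have h := (hπ q).choose_spec
    rw [OpenPartialHomeomorph.trans_source]
    exact ⟨h.1, (congrFun h.2 q) ▸ mem_chart_source N.model (π q)⟩
  chart_mem_atlas q := ⟨_, _, (hπ q).choose_spec.2, chart_mem_atlas _ _, rfl⟩

theorem pullIsManifold : @IsManifold ℝ _ N.model _ _ _ _ 𝓘(ℝ, N.model) ∞ Q _
    (pullChartedSpace hπ) := by
  let _ := pullChartedSpace hπ
  apply isManifold_of_contDiffOn
  rintro _ _ ⟨ε, c, h, hc, rfl⟩ ⟨ε', c', h', hc', rfl⟩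
  have hcc := HasGroupoid.compatible (G := contDiffGroupoid ∞ 𝓘(ℝ, N.model)) hc hc'
  rw [contDiffGroupoid, mem_groupoid_of_pregroupoid] at hcc
  have h1 : ContDiffOn ℝ ∞ (c.symm ≫ₕ c') (c.symm ≫ₕ c').source := by
    simpa [contDiffPregroupoid] using hcc.1
  have key : ∀ y, y ∈ ((ε ≫ₕ c).symm ≫ₕ ε' ≫ₕ c').source →
      ε' (ε.symm (c.symm y)) = c.symm y ∧ y ∈ (c.symm ≫ₕ c').source := by
    intro y hy
    simp only [OpenPartialHomeomorph.trans_source, OpenPartialHomeomorph.trans_symm_eq_symm_trans_symm,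
      OpenPartialHomeomorph.symm_source, Set.mem_inter_iff, Set.mem_preimage,
      OpenPartialHomeomorph.coe_trans, Function.comp_apply] at hy ⊢
    have h2 : ε' (ε.symm (c.symm y)) = c.symm y := by
      rw [← h', h, ε.right_inv hy.1.2]
    exact ⟨h2, hy.1.1, h2 ▸ hy.2.2⟩
  refine ContDiffOn.congr (h1.mono ?_) ?_
  · rintro y ⟨hy, -⟩
    exact (key y hy).2
  · rintro y ⟨hy, -⟩
    exact congrArg c' (key y hy).1

variable [T2Space Q] [SecondCountableTopology Q]

/-- The smooth structure on `Q` for which the local homeomorphism `π : Q → N` is a local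
diffeomorphism. -/
def pull : Mfd.{u} where
  carrier := Q
  model := N.model
  chartedSpace := pullChartedSpace hπ
  isManifold := pullIsManifold hπ

/-- The local homeomorphism `π : Q → N` as a map of manifolds. -/
def pullMap : pull hπ → N := π

/-- The preferred chart at `q` is a local branch of `π` followed by the chart at `π q`, so `π` reads
as the identity. -/
theorem pull_chart (q : pull hπ) (y : N.model) (hy : y ∈ (chartAt (pull hπ).model q).target) :
    chartAt N.model (pullMap hπ q) (pullMap hπ ((chartAt (pull hπ).model q).symm y)) = y := by
  have h := (hπ q).choose_spec.2
  have h1 : y ∈ ((hπ q).choose ≫ₕ chartAt N.model (π q)).target := hy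
  rw [OpenPartialHomeomorph.trans_target] at h1
  change chartAt N.model (π q) (π ((hπ q).choose.symm ((chartAt N.model (π q)).symm y))) = y
  have h2 : π ((hπ q).choose.symm ((chartAt N.model (π q)).symm y)) =
      (chartAt N.model (π q)).symm y :=
    (congrFun h _).trans ((hπ q).choose.right_inv h1.2)
  rw [h2, (chartAt N.model (π q)).right_inv h1.1]

theorem pullMap_smooth : Smooth (pullMap hπ) := fun q =>
  contMDiffAt_of_chart hπ.continuous (ContinuousLinearMap.id ℝ N.model) (pull_chart hπ q)

theorem tmap_pullMap (q : pull hπ) : tmap (pullMap hπ) q =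
    ContinuousLinearMap.id ℝ N.model :=
  tmap_of_chart (M := pull hπ) (f := pullMap hπ) (x := q) hπ.continuous
    (ContinuousLinearMap.id ℝ N.model) (pull_chart hπ q)

theorem pullMap_etale : Etale (pullMap hπ) :=
  etale_of_isLocalHomeomorph hπ (pullMap_smooth hπ) fun q => by
    rw [tmap_pullMap]
    exact Function.bijective_id

end LocalHomeomorph

/-- The product of two manifolds. -/
def prod (M N : Mfd.{u}) : Mfd.{u} where
  carrier := M × N
  model := M.model × N.model
  chartedSpace := prodChartedSpace M.model M N.model N
  isManifold := by
    rw [modelWithCornersSelf_prod]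
    exact IsManifold.prod M N

theorem prod_fst_chart (x : M.prod N) (y : (M.prod N).model)
    (hy : y ∈ (chartAt (M.prod N).model x).target) :
    chartAt M.model x.1 ((chartAt (M.prod N).model x).symm y : M.prod N).1 =
      ContinuousLinearMap.fst ℝ M.model N.model y :=
  (chartAt M.model x.1).right_inv hy.1

theorem prod_snd_chart (x : M.prod N) (y : (M.prod N).model)
    (hy : y ∈ (chartAt (M.prod N).model x).target) :
    chartAt N.model x.2 ((chartAt (M.prod N).model x).symm y : M.prod N).2 =
      ContinuousLinearMap.snd ℝ M.model N.model y :=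
  (chartAt N.model x.2).right_inv hy.2

theorem smooth_fst : Smooth (M := M.prod N) (N := M) Prod.fst := fun x =>
  contMDiffAt_of_chart continuous_fst _ (prod_fst_chart x)

theorem smooth_snd : Smooth (M := M.prod N) (N := N) Prod.snd := fun x =>
  contMDiffAt_of_chart continuous_snd _ (prod_snd_chart x)

theorem tmap_fst (x : M.prod N) (v : (M.prod N).model) :
    tmap (M := M.prod N) (N := M) Prod.fst x v = v.1 :=
  congrArg (fun A : (M.prod N).model →L[ℝ] M.model => A v)
    (tmap_of_chart (M := M.prod N) continuous_fst _ (prod_fst_chart x))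

theorem tmap_snd (x : M.prod N) (v : (M.prod N).model) :
    tmap (M := M.prod N) (N := N) Prod.snd x v = v.2 :=
  congrArg (fun A : (M.prod N).model →L[ℝ] N.model => A v)
    (tmap_of_chart (M := M.prod N) continuous_snd _ (prod_snd_chart x))

theorem tmap_coord {n : ℕ} (i : Fin n) (x : pow M n) (v : (pow M n).model) :
    tmap (M := pow M n) (N := M) (fun y => y i) x v = v i :=
  congrArg (fun A : (pow M n).model →L[ℝ] M.model => A v)
    (tmap_of_chart (M := pow M n) (f := fun y => y i) (continuous_apply i)
      (ContinuousLinearMap.proj i) fun _ hy => (chartAt M.model (x i)).right_inv (hy i trivial))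

/-- The map to a product with given components. -/
def pair (f : Q → M) (g : Q → N) : Q → M.prod N := fun x => (f x, g x)

theorem smooth_pair {f : Q → M} {g : Q → N} (hf : Smooth f) (hg : Smooth g) :
    Smooth (pair f g) := by
  intro x
  rw [contMDiffAt_iff]
  exact ⟨hf.continuous.continuousAt.prodMk hg.continuous.continuousAt,
    (contMDiffAt_iff.1 (hf x)).2.prodMk (contMDiffAt_iff.1 (hg x)).2⟩

theorem tmap_pow_eq_zero {n : ℕ} {f : N → pow M n} (hf : Smooth f) {x : N} {v : N.model}
    (h : ∀ i, tmap (N := M) (fun y => f y i) x v = 0) : tmap f x v = 0 := by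
  funext i
  refine (tmap_coord i (f x) (tmap f x v)).symm.trans (Eq.trans ?_ (h i))
  exact (congrArg (fun A : N.model →L[ℝ] M.model => A v)
    (tmap_comp (Mfd.contMDiff_coord M i) hf x)).symm

/-- Presenting an open subset of the preimage of a submanifold under a product of local
diffeomorphisms, together with a map into it that covers a local diffeomorphism. -/
theorem mapsToSubmanifold_etale {ι : Type} [Finite ι] {A B : ι → Mfd.{u}} {J X : Mfd.{u}}
    {E : ∀ i, A i → B i} (hE : ∀ i, Etale (E i)) {S' : Set (∀ i, B i)} {c' : ∀ i, J → B i}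
    (hc' : IsSubmanifold S' J c') {Ψ : X → J} (hΨ : Etale Ψ) {q : ∀ i, X → A i}
    (hq : ∀ i, Continuous (q i)) (hqΨ : ∀ i x, E i (q i x) = c' i (Ψ x)) {S U : Set (∀ i, A i)}
    (hU : IsOpen U) (hS : ∀ x, x ∈ S ↔ x ∈ U ∧ (fun i => E i (x i)) ∈ S')
    (hqS : ∀ x, (fun i => q i x) ∈ S) : MapsToSubmanifold S q Etale := by
  have hr : ∀ s : S, ∃ y, (fun i => c' i y) = fun i => E i (s.1 i) := fun s => by
    have := ((hS s.1).1 s.2).2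
    rwa [← hc'.range_eq] at this
  -- `π` sends a point of `S` to the point of `J` presenting its image. It is a base change of the
  -- product of the `E i`, and `S` receives the smooth structure pulled back along it.
  choose π hπ using hr
  have hloc : IsLocalHomeomorph π := by
    refine (IsLocalHomeomorph.piMap fun i => (hE i).isLocalHomeomorph).of_embedding
      (j := Subtype.val) (c := fun y i => c' i y) Topology.IsEmbedding.subtypeVal hc'.embedding
      hπ hU (fun s => ((hS s.1).1 s.2).1) ?_
    rintro m hm h
    rw [hc'.range_eq] at h
    exact ⟨⟨m, (hS m).2 ⟨hm, h⟩⟩, rfl⟩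
  have het := pullMap_etale hloc
  have hcs : ∀ i, Smooth (M := pull hloc) (N := A i) fun s : S => s.1 i := by
    intro i
    refine (hE i).smooth_lift ((continuous_apply i).comp continuous_subtype_val) ?_
    have h1 := (hc'.smooth i).comp het.smooth
    have h2 : (fun s : pull hloc => E i ((s : S).1 i)) = c' i ∘ pullMap hloc :=
      funext fun s => (congrFun (hπ s) i).symm
    exact h2 ▸ h1
  have hpc : Continuous fun x => (⟨fun i => q i x, hqS x⟩ : S) :=
    (continuous_pi hq).subtype_mk _
  -- The map into `S` is a continuous lift of the étale map `Ψ` along the étale map `π`.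
  have hpe : Etale (N := pull hloc) fun x => (⟨fun i => q i x, hqS x⟩ : S) := by
    refine het.lift hpc ?_
    have : (fun x => pullMap hloc (⟨fun i => q i x, hqS x⟩ : S)) = Ψ := by
      funext x
      refine hc'.embedding.injective ((hπ _).trans (funext fun i => hqΨ i x))
    exact this ▸ hΨ
  refine ⟨pull hloc, fun i (s : S) => s.1 i, ⟨hcs, ?_, ?_, ?_⟩, ⟨_, hpe.smooth⟩,
    fun _ _ => rfl, hpe⟩
  · exact Topology.IsEmbedding.subtypeVal
  · exact Subtype.range_val
  · intro s v hv
    refine het.eq_zero (x := s) (hc'.immersion (pullMap hloc s) (tmap (pullMap hloc) s v)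
      fun i => ?_)
    have h1 := tmap_comp (hc'.smooth i) het.smooth s
    have h2 := tmap_comp (hE i).smooth (hcs i) s
    have h3 : (fun s : pull hloc => E i ((s : S).1 i)) = fun s => c' i (pullMap hloc s) :=
      funext fun s => (congrFun (hπ s) i).symm
    rw [← h3, h2] at h1
    have h4 := congrArg (fun L : (pull hloc).model →L[ℝ] (B i).model => L v) h1
    refine h4.symm.trans ?_
    exact (congrArg (tmap (E i) _) (hv i)).trans (map_zero _)

section MapsTo

variable {ι : Type} {A : ι → Mfd.{u}} {S : Set (∀ i, A i)} {X : Mfd.{u}} {q : ∀ i, X → A i}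

theorem MapsToSubmanifold.submersion (h : MapsToSubmanifold S q Etale) :
    MapsToSubmanifold S q Submersion := by
  obtain ⟨P, c, hc, p, hp, he⟩ := h
  exact ⟨P, c, hc, p, hp, Etale.submersion he⟩

theorem MapsToSubmanifold.injectiveEtale (h : MapsToSubmanifold S q Etale)
    (hq : ∀ x y, (∀ i, q i x = q i y) → x = y) : MapsToSubmanifold S q InjectiveEtale := by
  obtain ⟨P, c, hc, p, hp, he⟩ := h
  refine ⟨P, c, hc, p, hp, fun x y hxy => hq x y fun i => ?_, he⟩
  rw [← hp, ← hp, hxy]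

theorem MapsToSubmanifold.immersion (h : MapsToSubmanifold S q Etale) {x : X} {v : X.model}
    (hv : ∀ i, tmap (q i) x v = 0) : v = 0 := by
  obtain ⟨P, c, hc, p, hp, he⟩ := h
  refine Etale.eq_zero he (x := x) (hc.immersion (map p x) (tmap (map p) x v) fun i => ?_)
  have h1 := tmap_comp (hc.smooth i) he.smooth x
  have h2 : (fun x => c i (map p x)) = q i := funext fun x => hp i x
  rw [h2] at h1
  exact (congrArg (fun L : X.model →L[ℝ] (A i).model => L v) h1).symm.trans (hv i)

/-- A submanifold presented by `X` itself. -/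
theorem IsSubmanifold.mapsTo (h : IsSubmanifold S X q) : MapsToSubmanifold S q Etale :=
  ⟨X, q, h, ⟨fun x => x, contMDiff_id⟩, fun _ _ => rfl, Etale.id⟩

end MapsTo

end Mfd

/-! ### Horn and matching conditions for levelwise étale morphisms -/

namespace SMfd

variable {K J : SMfd.{u}}

theorem face_smooth (K : SMfd.{u}) {l : ℕ} (i : Fin (l + 2)) : Mfd.Smooth (K.face i) :=
  (K.δ i).smooth

theorem level_smooth (f : K ⟶ J) (l : ℕ) : Mfd.Smooth (level f l) :=
  (f.app (op (.mk l))).smooth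

theorem map_comp_apply (K : SMfd.{u}) {a b c : SimplexCategoryᵒᵖ} (f : a ⟶ b) (g : b ⟶ c)
    (x : K.obj a) : Mfd.map (K.map (f ≫ g)) x = Mfd.map (K.map g) (Mfd.map (K.map f) x) := by
  rw [K.map_comp]
  rfl

theorem level_naturality (f : K ⟶ J) {a b : SimplexCategoryᵒᵖ} (θ : a ⟶ b) (x : K.obj a) :
    Mfd.map (f.app b) (Mfd.map (K.map θ) x) = Mfd.map (J.map θ) (Mfd.map (f.app a) x) :=
  congrFun (congrArg Mfd.map (f.naturality θ)) x

theorem level_face (f : K ⟶ J) {l : ℕ} (i : Fin (l + 2)) (x : K.lev (l + 1)) :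
    level f l (K.face i x) = J.face i (level f (l + 1) x) :=
  level_naturality f _ x

theorem face_face (K : SMfd.{u}) {l : ℕ} {a b : Fin (l + 2)} (h : a ≤ b) (x : K.lev (l + 2)) :
    K.face a (K.face b.succ x) = K.face b (K.face a.castSucc x) :=
  congrFun (congrArg Mfd.map (SimplicialObject.δ_comp_δ (X := K) h)) x

theorem faces_mem_horn (K : SMfd.{u}) (l : ℕ) (j : Fin (l + 3)) (x : K.lev (l + 2)) :
    (fun i : {i : Fin (l + 3) // i ≠ j} => K.face i.1 x) ∈ horn K (l + 1) j :=
  fun _ _ h _ _ => K.face_face h x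

theorem faces_mem_boundary (K : SMfd.{u}) : ∀ (l : ℕ) (x : K.lev (l + 1)),
    (fun i : Fin (l + 2) => K.face i x) ∈ boundary K l
  | 0, _ => trivial
  | _ + 1, x => fun _ _ h => K.face_face h x

/-- A horn `Λ[1, j]` is the single vertex `Fin.rev j`-th face, so its horn space is `K_0`, and any
continuous map to a zero-dimensional manifold is a submersion. -/
theorem hornProj_zero (K : SMfd.{u}) [Subsingleton (K.lev 0).model] (j : Fin 2) :
    HornProj K 0 j Mfd.Submersion := by
  have hne : Fin.rev j ≠ j := by
    intro h
    revert j
    decide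
  let _ : Unique {i : Fin 2 // i ≠ j} :=
    { default := ⟨Fin.rev j, hne⟩
      uniq := by
        rintro ⟨i, hi⟩
        apply Subtype.ext
        revert i j
        decide }
  refine ⟨K.lev 0, fun _ x => x, ⟨fun _ => contMDiff_id, ?_, ?_, ?_⟩, K.δ (Fin.rev j), ?_,
    Mfd.submersion_of_subsingleton (K.face_smooth _).continuous⟩
  · exact Topology.IsEmbedding.of_leftInverse (f := fun z => z default) (fun _ => rfl)
      (continuous_apply _) (continuous_pi fun _ => continuous_id)
  · refine Set.eq_univ_of_forall fun z => ⟨z default, ?_⟩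
    funext i
    rw [Unique.eq_default i]
  · intro x v _
    exact Subsingleton.elim _ _
  · intro i x
    rw [Unique.eq_default i]
    rfl

/-- The index in `HornProj` is one less than the dimension: `h` covers dimensions 2 and higher,
while injectivity is needed only from dimension 3 on. -/
theorem isLocalLieGroup_two [Unique (K.lev 0)] [Subsingleton (K.lev 0).model]
    (h : ∀ l j, HornProj K (l + 1) j Mfd.Etale)
    (hinj : ∀ (l : ℕ) (j : Fin (l + 4)) (x y : K.lev (l + 3)),
      (∀ i, i ≠ j → K.face i x = K.face i y) → x = y) : IsLocalLieGroup 2 K := by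
  refine ⟨fun l j => ?_, ⟨inferInstance⟩⟩
  match l, j with
  | 0, j => exact ⟨K.hornProj_zero j, fun h => by omega⟩
  | 1, j => exact ⟨(h 0 j).submersion, fun h => by omega⟩
  | l + 2, j => exact ⟨(h _ j).submersion, fun _ => (h _ j).injectiveEtale fun x y hxy =>
      hinj l j x y fun i hi => hxy ⟨i, hi⟩⟩

/-- For the identity the fibre product is the graph of the boundary map over `J_{l+1}`. It is the
reference with which the matching space of an étale morphism is compared. -/
theorem isSubmanifold_matchSpace_id (J : SMfd.{u}) (l : ℕ) :
    Mfd.IsSubmanifold (matchSpace (𝟙 J) l) (J.lev (l + 1)) (matchMap (𝟙 J) l) := by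
  have hs : ∀ s, Mfd.Smooth (matchMap (𝟙 J) l s) := by
    rintro (_ | a)
    · exact contMDiff_id
    · exact J.face_smooth a
  refine ⟨hs, ?_, ?_, ?_⟩
  · exact Topology.IsEmbedding.of_leftInverse (f := fun z => z none) (fun _ => rfl)
      (continuous_apply _) (continuous_pi fun s => (hs s).continuous)
  · ext z
    constructor
    · rintro ⟨x, rfl⟩
      exact ⟨J.faces_mem_boundary l x, fun _ => rfl⟩
    · rintro ⟨-, hz⟩
      refine ⟨z none, ?_⟩
      funext s
      match s with
      | none => rfl
      | some a => exact (hz a).symm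
  · intro x v hv
    exact (congrArg (fun A : (J.lev (l + 1)).model →L[ℝ] (J.lev (l + 1)).model => A v)
      (Mfd.tmap_id x)).symm.trans (hv none)

/-- Levelwise étale morphisms lift étale horn projections. -/
theorem hornProj_of_etale (Φ : K ⟶ J) (hΦ : ∀ l, Mfd.Etale (level Φ l)) {l : ℕ} {j : Fin (l + 3)}
    (h : Mfd.IsSubmanifold (horn J (l + 1) j) (J.lev (l + 2))
      (fun i : {i : Fin (l + 3) // i ≠ j} => J.face i.1)) :
    HornProj K (l + 1) j Mfd.Etale := by
  obtain ⟨V, hV, hd, hinj⟩ := (hΦ l).isLocalHomeomorph.exists_isOpen_diagonal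
  -- A family in `K` is a horn exactly when its image in `J` is one and each pair of faces to be
  -- matched lies in `V`: near the diagonal, equality after `Φ` implies equality. The second
  -- condition is open.
  refine Mfd.mapsToSubmanifold_etale (E := fun _ => level Φ (l + 1)) (fun _ => hΦ _) h (hΦ (l + 2))
    (fun i => (K.face_smooth i.1).continuous) (fun i x => level_face Φ i.1 x)
    (U := {x | ∀ (a b : Fin (l + 2)) (_ : a ≤ b) (ha : a.castSucc ≠ j) (hb : b.succ ≠ j),
      (K.face a (x ⟨b.succ, hb⟩), K.face b (x ⟨a.castSucc, ha⟩)) ∈ V}) ?_ ?_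
    (K.faces_mem_horn l j)
  · simp only [Set.ofPred_forall]
    refine isOpen_iInter_of_finite fun a => isOpen_iInter_of_finite fun b =>
      isOpen_iInter_of_finite fun _ => isOpen_iInter_of_finite fun ha =>
      isOpen_iInter_of_finite fun hb => hV.preimage ?_
    have hc : ∀ i, Continuous fun x : ∀ _ : {i : Fin (l + 3) // i ≠ j}, K.lev (l + 1) => x i :=
      fun i => continuous_apply i
    exact ((K.face_smooth a).continuous.comp (hc ⟨b.succ, hb⟩)).prodMk
      ((K.face_smooth b).continuous.comp (hc ⟨a.castSucc, ha⟩))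
  · intro x
    constructor
    · refine fun hx => ⟨fun a b hab ha hb => ?_, fun a b hab ha hb => ?_⟩
      · rw [hx a b hab ha hb]
        exact hd _
      · rw [← level_face, ← level_face, hx a b hab ha hb]
    · rintro ⟨hU, hx⟩ a b hab ha hb
      refine hinj _ _ (hU a b hab ha hb) ?_
      rw [level_face, level_face]
      exact hx a b hab ha hb

/-- The argument is the one for horns, with `Φ` applied to the boundary components and the component
in `J_{l+1}` kept fixed. -/
theorem matchProj_of_etale (Φ : K ⟶ J) (hΦ : ∀ l, Mfd.Etale (level Φ l)) (l : ℕ) :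
    MatchProj Φ (l + 1) Mfd.Etale := by
  have key : ∃ U : Set (Fin (l + 2) → K.lev l), IsOpen U ∧ ∀ x, x ∈ boundary K l ↔
      x ∈ U ∧ (fun a => level Φ l (x a)) ∈ boundary J l := by
    match l with
    | 0 => exact ⟨Set.univ, isOpen_univ, fun _ => ⟨fun _ => ⟨trivial, trivial⟩, fun _ => trivial⟩⟩
    | l + 1 =>
      obtain ⟨V, hV, hd, hinj⟩ := (hΦ l).isLocalHomeomorph.exists_isOpen_diagonal
      refine ⟨{x | ∀ (a b : Fin (l + 2)) (_ : a ≤ b),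
        (K.face a (x b.succ), K.face b (x a.castSucc)) ∈ V}, ?_, fun x => ?_⟩
      · simp only [Set.ofPred_forall]
        refine isOpen_iInter_of_finite fun a => isOpen_iInter_of_finite fun b =>
          isOpen_iInter_of_finite fun _ => hV.preimage ?_
        have hc : ∀ i, Continuous fun x : Fin (l + 3) → K.lev (l + 1) => x i :=
          fun i => continuous_apply i
        exact ((K.face_smooth a).continuous.comp (hc b.succ)).prodMk
          ((K.face_smooth b).continuous.comp (hc a.castSucc))
      · constructor
        · refine fun hx => ⟨fun a b hab => ?_, fun a b hab => ?_⟩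
          · rw [hx a b hab]
            exact hd _
          · rw [← level_face, ← level_face, hx a b hab]
        · rintro ⟨hU, hx⟩ a b hab
          refine hinj _ _ (hU a b hab) ?_
          rw [level_face, level_face]
          exact hx a b hab
  obtain ⟨U, hU, hb⟩ := key
  let E : ∀ s, matchAmbient K J l s → matchAmbient J J l s := fun s => match s with
    | some _ => level Φ l
    | none => fun x => x
  have hE : ∀ s, Mfd.Etale (E s) := by
    rintro (_ | a)
    · exact Mfd.Etale.id
    · exact hΦ l
  refine Mfd.mapsToSubmanifold_etale hE (isSubmanifold_matchSpace_id J l) (hΦ (l + 1))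
    (q := matchMap Φ l) ?_ ?_ (U := {x | (fun a : Fin (l + 2) => x (some a)) ∈ U}) ?_ ?_ ?_
  · rintro (_ | a)
    · exact (level_smooth Φ _).continuous
    · exact (K.face_smooth a).continuous
  · rintro (_ | a) x
    · rfl
    · exact level_face Φ a x
  · exact hU.preimage (continuous_pi fun a => continuous_apply (some a))
  · intro x
    constructor
    · rintro ⟨h1, h2⟩
      exact ⟨((hb _).1 h1).1, ((hb _).1 h1).2, h2⟩
    · rintro ⟨h1, h2, h3⟩
      exact ⟨(hb _).2 ⟨h1, h2⟩, h3⟩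
  · exact fun x => ⟨K.faces_mem_boundary l x, fun a => level_face Φ a x⟩

theorem isHypercover_two (Φ : K ⟶ J) (hΦ : ∀ l, Mfd.Etale (level Φ l))
    (hinj : ∀ x y : K.lev 2, (∀ i, K.face i x = K.face i y) → level Φ 2 x = level Φ 2 y → x = y) :
    IsHypercover 2 Φ := by
  refine ⟨fun i hi => ?_, ?_⟩
  · match i with
    | 0 => exact (hΦ 0).submersion
    | 1 => exact Mfd.MapsToSubmanifold.submersion (matchProj_of_etale Φ hΦ 0)
  · exact Mfd.MapsToSubmanifold.injectiveEtale (matchProj_of_etale Φ hΦ 1) fun x y h =>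
      hinj x y (fun i => h (some i)) (h none)

theorem isHypercover_two_id (K : SMfd.{u}) : IsHypercover 2 (𝟙 K) :=
  isHypercover_two _ (fun _ => Mfd.Etale.id) fun _ _ _ h => h

end SMfd

theorem Mfd.tmap_pair_eq_zero {M N Q : Mfd.{u}} {f : Q → M} {g : Q → N} (hf : Mfd.Smooth f)
    (hg : Mfd.Smooth g) {x : Q} {v : Q.model} (h1 : Mfd.tmap f x v = 0)
    (h2 : Mfd.tmap g x v = 0) : Mfd.tmap (Mfd.pair f g) x v = 0 := by
  have h := Mfd.smooth_pair hf hg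
  have e1 := congrArg (fun A : Q.model →L[ℝ] M.model => A v) (Mfd.tmap_comp Mfd.smooth_fst h x)
  have e2 := congrArg (fun A : Q.model →L[ℝ] N.model => A v) (Mfd.tmap_comp Mfd.smooth_snd h x)
  have f1 := (e1.trans (Mfd.tmap_fst _ _)).symm.trans h1
  have f2 := (e2.trans (Mfd.tmap_snd _ _)).symm.trans h2
  exact Prod.ext f1 f2

/-! ### Unique filling of horns in the nerve -/

namespace LieGrp

variable (G : LieGrp.{u})

theorem smooth_inv_mul : Mfd.Smooth (M := G.toMfd.prod G.toMfd) (N := G.toMfd)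
    fun p => p.1⁻¹ * p.2 :=
  smooth_mul (smooth_inv Mfd.smooth_fst) Mfd.smooth_snd

variable {G}

/-- The edge of a simplex of the nerve between two of its vertices. -/
def edge {n : ℕ} (x : Fin n → G) (p q : Fin (n + 1)) : G :=
  (Fin.partialProd x p)⁻¹ * Fin.partialProd x q

theorem edge_self {n : ℕ} (x : Fin n → G) (p : Fin (n + 1)) : edge x p p = 1 :=
  inv_mul_cancel _

theorem edge_mul {n : ℕ} (x : Fin n → G) (p q r : Fin (n + 1)) :
    edge x p q * edge x q r = edge x p r := by
  simp [edge, mul_assoc]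

theorem edge_inv_mul {n : ℕ} (x : Fin n → G) (p q r : Fin (n + 1)) :
    (edge x p q)⁻¹ * edge x p r = edge x q r := by
  simp [edge, mul_assoc]

theorem edge_castSucc_succ {n : ℕ} (x : Fin n → G) (i : Fin n) : edge x i.castSucc i.succ = x i :=
  Fin.partialProd_right_inv (G := G) x i

theorem ext_edge {n : ℕ} {x y : Fin n → G} (h : ∀ p q, edge x p q = edge y p q) : x = y := by
  funext i
  rw [← edge_castSucc_succ x, h, edge_castSucc_succ]

theorem edge_nerveOp {m n : ℕ} (θ : Fin (m + 1) →o Fin (n + 1)) (x : Fin n → G)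
    (p q : Fin (m + 1)) : edge (G.nerveOp θ x) p q = edge x (θ p) (θ q) := by
  simp [edge, partialProd_nerveOp, mul_assoc]

theorem edge_face {l : ℕ} (i : Fin (l + 2)) (x : G.nerve.lev (l + 1)) (p q : Fin (l + 1)) :
    edge (G := G) (n := l) (G.nerve.face i x) p q =
      edge (G := G) (n := l + 1) x (i.succAbove p) (i.succAbove q) :=
  edge_nerveOp _ _ _ _

/-- The simplex of the nerve with given products along the edges. -/
def ofVertices {n : ℕ} (γ : Fin (n + 1) → G) : Fin n → G := fun i => (γ i.castSucc)⁻¹ * γ i.succ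

theorem edge_ofVertices {n : ℕ} (γ : Fin (n + 1) → G) (p q : Fin (n + 1)) :
    edge (ofVertices γ) p q = (γ p)⁻¹ * γ q := by
  have h : ∀ k, Fin.partialProd (ofVertices γ) k = (γ 0)⁻¹ * γ k := fun k => by
    induction k using Fin.induction with
    | zero => simp
    | succ k ih => rw [Fin.partialProd_succ, ih]; simp [ofVertices, mul_assoc]
  simp [edge, h, mul_assoc]

theorem smooth_edge {n : ℕ} (p q : Fin (n + 1)) :
    Mfd.Smooth (M := G.nerve.lev n) (N := G.toMfd) fun x => edge (G := G) (n := n) x p q :=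
  (G.contMDiff_partialProd p).inv.mul (G.contMDiff_partialProd q)

theorem _root_.Fin.succAbove_castSucc_succAbove {n : ℕ} {a b : Fin (n + 2)} (h : a ≤ b)
    (r : Fin (n + 1)) : a.castSucc.succAbove (b.succAbove r) = b.succ.succAbove (a.succAbove r) := by
  have h' : a.1 ≤ b.1 := h
  apply Fin.ext
  simp only [Fin.succAbove, Fin.lt_def]
  split_ifs <;> simp_all <;> omega

/-- The edges of the members of a horn in the nerve agree. -/
theorem edge_eq_of_mem_horn {l : ℕ} {j : Fin (l + 3)}
    {x : ∀ _ : {i : Fin (l + 3) // i ≠ j}, G.nerve.lev (l + 1)} (hx : x ∈ G.nerve.horn (l + 1) j)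
    (i i' : {i : Fin (l + 3) // i ≠ j}) (p q p' q' : Fin (l + 2))
    (hp : i.1.succAbove p = i'.1.succAbove p') (hq : i.1.succAbove q = i'.1.succAbove q') :
    edge (G := G) (n := l + 1) (x i) p q = edge (G := G) (n := l + 1) (x i') p' q' := by
  have key : ∀ (a b : Fin (l + 2)) (ha : a.castSucc ≠ j) (hb : b.succ ≠ j) (p q p' q' : Fin (l + 2)),
      a ≤ b → a.castSucc.succAbove p = b.succ.succAbove p' →
      a.castSucc.succAbove q = b.succ.succAbove q' →
      edge (G := G) (n := l + 1) (x ⟨a.castSucc, ha⟩) p q =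
        edge (G := G) (n := l + 1) (x ⟨b.succ, hb⟩) p' q' := by
    intro a b ha hb p q p' q' hab hp hq
    -- A vertex lying in both faces belongs to their common face of codimension two, on which the
    -- horn condition compares the two members.
    have hr : ∀ p p' : Fin (l + 2), a.castSucc.succAbove p = b.succ.succAbove p' →
        ∃ r : Fin (l + 1), b.succAbove r = p ∧ a.succAbove r = p' := by
      intro p p' h
      have hpb : p ≠ b := by
        rintro rfl
        rw [Fin.succAbove_of_le_castSucc _ _ (Fin.castSucc_le_castSucc_iff.2 hab)] at h
        exact Fin.succAbove_ne _ _ h.symm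
      obtain ⟨r, rfl⟩ := Fin.exists_succAbove_eq hpb
      refine ⟨r, rfl, ?_⟩
      rw [Fin.succAbove_castSucc_succAbove hab] at h
      exact Fin.succAbove_right_injective h
    obtain ⟨r, rfl, rfl⟩ := hr p p' hp
    obtain ⟨s, rfl, rfl⟩ := hr q q' hq
    rw [← edge_face, ← edge_face]
    exact congrArg (fun y => edge (G := G) (n := l) y r s) (hx a b hab ha hb).symm
  obtain ⟨i, hi⟩ := i
  obtain ⟨i', hi'⟩ := i'
  rcases lt_trichotomy i i' with h | rfl | h
  · have h1 : i.1 < i'.1 := h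
    have h2 := i'.2
    obtain ⟨a, rfl⟩ : ∃ a : Fin (l + 2), a.castSucc = i := ⟨⟨i.1, by omega⟩, rfl⟩
    obtain ⟨b, rfl⟩ : ∃ b : Fin (l + 2), b.succ = i' :=
      ⟨⟨i'.1 - 1, by omega⟩, Fin.ext (show i'.1 - 1 + 1 = i'.1 by omega)⟩
    exact key a b hi hi' p q p' q' (Fin.le_def.2 (by simp at h1; omega)) hp hq
  · rw [Fin.succAbove_right_injective hp, Fin.succAbove_right_injective hq]
  · have h1 : i'.1 < i.1 := h
    have h2 := i.2
    obtain ⟨a, rfl⟩ : ∃ a : Fin (l + 2), a.castSucc = i' := ⟨⟨i'.1, by omega⟩, rfl⟩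
    obtain ⟨b, rfl⟩ : ∃ b : Fin (l + 2), b.succ = i :=
      ⟨⟨i.1 - 1, by omega⟩, Fin.ext (show i.1 - 1 + 1 = i.1 by omega)⟩
    exact (key a b hi' hi p' q' p q (Fin.le_def.2 (by simp at h1; omega)) hp.symm hq.symm).symm

/-- A simplex of the nerve is determined by its edges from vertex `j` to the vertices `k`. Each such
edge lies in a face of the horn, so the horn determines its filler by a smooth formula, which gives
the embedding and the injectivity of its derivative. -/
theorem isSubmanifold_horn (l : ℕ) (j : Fin (l + 3)) :
    Mfd.IsSubmanifold (G.nerve.horn (l + 1) j) (G.nerve.lev (l + 2))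
      (fun i : {i : Fin (l + 3) // i ≠ j} => G.nerve.face i.1) := by
  -- There are at least three vertices, so some face of the horn contains both `j` and `k`.
  have hι : ∀ k : Fin (l + 3), ∃ i, i ≠ j ∧ i ≠ k := fun k => by
    obtain ⟨i, -, hi⟩ := Finset.exists_mem_notMem_of_card_lt_card
      (s := ({j, k} : Finset (Fin (l + 3)))) (t := Finset.univ)
      (lt_of_le_of_lt Finset.card_le_two (by simp))
    simp only [Finset.mem_insert, Finset.mem_singleton, not_or] at hi
    exact ⟨i, hi⟩
  choose ι hιj hιk using hι
  choose p hp using fun k => Fin.exists_succAbove_eq (hιj k).symm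
  choose q hq using fun k => Fin.exists_succAbove_eq (hιk k).symm
  let γ : (∀ _ : {i : Fin (l + 3) // i ≠ j}, G.nerve.lev (l + 1)) → Fin (l + 3) → G :=
    fun x k => edge (G := G) (n := l + 1) (x ⟨ι k, hιj k⟩) (p k) (q k)
  have hγ : ∀ (g : G.nerve.lev (l + 2)) k,
      γ (fun i => G.nerve.face i.1 g) k = edge (G := G) (n := l + 2) g j k := by
    intro g k
    change edge (G := G) (n := l + 1) (G.nerve.face (ι k) g) (p k) (q k) = _
    rw [edge_face, hp, hq]
  have hleft : ∀ g : G.nerve.lev (l + 2),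
      ofVertices (γ fun i => G.nerve.face i.1 g) = (g : Fin (l + 2) → G) := by
    intro g
    refine ext_edge fun a b => ?_
    rw [edge_ofVertices, hγ, hγ]
    exact edge_inv_mul (G := G) (n := l + 2) g j a b
  have hsm : ∀ k, Mfd.Smooth (M := G.nerve.lev (l + 2)) (N := G.toMfd)
      fun g => γ (fun i => G.nerve.face i.1 g) k := fun k =>
    (smooth_edge (p k) (q k)).comp (G.nerve.face_smooth (ι k))
  refine ⟨fun i => G.nerve.face_smooth i.1, ?_, ?_, ?_⟩
  · refine Topology.IsEmbedding.of_leftInverse (f := fun x => ofVertices (γ x)) hleft ?_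
      (continuous_pi fun i => (G.nerve.face_smooth i.1).continuous)
    have hc : ∀ k, Continuous fun x => γ x k := fun k =>
      (smooth_edge (G := G) (p k) (q k)).continuous.comp (continuous_apply _)
    exact continuous_pi fun i => G.smooth_inv_mul.continuous.comp ((hc _).prodMk (hc _))
  · ext x
    constructor
    · rintro ⟨g, rfl⟩
      exact G.nerve.faces_mem_horn l j g
    · intro hx
      refine ⟨(ofVertices (γ x) : Fin (l + 2) → G), ?_⟩
      funext i
      -- `b` is the position of the vertex `j` in the face `i`; the edges from `j` inside this face
      -- agree with those chosen in `γ`.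
      obtain ⟨b, hb⟩ := Fin.exists_succAbove_eq i.2.symm
      have h1 : ∀ r, γ x (i.1.succAbove r) = edge (G := G) (n := l + 1) (x i) b r := fun r =>
        edge_eq_of_mem_horn hx ⟨_, hιj _⟩ i _ _ _ _ ((hp _).trans hb.symm) (hq _)
      refine ext_edge (G := G) (n := l + 1) fun r s => ?_
      refine (edge_face i.1 (ofVertices (γ x) : Fin (l + 2) → G) r s).trans
        ((edge_ofVertices (γ x) _ _).trans ?_)
      rw [h1, h1]
      exact edge_inv_mul (G := G) (n := l + 1) (x i) b r s
  · intro x v hv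
    have h0 : ∀ k, Mfd.tmap (M := G.nerve.lev (l + 2)) (N := G.toMfd)
        (fun g => γ (fun i => G.nerve.face i.1 g) k) x v = 0 := fun k => by
      have h1 := congrArg (fun A : (G.nerve.lev (l + 2)).model →L[ℝ] G.toMfd.model => A v)
        (Mfd.tmap_comp (smooth_edge (G := G) (p k) (q k)) (G.nerve.face_smooth (ι k)) x)
      exact h1.trans ((congrArg (Mfd.tmap (M := G.nerve.lev (l + 1)) (N := G.toMfd) _ _)
        (hv ⟨ι k, hιj k⟩)).trans (map_zero _))
    have h2 : Mfd.tmap (M := G.nerve.lev (l + 2)) (N := G.toMfd.pow (l + 2))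
        (fun g => (g : Fin (l + 2) → G)) x v = 0 := by
      refine Mfd.tmap_pow_eq_zero (f := fun g : G.nerve.lev (l + 2) => (g : Fin (l + 2) → G))
        contMDiff_id fun i => ?_
      have h3 : (fun g : G.nerve.lev (l + 2) => (g : Fin (l + 2) → G) i) = fun g =>
          (fun p : G.toMfd.prod G.toMfd => p.1⁻¹ * p.2)
            (Mfd.pair (M := G.toMfd) (N := G.toMfd) (fun g => γ (fun i => G.nerve.face i.1 g) i.castSucc)
              (fun g => γ (fun i => G.nerve.face i.1 g) i.succ) g) :=
        funext fun g => (congrFun (hleft g) i).symm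
      refine (congrArg (fun f => Mfd.tmap (M := G.nerve.lev (l + 2)) (N := G.toMfd) f x v) h3).trans ?_
      have h4 := congrArg (fun A : (G.nerve.lev (l + 2)).model →L[ℝ] G.toMfd.model => A v)
        (Mfd.tmap_comp G.smooth_inv_mul (Mfd.smooth_pair (hsm i.castSucc) (hsm i.succ)) x)
      exact h4.trans ((congrArg (Mfd.tmap (M := G.toMfd.prod G.toMfd) (N := G.toMfd) _ _)
        (Mfd.tmap_pair_eq_zero (hsm _) (hsm _) (h0 _) (h0 _))).trans (map_zero _))
    exact (congrArg (fun A : (G.nerve.lev (l + 2)).model →L[ℝ] (G.nerve.lev (l + 2)).model => A v)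
      (Mfd.tmap_id x)).symm.trans h2

instance : Unique (G.nerve.lev 0) := inferInstanceAs (Unique (Fin 0 → G))

instance : Subsingleton (G.nerve.lev 0).model := inferInstanceAs (Subsingleton (Fin 0 → G.model))

variable (G) in
theorem hornProj_nerve (l : ℕ) (j : Fin (l + 3)) : G.nerve.HornProj (l + 1) j Mfd.Etale :=
  (isSubmanifold_horn l j).mapsTo

variable (G) in
theorem isLocalLieGroup_nerve : SMfd.IsLocalLieGroup 2 G.nerve :=
  SMfd.isLocalLieGroup_two G.hornProj_nerve fun l j _ _ h =>
    (isSubmanifold_horn (l + 1) j).embedding.injective (funext fun i => h i.1 i.2)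

end LieGrp

/-! ### The multiplication `H₋ × H₊ → G` is étale -/

namespace LieGrp

theorem tmap_mul_left_injective (G : LieGrp.{u}) (g x : G) :
    Function.Injective (Mfd.tmap (M := G.toMfd) (N := G.toMfd) (fun y => g * y) x) := by
  have h := Mfd.tmap_comp (M := G.toMfd) (N := G.toMfd) (Q := G.toMfd) (smooth_mul_left (G := G) g⁻¹)
    (smooth_mul_left (G := G) g) x
  have e : (fun y : G => g⁻¹ * (g * y)) = fun y => y := funext fun y => inv_mul_cancel_left g y
  rw [e, Mfd.tmap_id] at h
  intro v w hvw
  have hv := congrArg (fun A : G.model →L[ℝ] G.model => A v) h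
  have hw := congrArg (fun A : G.model →L[ℝ] G.model => A w) h
  refine hv.trans (Eq.trans ?_ hw.symm)
  exact congrArg (Mfd.tmap (M := G.toMfd) (N := G.toMfd) (fun y => g⁻¹ * y) (g * x)) hvw

theorem mcLeft_eq_zero_iff {G : LieGrp.{u}} {M : Mfd.{u}} {f : M → G} {x : M} {v : M.model} :
    G.mcLeft f x v = @OfNat.ofNat G.model 0 _ ↔ Mfd.tmap (N := G.toMfd) f x v = 0 := by
  constructor
  · intro h
    exact tmap_mul_left_injective G _ _ (h.trans (map_zero _).symm)
  · intro h
    exact (congrArg (Mfd.tmap (M := G.toMfd) (N := G.toMfd) (fun y => (f x)⁻¹ * y) (f x)) h).trans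
      (map_zero _)

end LieGrp

namespace Integration

variable {𝔤 : Type*} [LieRing 𝔤] [LieAlgebra ℝ 𝔤] {T : ManinTriple 𝔤} (I : Integration.{u} T)
  {M : Mfd.{u}}

theorem thetaL_eq_zero_iff {f : M → I.G} {x : M} {v : M.model} :
    I.thetaL f x v = 0 ↔ Mfd.tmap (N := I.G.toMfd) f x v = 0 := by
  rw [← LieGrp.mcLeft_eq_zero_iff]
  exact I.lieG.toLinearEquiv.map_eq_zero_iff

theorem thetaLp_eq_zero_iff {f : M → I.Hp} {x : M} {v : M.model} :
    I.thetaLp f x v = 0 ↔ Mfd.tmap (N := I.Hp.toMfd) f x v = 0 := by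
  rw [← LieGrp.mcLeft_eq_zero_iff]
  exact (ZeroMemClass.coe_eq_zero (x := I.liep _)).trans I.liep.toLinearEquiv.map_eq_zero_iff

theorem thetaLm_eq_zero_iff {f : M → I.Hm} {x : M} {v : M.model} :
    I.thetaLm f x v = 0 ↔ Mfd.tmap (N := I.Hm.toMfd) f x v = 0 := by
  rw [← LieGrp.mcLeft_eq_zero_iff]
  exact (ZeroMemClass.coe_eq_zero (x := I.liem _)).trans I.liem.toLinearEquiv.map_eq_zero_iff

theorem finrank_model : Module.finrank ℝ (I.Hm.toMfd.prod I.Hp.toMfd).model =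
    Module.finrank ℝ I.G.model := by
  have eG : Module.finrank ℝ I.G.model = Module.finrank ℝ 𝔤 :=
    LinearEquiv.finrank_eq (I.lieG.toLinearEquiv : I.G.model ≃ₗ[ℝ] 𝔤)
  have ep : Module.finrank ℝ I.Hp.model = Module.finrank ℝ T.hp.toSubmodule :=
    LinearEquiv.finrank_eq (I.liep.toLinearEquiv : I.Hp.model ≃ₗ[ℝ] T.hp)
  have em : Module.finrank ℝ I.Hm.model = Module.finrank ℝ T.hm.toSubmodule :=
    LinearEquiv.finrank_eq (I.liem.toLinearEquiv : I.Hm.model ≃ₗ[ℝ] T.hm)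
  let f : I.G.model →ₗ[ℝ] 𝔤 := I.lieG.toLinearEquiv.toLinearMap
  have : FiniteDimensional ℝ 𝔤 := Module.Finite.of_surjective f I.lieG.toLinearEquiv.surjective
  have h := Submodule.finrank_add_eq_of_isCompl T.isCompl
  rw [eG, ← h, ← ep, ← em, add_comm]
  exact Module.finrank_prod

/-- The multiplication `H₋ × H₊ → G`. -/
def mulMap : I.Hm.toMfd.prod I.Hp.toMfd → I.G := fun p => I.φm p.1 * I.φp p.2

theorem smooth_φm {f : M → I.Hm} (hf : Mfd.Smooth (N := I.Hm.toMfd) f) :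
    Mfd.Smooth (N := I.G.toMfd) fun x => I.φm (f x) :=
  I.smooth_m.comp hf

theorem smooth_φp {f : M → I.Hp} (hf : Mfd.Smooth (N := I.Hp.toMfd) f) :
    Mfd.Smooth (N := I.G.toMfd) fun x => I.φp (f x) :=
  I.smooth_p.comp hf

theorem smooth_mulMap : Mfd.Smooth (N := I.G.toMfd) I.mulMap :=
  LieGrp.smooth_mul (I.smooth_φm Mfd.smooth_fst) (I.smooth_φp Mfd.smooth_snd)

/-- Up to `Ad`, the Maurer–Cartan form of the product at `(a, h)` is the left form of `a` plus the
right form of `h`. These lie in the complementary subspaces `𝔥₋` and `𝔥₊`, so a vector in the kernel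
has both components zero; a dimension count gives bijectivity at every point. -/
theorem etale_mulMap : Mfd.Etale (N := I.G.toMfd) I.mulMap := by
  refine Mfd.etale_of_bijective I.smooth_mulMap fun x => ?_
  have hm : Mfd.Smooth (M := I.Hm.toMfd.prod I.Hp.toMfd) (N := I.Hm.toMfd) Prod.fst :=
    Mfd.smooth_fst
  have hp : Mfd.Smooth (M := I.Hm.toMfd.prod I.Hp.toMfd) (N := I.Hp.toMfd) Prod.snd :=
    Mfd.smooth_snd
  have inj : Function.Injective (Mfd.tmap (N := I.G.toMfd) I.mulMap x) := by
    rw [injective_iff_map_eq_zero]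
    intro v hv
    have h1 := I.thetaL_eq_zero_iff.2 hv
    have h2 : I.adj (I.φp x.2)⁻¹ (I.thetaL (fun z : I.Hm.toMfd.prod I.Hp.toMfd => I.φm z.1) x v) +
        I.thetaL (fun z : I.Hm.toMfd.prod I.Hp.toMfd => I.φp z.2) x v = 0 :=
      (thetaL_mul (I.smooth_φm hm) (I.smooth_φp hp) x v).symm.trans h1
    have h3 := congrArg (I.adj (I.φp x.2)) h2
    rw [map_add, adj_adj_inv, ← thetaR_eq (I.smooth_φp hp) x v, map_zero] at h3
    have ha := thetaL_m_mem hm x v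
    have hb := thetaR_p_mem hp x v
    have h4 : I.thetaL (fun z : I.Hm.toMfd.prod I.Hp.toMfd => I.φm z.1) x v = 0 := by
      refine (Submodule.disjoint_def.1 T.isCompl.disjoint) _ ?_ ha
      rw [eq_neg_of_add_eq_zero_left h3]
      exact T.hp.neg_mem hb
    have h5 : I.thetaL (fun z : I.Hm.toMfd.prod I.Hp.toMfd => I.φp z.2) x v = 0 := by
      rw [h4, map_zero, zero_add] at h2
      exact h2
    have h6 := I.thetaLm_eq_zero_iff.1 ((congrArg (fun θ => θ x v) (thetaLm_eq hm)).trans h4)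
    have h7 := I.thetaLp_eq_zero_iff.1 ((congrArg (fun θ => θ x v) (thetaLp_eq hp)).trans h5)
    exact Prod.ext ((Mfd.tmap_fst x v).symm.trans h6) ((Mfd.tmap_snd x v).symm.trans h7)
  exact ⟨inj, (LinearMap.injective_iff_surjective_of_finrank_eq_finrank I.finrank_model
    (f := (Mfd.tmap (N := I.G.toMfd) I.mulMap x).toLinearMap)).1 inj⟩

end Integration

namespace Integration

variable {𝔤 : Type*} [LieRing 𝔤] [LieAlgebra ℝ 𝔤] {T : ManinTriple 𝔤} {I : Integration.{u} T}
  {n : ℕ}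

instance : Finite (Triple n) :=
  Finite.of_injective (β := Fin (n + 1) × Fin (n + 1) × Fin (n + 1)) (fun t => (t.i, t.j, t.k))
    fun t t' h => by
      simp only [Prod.mk.injEq] at h
      exact Triple.ext h.1 h.2.1 h.2.2

/-! ### Staircases and cocycles -/

namespace Staircase

instance : TopologicalSpace (I.Staircase n) := .induced (Staircase.edges I) inferInstance

theorem isEmbedding_edges : Topology.IsEmbedding (Staircase.edges I (n := n)) :=
  ⟨⟨rfl⟩, fun _ _ h => Staircase.ext (funext fun t => congrFun h (.inl t))
    (funext fun t => congrFun h (.inr t))⟩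

instance : T2Space (I.Staircase n) := isEmbedding_edges.t2Space

instance : SecondCountableTopology (I.Staircase n) :=
  isEmbedding_edges.isInducing.secondCountableTopology

theorem continuous_a (t : Triple n) : Continuous fun s : I.Staircase n => s.a t :=
  (continuous_apply (Sum.inl t : Triple n ⊕ Triple n)).comp
    (isEmbedding_edges (I := I) (n := n)).continuous

theorem continuous_h (t : Triple n) : Continuous fun s : I.Staircase n => s.h t :=
  (continuous_apply (Sum.inr t : Triple n ⊕ Triple n)).comp
    (isEmbedding_edges (I := I) (n := n)).continuous

/-- The label of the segment from `i` to `k`. -/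
def label (s : I.Staircase n) (i k : Fin (n + 1)) (h : i ≤ k) : I.Hm × I.Hp :=
  (s.a ⟨i, i, k, le_rfl, h⟩, s.h ⟨i, k, k, h, le_rfl⟩)

theorem a_eq_label (s : I.Staircase n) (t : Triple n) :
    s.a t = (s.label t.i t.j t.hij).1⁻¹ * (s.label t.i t.k (t.hij.trans t.hjk)).1 :=
  eq_inv_mul_of_mul_eq (s.a_comp t.i t.i t.j t.k le_rfl t.hij t.hjk)

theorem h_eq_label (s : I.Staircase n) (t : Triple n) :
    s.h t = (s.label t.i t.k (t.hij.trans t.hjk)).2 * (s.label t.j t.k t.hjk).2⁻¹ :=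
  eq_mul_inv_of_mul_eq (s.h_comp t.i t.j t.k t.k t.hij t.hjk le_rfl)

theorem ext_label {s s' : I.Staircase n} (h : ∀ i k hik, s.label i k hik = s'.label i k hik) :
    s = s' := by
  ext t
  · rw [a_eq_label, a_eq_label, h, h]
  · rw [h_eq_label, h_eq_label, h, h]

theorem label_self (s : I.Staircase n) (i : Fin (n + 1)) : s.label i i le_rfl = 1 :=
  Prod.ext (s.a_self i i le_rfl) (s.h_self i i le_rfl)

/-- The square with corner `(j, j)` exchanges the vertical edge arriving there with the horizontal
edge leaving it; afterwards horizontal and vertical edges compose separately. -/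
theorem mul_label (s : I.Staircase n) (i j k : Fin (n + 1)) (hij : i ≤ j) (hjk : j ≤ k) :
    I.mulMap (s.label i j hij) * I.mulMap (s.label j k hjk) =
      I.mulMap (s.label i k (hij.trans hjk)) := by
  have h1 : I.φp (s.h ⟨i, j, j, hij, le_rfl⟩) * I.φm (s.a ⟨j, j, k, le_rfl, hjk⟩) =
      I.φm (s.a ⟨i, j, k, hij, hjk⟩) * I.φp (s.h ⟨i, j, k, hij, hjk⟩) :=
    s.square i j j k hij le_rfl hjk
  have h2 := s.a_comp i i j k le_rfl hij hjk
  have h3 := s.h_comp i j k k hij hjk le_rfl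
  change I.φm (s.a ⟨i, i, j, _, _⟩) * I.φp (s.h ⟨i, j, j, _, _⟩) *
    (I.φm (s.a ⟨j, j, k, _, _⟩) * I.φp (s.h ⟨j, k, k, _, _⟩)) =
    I.φm (s.a ⟨i, i, k, _, _⟩) * I.φp (s.h ⟨i, k, k, _, _⟩)
  rw [← h2, ← h3, map_mul, map_mul, mul_assoc, ← mul_assoc (I.φp _) (I.φm _), h1]
  simp only [mul_assoc]

/-- The cocycle of a staircase, as a simplex of the nerve. -/
def toNerve (s : I.Staircase n) : Fin n → I.G := fun i =>
  I.mulMap (s.label i.castSucc i.succ (Fin.castSucc_lt_succ).le)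

theorem edge_toNerve (s : I.Staircase n) (i k : Fin (n + 1)) (h : i ≤ k) :
    LieGrp.edge s.toNerve i k = I.mulMap (s.label i k h) := by
  have h0 : ∀ k, Fin.partialProd s.toNerve k = I.mulMap (s.label 0 k (Fin.zero_le k)) := fun k => by
    induction k using Fin.induction with
    | zero =>
      rw [Fin.partialProd_zero, label_self]
      exact (by simp : (1 : I.G) = I.φm 1 * I.φp 1)
    | succ k ih => rw [Fin.partialProd_succ, ih, toNerve, mul_label]
  rw [LieGrp.edge, h0, h0, inv_mul_eq_iff_eq_mul, mul_label]

theorem toNerve_map {m : ℕ} (θ : Fin (m + 1) →o Fin (n + 1)) (s : I.Staircase n) :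
    (s.map I θ).toNerve = I.G.nerveOp θ s.toNerve := by
  funext i
  exact (s.edge_toNerve (θ i.castSucc) (θ i.succ) (θ.monotone (Fin.castSucc_lt_succ).le)).symm

/-- Ordered pairs of vertices. -/
abbrev Pairs (n : ℕ) : Type := {p : Fin (n + 1) × Fin (n + 1) // p.1 < p.2}

/-- The labels of the non-degenerate segments. -/
def labels (s : I.Staircase n) : Pairs n → I.Hm.toMfd.prod I.Hp.toMfd := fun p =>
  s.label p.1.1 p.1.2 p.2.le

/-- The trivial extension of a family of labels to degenerate segments. -/
def extend (m : Pairs n → I.Hm.toMfd.prod I.Hp.toMfd) (i k : Fin (n + 1)) : I.Hm × I.Hp :=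
  if h : i < k then m ⟨(i, k), h⟩ else 1

theorem extend_self (m : Pairs n → I.Hm.toMfd.prod I.Hp.toMfd) (i : Fin (n + 1)) :
    extend m i i = 1 :=
  dif_neg (lt_irrefl i)

theorem extend_of_lt (m : Pairs n → I.Hm.toMfd.prod I.Hp.toMfd) {i k : Fin (n + 1)} (h : i < k) :
    extend m i k = m ⟨(i, k), h⟩ :=
  dif_pos h

theorem extend_labels (s : I.Staircase n) (i k : Fin (n + 1)) (h : i ≤ k) :
    extend s.labels i k = s.label i k h := by
  rcases h.eq_or_lt with rfl | h
  · rw [extend_self, label_self]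
  · exact dif_pos h

theorem continuous_extend (i k : Fin (n + 1)) :
    Continuous fun m : Pairs n → I.Hm.toMfd.prod I.Hp.toMfd => extend m i k := by
  by_cases h : i < k
  · have : (fun m : Pairs n → I.Hm.toMfd.prod I.Hp.toMfd => extend m i k) =
        fun m => m ⟨(i, k), h⟩ := funext fun m => extend_of_lt m h
    rw [this]
    exact continuous_apply (A := fun _ : Pairs n => I.Hm × I.Hp) _
  · have : (fun m : Pairs n → I.Hm.toMfd.prod I.Hp.toMfd => extend m i k) =
        fun _ => 1 := funext fun m => dif_neg h
    rw [this]
    exact continuous_const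

/-- All edges in terms of the labels. -/
def edgesOfLabels (m : Pairs n → I.Hm.toMfd.prod I.Hp.toMfd) : ∀ e, I.edgeGroup n e
  | .inl t => (extend m t.i t.j).1⁻¹ * (extend m t.i t.k).1
  | .inr t => (extend m t.i t.k).2 * (extend m t.j t.k).2⁻¹

theorem edgesOfLabels_labels (s : I.Staircase n) : edgesOfLabels s.labels = Staircase.edges I s := by
  funext e
  rcases e with t | t
  · change (extend s.labels t.i t.j).1⁻¹ * (extend s.labels t.i t.k).1 = s.a t
    rw [extend_labels _ _ _ t.hij, extend_labels _ _ _ (t.hij.trans t.hjk), ← a_eq_label]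
  · change (extend s.labels t.i t.k).2 * (extend s.labels t.j t.k).2⁻¹ = s.h t
    rw [extend_labels _ _ _ t.hjk, extend_labels _ _ _ (t.hij.trans t.hjk), ← h_eq_label]

theorem continuous_edgesOfLabels : Continuous (edgesOfLabels (I := I) (n := n)) := by
  have h1 : ∀ i k, Continuous fun m : Pairs n → I.Hm.toMfd.prod I.Hp.toMfd => (extend m i k).1 :=
    fun i k => continuous_fst.comp (continuous_extend i k)
  have h2 : ∀ i k, Continuous fun m : Pairs n → I.Hm.toMfd.prod I.Hp.toMfd => (extend m i k).2 :=
    fun i k => continuous_snd.comp (continuous_extend i k)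
  have _ : IsTopologicalGroup I.Hm := topologicalGroup_of_lieGroup 𝓘(ℝ, I.Hm.model) ∞
  have _ : IsTopologicalGroup I.Hp := topologicalGroup_of_lieGroup 𝓘(ℝ, I.Hp.model) ∞
  refine continuous_pi fun e => ?_
  rcases e with t | t
  · exact (h1 t.i t.j).inv.mul (h1 t.i t.k)
  · exact (h2 t.i t.k).mul (h2 t.j t.k).inv

theorem continuous_labels : Continuous (labels (I := I) (n := n)) :=
  continuous_pi fun _ => (continuous_a _).prodMk (continuous_h _)

/-- All edges are continuous functions of the labels, so the labels carry the full topology. -/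
theorem isEmbedding_labels : Topology.IsEmbedding (labels (I := I) (n := n)) := by
  refine Topology.IsEmbedding.of_comp continuous_labels continuous_edgesOfLabels ?_
  have : edgesOfLabels ∘ labels (I := I) (n := n) = Staircase.edges I := funext edgesOfLabels_labels
  rw [this]
  exact isEmbedding_edges

/-- The staircase of a cocycle. -/
def ofLabels (m : Pairs n → I.Hm.toMfd.prod I.Hp.toMfd) (g : Fin n → I.G)
    (h : ∀ p : Pairs n, I.mulMap (m p) = LieGrp.edge g p.1.1 p.1.2) : I.Staircase n where
  a t := (extend m t.i t.j).1⁻¹ * (extend m t.i t.k).1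
  h t := (extend m t.i t.k).2 * (extend m t.j t.k).2⁻¹
  a_comp _ _ _ _ _ _ _ := by group
  h_comp _ _ _ _ _ _ _ := by group
  square i j k l hij hjk hkl := by
    have he : ∀ i k : Fin (n + 1), i ≤ k →
        I.φm (extend m i k).1 * I.φp (extend m i k).2 = LieGrp.edge g i k := by
      intro i k hik
      rcases hik.eq_or_lt with rfl | hik
      · simp [extend_self, LieGrp.edge_self]
      · rw [extend_of_lt m hik]
        exact h ⟨(i, k), hik⟩
    have e1 := he i k (hij.trans hjk)
    have e2 := he j k hjk
    have e3 := he j l (hjk.trans hkl)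
    have e4 := he i l ((hij.trans hjk).trans hkl)
    -- Multiplied on the left by the inverse `H₋`-part of the label `ik`, and on the right by the
    -- inverse `H₊`-part of the label `jl`, this cocycle relation becomes the square relation.
    have e5 : LieGrp.edge g i k * (LieGrp.edge g j k)⁻¹ * LieGrp.edge g j l =
        LieGrp.edge g i l := by
      simp [LieGrp.edge, mul_assoc]
    rw [← e1, ← e2, ← e3, ← e4] at e5
    simp only [Gam, Set.mem_ofPred_eq, map_mul, map_inv]
    simp only [mul_inv_rev, mul_assoc] at e5 ⊢
    rw [eq_inv_mul_iff_mul_eq,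
      ← mul_assoc (I.φm (extend m i l).1), eq_mul_inv_iff_mul_eq]
    simpa only [mul_assoc] using e5

theorem labels_ofLabels (m : Pairs n → I.Hm.toMfd.prod I.Hp.toMfd) (g : Fin n → I.G)
    (h : ∀ p : Pairs n, I.mulMap (m p) = LieGrp.edge g p.1.1 p.1.2) :
    (ofLabels m g h).labels = m := by
  funext p
  have h1 : extend m p.1.1 p.1.2 = m p := dif_pos p.2
  refine Prod.ext ?_ ?_
  · change (extend m p.1.1 p.1.1).1⁻¹ * (extend m p.1.1 p.1.2).1 = (m p).1
    rw [extend_self, h1]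
    simp
  · change (extend m p.1.1 p.1.2).2 * (extend m p.1.2 p.1.2).2⁻¹ = (m p).2
    rw [extend_self, h1]
    simp

theorem isEmbedding_nerve_edges (G : LieGrp.{u}) : Topology.IsEmbedding
    fun (g : G.nerve.lev n) (p : Pairs n) => LieGrp.edge (G := G) (n := n) g p.1.1 p.1.2 := by
  refine Topology.IsEmbedding.of_leftInverse
    (f := fun z i => z ⟨(i.castSucc, i.succ), Fin.castSucc_lt_succ⟩) ?_ ?_ ?_
  · intro g
    funext i
    exact LieGrp.edge_castSucc_succ (G := G) (n := n) g i
  · exact continuous_pi fun i => continuous_apply _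
  · exact continuous_pi fun p => (LieGrp.smooth_edge (G := G) p.1.1 p.1.2).continuous

/-- The cocycle map as a map to the manifold `G ^ n`. -/
def nerveMap (s : I.Staircase n) : I.G.nerve.lev n := s.toNerve

/-- Staircases are the fibre product of `G^n` with the families of labels over the families of
elements of `G` indexed by pairs `i < k`. The cocycle map is thus a base change of a product of
copies of the étale map `mulMap`. -/
theorem isLocalHomeomorph_nerveMap : IsLocalHomeomorph (nerveMap (I := I) (n := n)) := by
  refine (IsLocalHomeomorph.piMap fun _ : Pairs n => I.etale_mulMap.isLocalHomeomorph).of_embedding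
    isEmbedding_labels (isEmbedding_nerve_edges I.G) ?_ isOpen_univ (fun _ => trivial) ?_
  · intro s
    funext p
    exact s.edge_toNerve p.1.1 p.1.2 p.2.le
  · rintro m - ⟨g, hg⟩
    exact ⟨ofLabels m g fun p => (congrFun hg p).symm, labels_ofLabels _ _ _⟩

end Staircase

end Integration

/-! ### The codiagonal as a simplicial manifold étale over the nerve -/

namespace Integration

variable {𝔤 : Type*} [LieRing 𝔤] [LieAlgebra ℝ 𝔤] {T : ManinTriple 𝔤} (I : Integration.{u} T)

/-- The manifold of `n`-simplices of the codiagonal. -/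
def gammaLev (n : ℕ) : Mfd.{u} :=
  Mfd.pull (Staircase.isLocalHomeomorph_nerveMap (I := I) (n := n))

/-- The cocycle map on the manifold of staircases. -/
def gammaMap (n : ℕ) : I.gammaLev n → I.G.nerve.lev n := Mfd.pullMap _

theorem etale_gammaMap (n : ℕ) : Mfd.Etale (I.gammaMap n) := Mfd.pullMap_etale _

/-- The operator is a continuous lift, along the étale cocycle map, of the smooth operator of the
nerve. -/
theorem smooth_staircaseMap {m n : ℕ} (θ : SimplexCategory.mk m ⟶ SimplexCategory.mk n) :
    Mfd.Smooth (M := I.gammaLev n) (N := I.gammaLev m)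
      (Staircase.map I θ.toOrderHom) := by
  refine (I.etale_gammaMap m).smooth_lift ?_ ?_
  · refine (Staircase.isEmbedding_edges (I := I) (n := m)).continuous_iff.2 (continuous_pi fun e => ?_)
    rcases e with t | t
    · exact Staircase.continuous_a (t.map θ.toOrderHom)
    · exact Staircase.continuous_h (t.map θ.toOrderHom)
  · have h := (I.G.nerve.map θ.op).smooth.comp (I.etale_gammaMap n).smooth
    have e : (fun s : I.gammaLev n => I.gammaMap m (Staircase.map I θ.toOrderHom s)) =
        Mfd.map (I.G.nerve.map θ.op) ∘ I.gammaMap n :=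
      funext fun s => Staircase.toNerve_map θ.toOrderHom s
    rw [e]
    exact h

/-- The codiagonal as a simplicial manifold. -/
def gamma : SMfd.{u} where
  obj X := I.gammaLev X.unop.len
  map θ := ⟨Staircase.map I θ.unop.toOrderHom, I.smooth_staircaseMap θ.unop⟩
  map_id _ := rfl
  map_comp _ _ := rfl

/-- The cocycle map from the codiagonal to the nerve. -/
def gammaNerve : I.gamma ⟶ I.G.nerve where
  app X := ⟨I.gammaMap X.unop.len, (I.etale_gammaMap _).smooth⟩
  naturality _ _ θ := Mfd.hom_ext (funext fun s => Staircase.toNerve_map θ.unop.toOrderHom s)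

theorem etale_gammaNerve (l : ℕ) : Mfd.Etale (SMfd.level I.gammaNerve l) := I.etale_gammaMap l

theorem smooth_label {n : ℕ} (i k : Fin (n + 1)) (h : i ≤ k) :
    Mfd.Smooth (M := I.gammaLev n) (N := I.Hm.toMfd.prod I.Hp.toMfd)
      fun s => Staircase.label (I := I) s i k h := by
  refine I.etale_mulMap.smooth_lift ?_ ?_
  · exact (Staircase.continuous_a _).prodMk (Staircase.continuous_h _)
  · have h1 := (LieGrp.smooth_edge (G := I.G) i k).comp (I.etale_gammaMap n).smooth
    have e : (fun s : I.gammaLev n => I.mulMap (Staircase.label (I := I) s i k h)) =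
        fun s => LieGrp.edge (G := I.G) (n := n) (I.gammaMap n s) i k :=
      funext fun s => (Staircase.edge_toNerve (I := I) s i k h).symm
    rw [e]
    exact h1

theorem smooth_a {n : ℕ} (t : Triple n) :
    Mfd.Smooth (M := I.gammaLev n) (N := I.Hm.toMfd) fun s => Staircase.a (I := I) s t := by
  have h1 := fun i k h => Mfd.smooth_fst.comp (I.smooth_label (n := n) i k h)
  have e : (fun s : I.gammaLev n => Staircase.a (I := I) s t) = fun s =>
      (Staircase.label (I := I) s t.i t.j t.hij).1⁻¹ *
        (Staircase.label (I := I) s t.i t.k (t.hij.trans t.hjk)).1 :=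
    funext fun s => Staircase.a_eq_label (I := I) s t
  rw [e]
  exact LieGrp.smooth_mul (LieGrp.smooth_inv (h1 _ _ _)) (h1 _ _ _)

theorem smooth_h {n : ℕ} (t : Triple n) :
    Mfd.Smooth (M := I.gammaLev n) (N := I.Hp.toMfd) fun s => Staircase.h (I := I) s t := by
  have h1 := fun i k h => Mfd.smooth_snd.comp (I.smooth_label (n := n) i k h)
  have e : (fun s : I.gammaLev n => Staircase.h (I := I) s t) = fun s =>
      (Staircase.label (I := I) s t.i t.k (t.hij.trans t.hjk)).2 *
        (Staircase.label (I := I) s t.j t.k t.hjk).2⁻¹ :=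
    funext fun s => Staircase.h_eq_label (I := I) s t
  rw [e]
  exact LieGrp.smooth_mul (h1 _ _ _) (LieGrp.smooth_inv (h1 _ _ _))

theorem isSubmanifold_gammaLev (n : ℕ) :
    Mfd.IsSubmanifold (Set.range (Staircase.edges I (n := n))) (I.gammaLev n)
      (fun e s => Staircase.edges I s e) := by
  refine ⟨?_, Staircase.isEmbedding_edges, rfl, ?_⟩
  · rintro (t | t)
    · exact I.smooth_a t
    · exact I.smooth_h t
  · intro s v hv
    -- A vector killed by all edges is killed by the labels of consecutive vertices, hence by the
    -- cocycle map, which is étale.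
    refine (I.etale_gammaMap n).eq_zero (x := s) ?_
    refine Mfd.tmap_pow_eq_zero (M := I.G.toMfd) (n := n) (f := I.gammaMap n)
      (I.etale_gammaMap n).smooth fun i => ?_
    have hle : i.castSucc ≤ i.succ := Fin.castSucc_lt_succ.le
    have h1 := I.smooth_label i.castSucc i.succ hle
    have h2 : Mfd.tmap (M := I.gammaLev n) (N := I.Hm.toMfd.prod I.Hp.toMfd)
        (fun s => Staircase.label (I := I) s i.castSucc i.succ hle) s v = 0 :=
      Mfd.tmap_pair_eq_zero (I.smooth_a ⟨_, _, _, le_rfl, hle⟩) (I.smooth_h ⟨_, _, _, hle, le_rfl⟩)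
        (hv (.inl ⟨_, _, _, le_rfl, hle⟩)) (hv (.inr ⟨_, _, _, hle, le_rfl⟩))
    have h3 := congrArg (fun A : (I.gammaLev n).model →L[ℝ] I.G.model => A v)
      (Mfd.tmap_comp I.smooth_mulMap h1 s)
    exact h3.trans ((congrArg (Mfd.tmap (N := I.G.toMfd) I.mulMap _) h2).trans (map_zero _))

/-- The simplicial manifold of staircases presents the codiagonal. -/
def gammaBar : I.GammaBar I.gamma where
  equiv _ := Equiv.refl _
  natural _ _ := rfl
  submanifold n := I.isSubmanifold_gammaLev n

theorem label_eq_of_face_eq {l : ℕ} {s s' : I.gamma.lev (l + 1)} {m i k : Fin (l + 2)} (hik : i ≤ k)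
    (hi : i ≠ m) (hk : k ≠ m) (h : I.gamma.face m s = I.gamma.face m s') :
    Staircase.label (I := I) (n := l + 1) s i k hik =
      Staircase.label (I := I) (n := l + 1) s' i k hik := by
  obtain ⟨i, rfl⟩ := Fin.exists_succAbove_eq hi
  obtain ⟨k, rfl⟩ := Fin.exists_succAbove_eq hk
  exact congrArg (fun z => Staircase.label (I := I) (n := l) z i k
    (Fin.succAbove_le_succAbove_iff.1 hik)) h

instance : Unique (I.gamma.lev 0) where
  default := (⟨fun _ => 1, fun _ => 1, by simp, by simp, by simp [Gam]⟩ : I.Staircase 0)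
  uniq s := Staircase.ext_label (I := I) (n := 0) fun i k hik => by
    obtain rfl : i = k := Subsingleton.elim (α := Fin 1) _ _
    exact (Staircase.label_self (I := I) (n := 0) s i).trans
      (Staircase.label_self (I := I) (n := 0) _ i).symm

instance : Subsingleton (I.gamma.lev 0).model := inferInstanceAs (Subsingleton (Fin 0 → I.G.model))

theorem isLocalLieGroup_gamma : SMfd.IsLocalLieGroup 2 I.gamma := by
  refine SMfd.isLocalLieGroup_two (fun l j => SMfd.hornProj_of_etale I.gammaNerve I.etale_gammaNerve
    (LieGrp.isSubmanifold_horn l j)) fun l j s s' h => ?_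
  refine Staircase.ext_label (I := I) (n := l + 3) fun i k hik => ?_
  -- With at least four vertices, some `m` differs from `i`, `j` and `k`; the face opposite to it
  -- belongs to the horn and contains the segment from `i` to `k`.
  obtain ⟨m, -, hm⟩ := Finset.exists_mem_notMem_of_card_lt_card
    (s := ({i, j, k} : Finset (Fin (l + 4)))) (t := Finset.univ)
    (lt_of_le_of_lt Finset.card_le_three (by simp))
  simp only [Finset.mem_insert, Finset.mem_singleton, not_or] at hm
  exact I.label_eq_of_face_eq hik (Ne.symm hm.1) (Ne.symm hm.2.2) (h m hm.2.1)

theorem isHypercover_gammaNerve : SMfd.IsHypercover 2 I.gammaNerve := by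
  refine SMfd.isHypercover_two _ I.etale_gammaNerve fun s s' h _ => ?_
  refine Staircase.ext_label (I := I) (n := 2) fun i k hik => ?_
  -- Three vertices suffice here, since no face is missing: the boundary alone determines a
  -- 2-simplex.
  obtain ⟨m, -, hm⟩ := Finset.exists_mem_notMem_of_card_lt_card
    (s := ({i, k} : Finset (Fin 3))) (t := Finset.univ)
    (lt_of_le_of_lt Finset.card_le_two (by simp))
  simp only [Finset.mem_insert, Finset.mem_singleton, not_or] at hm
  exact I.label_eq_of_face_eq hik (Ne.symm hm.1) (Ne.symm hm.2) (h m)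

end Integration

/-! ### Pullback and linearity of the de Rham differential -/

namespace Form

variable {M N Q : Mfd.{u}} {k : ℕ}

theorem pullback_apply (f : M → N) (η : Form N k) (x : M) (v : Fin k → M.model) :
    pullback f η x v = η (f x) fun i => Mfd.tmap f x (v i) := rfl

theorem pullback_comp {g : N → Q} {f : M → N} (hg : Mfd.Smooth g) (hf : Mfd.Smooth f)
    (η : Form Q k) : pullback f (pullback g η) = pullback (fun x => g (f x)) η := by
  funext x
  ext v
  rw [pullback_apply, pullback_apply, pullback_apply, Mfd.tmap_comp hg hf]
  rfl

theorem pullback_id (η : Form M k) : pullback (fun x : M => x) η = η := by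
  funext x
  ext v
  rw [pullback_apply, Mfd.tmap_id]
  rfl

theorem pullback_add (f : M → N) (η ζ : Form N k) :
    pullback f (η + ζ) = pullback f η + pullback f ζ := rfl

theorem pullback_sub (f : M → N) (η ζ : Form N k) :
    pullback f (η - ζ) = pullback f η - pullback f ζ := rfl

theorem pullback_neg (f : M → N) (η : Form N k) : pullback f (-η) = -pullback f η := rfl

theorem pullback_zero (f : M → N) : pullback f (0 : Form N k) = 0 := rfl

theorem pullback_smul (f : M → N) (c : ℝ) (η : Form N k) :
    pullback f (c • η) = c • pullback f η := rfl

theorem pullback_sum {ι : Type*} (s : Finset ι) (f : M → N) (η : ι → Form N k) :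
    pullback f (∑ i ∈ s, η i) = ∑ i ∈ s, pullback f (η i) := by
  classical
  induction s using Finset.induction with
  | empty => rfl
  | insert a s ha ih => rw [Finset.sum_insert ha, Finset.sum_insert ha, pullback_add, ih]

theorem isSmooth_zero : IsSmooth (0 : Form M k) := fun _ =>
  (contDiffOn_const (c := (0 : M.model [⋀^Fin k]→L[ℝ] ℝ))).congr fun _ _ => rfl

theorem IsSmooth.neg {η : Form M k} (h : IsSmooth η) : IsSmooth (-η) := fun x =>
  (h x).neg.congr fun _ _ => rfl

theorem IsSmooth.sub {η ζ : Form M k} (h : IsSmooth η) (h' : IsSmooth ζ) : IsSmooth (η - ζ) :=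
  fun x => ((h x).sub (h' x)).congr fun _ _ => rfl

theorem deRham_sub {η ζ : Form M k} (h : IsSmooth η) (h' : IsSmooth ζ) :
    deRham (η - ζ) = deRham η - deRham ζ := by
  funext x
  ext v
  change _ = deRham η x v - deRham ζ x v
  rw [deRham_apply (h.sub h'), deRham_apply h, deRham_apply h', ← Finset.sum_sub_distrib]
  refine Finset.sum_congr rfl fun i _ => ?_
  rw [← smul_sub]
  have hd : ∀ {η : Form M k} (_ : IsSmooth η) (w : Fin k → M.model), DifferentiableAt ℝ
      (fun y => inChart η x y w) (chartAt M.model x x) := fun h w =>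
    ((ContinuousAlternatingMap.apply ℝ M.model ℝ w).differentiableAt).comp _
      (((h x).contDiffAt ((chartAt M.model x).open_target.mem_nhds
        (mem_chart_target _ x))).differentiableAt (by simp))
  have h1 := fderiv_fun_sub (hd h (i.removeNth v)) (hd h' (i.removeNth v))
  exact congrArg (fun A : M.model →L[ℝ] ℝ => (-1) ^ (i : ℕ) • A (v i)) h1

theorem deRham_zero : deRham (0 : Form M k) = 0 := by
  rw [← sub_self (0 : Form M k), deRham_sub isSmooth_zero isSmooth_zero, sub_self]

theorem deRham_neg {η : Form M k} (h : IsSmooth η) : deRham (-η) = -deRham η := by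
  rw [← zero_sub, deRham_sub isSmooth_zero h, deRham_zero, zero_sub]

end Form

/-! ### The simplicial differential, the tangent complex and the IM-form -/

namespace SMfd

variable {K J : SMfd.{u}} {p q : ℕ}

theorem simplicialDiff_zero : simplicialDiff K (0 : Form (K.lev p) q) = 0 := by
  simp [simplicialDiff, Form.pullback_zero]

theorem simplicialDiff_neg (η : Form (K.lev p) q) :
    simplicialDiff K (-η) = -simplicialDiff K η := by
  simp [simplicialDiff, Form.pullback_neg]

theorem simplicialDiff_add (η ζ : Form (K.lev p) q) :
    simplicialDiff K (η + ζ) = simplicialDiff K η + simplicialDiff K ζ := by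
  simp [simplicialDiff, Form.pullback_add, Finset.sum_add_distrib]

theorem simplicialDiff_one (η : Form (K.lev 1) q) : simplicialDiff K η =
    Form.pullback (K.face 0) η - Form.pullback (K.face 1) η + Form.pullback (K.face 2) η := by
  have h2 : (-1 : ℝ) ^ ((2 : Fin 3) : ℕ) = 1 := by norm_num [show ((2 : Fin 3) : ℕ) = 2 from rfl]
  have h1 : (-1 : ℝ) ^ ((1 : Fin 3) : ℕ) = -1 := by norm_num
  have h0 : (-1 : ℝ) ^ ((0 : Fin 3) : ℕ) = 1 := by norm_num
  rw [simplicialDiff, Fin.sum_univ_three, h0, h1, h2, one_smul, one_smul,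
    sub_eq_add_neg]
  exact congrArg₂ _ (congrArg₂ _ rfl (neg_one_smul ℝ (Form.pullback (K.face 1) η))) rfl

theorem simplicialDiff_two (η : Form (K.lev 2) q) : simplicialDiff K η =
    Form.pullback (K.face 0) η - Form.pullback (K.face 1) η + Form.pullback (K.face 2) η -
      Form.pullback (K.face 3) η := by
  have h3 : (-1 : ℝ) ^ ((3 : Fin 4) : ℕ) = -1 := by norm_num [show ((3 : Fin 4) : ℕ) = 3 from rfl]
  have h2 : (-1 : ℝ) ^ ((2 : Fin 4) : ℕ) = 1 := by norm_num [show ((2 : Fin 4) : ℕ) = 2 from rfl]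
  have h1 : (-1 : ℝ) ^ ((1 : Fin 4) : ℕ) = -1 := by norm_num
  have h0 : (-1 : ℝ) ^ ((0 : Fin 4) : ℕ) = 1 := by norm_num
  rw [simplicialDiff, Fin.sum_univ_four, h0, h1, h2, h3, one_smul, one_smul,
    sub_eq_add_neg, sub_eq_add_neg]
  exact congrArg₂ _ (congrArg₂ _ (congrArg₂ _ rfl
    (neg_one_smul ℝ (Form.pullback (K.face 1) η))) rfl)
    (neg_one_smul ℝ (Form.pullback (K.face 3) η))

theorem simplicialDiff_simplicialDiff (η : Form (K.lev 1) q) :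
    simplicialDiff K (simplicialDiff K η) = 0 := by
  have e : ∀ (i : Fin 4) (j : Fin 3), Form.pullback (K.face i) (Form.pullback (K.face j) η) =
      Form.pullback (fun x => K.face j (K.face i x)) η := fun i j =>
    Form.pullback_comp (K.face_smooth j) (K.face_smooth i) η
  have f : ∀ a b : Fin 3, a ≤ b → (fun x : K.lev 3 => K.face a (K.face b.succ x)) =
      fun x => K.face b (K.face a.castSucc x) := fun a b h => funext fun x => K.face_face h x
  have f00 := f 0 0 (by decide)
  have f01 := f 0 1 (by decide)
  have f02 := f 0 2 (by decide)
  have f11 := f 1 1 (by decide)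
  have f12 := f 1 2 (by decide)
  have f22 := f 2 2 (by decide)
  simp only [Fin.castSucc_zero, Fin.castSucc_one, Fin.succ_zero_eq_one, Fin.succ_one_eq_two,
    show (2 : Fin 3).castSucc = 2 from rfl, show (2 : Fin 3).succ = 3 from rfl]
    at f00 f01 f02 f11 f12 f22
  rw [simplicialDiff_two, simplicialDiff_one]
  simp only [Form.pullback_add, Form.pullback_sub, e, f00, f01, f02, f11, f12, f22]
  abel

theorem simplicialDiff_pullback (f : K ⟶ J) (η : Form (J.lev p) q) :
    simplicialDiff K (Form.pullback (level f p) η) =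
      Form.pullback (level f (p + 1)) (simplicialDiff J η) := by
  rw [simplicialDiff, simplicialDiff, Form.pullback_sum]
  refine Finset.sum_congr rfl fun i _ => ?_
  rw [Form.pullback_smul, Form.pullback_comp (level_smooth f p) (K.face_smooth i),
    Form.pullback_comp (J.face_smooth i) (level_smooth f (p + 1))]
  simp only [level_face]

/-- These vectors are the kernel of the tangent map of the projection to the horn missing the last
face, which is zero when that projection is étale. -/
theorem tangent_eq_bot (h : ∀ l j, HornProj K (l + 1) j Mfd.Etale) (x : K.lev 0) (l : ℕ) :
    tangent K x (l + 2) = ⊥ := by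
  rw [eq_bot_iff]
  intro v hv
  simp only [tangent, Submodule.mem_iInf, LinearMap.mem_ker] at hv
  refine (h l (Fin.last _)).immersion (x := basePoint K (l + 2) x) fun i => ?_
  obtain ⟨i, hi⟩ := i
  obtain ⟨i, rfl⟩ := Fin.exists_castSucc_eq.2 hi
  exact hv i

theorem imForm_zero_left {l r m : ℕ} (h : l + r = m) (η : Form (K.lev m) 2) (x : K.lev 0)
    (w : (K.lev r).model) : imForm K h η x 0 w = 0 := by
  refine Finset.sum_eq_zero fun σ _ => ?_
  rw [map_zero]
  refine mul_eq_zero_of_right _ ?_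
  exact (η (basePoint K m x)).map_coord_zero 0 rfl

theorem imForm_zero_right {l r m : ℕ} (h : l + r = m) (η : Form (K.lev m) 2) (x : K.lev 0)
    (v : (K.lev l).model) : imForm K h η x v 0 = 0 := by
  refine Finset.sum_eq_zero fun σ _ => ?_
  rw [map_zero]
  refine mul_eq_zero_of_right _ ?_
  exact (η (basePoint K m x)).map_coord_zero 1 rfl

/-- The tangent complex is concentrated in degree 1: degree 0 vanishes because `K_0` is
zero-dimensional, and degrees from 2 on because horn projections are étale. Its homology is all of
`T K_1`, and only the pairing with `l = r = 1` matters. -/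
theorem isNondegenerate_two [Subsingleton (K.lev 0).model]
    (h : ∀ l j, HornProj K (l + 1) j Mfd.Etale) {α : Cochain K}
    (hl : ∀ x v, (∀ w, imForm K (l := 1) (r := 1) rfl (α 2 2) x v w = 0) → v = 0)
    (hr : ∀ x w, (∀ v, imForm K (l := 1) (r := 1) rfl (α 2 2) x v w = 0) → w = 0) :
    IsNondegenerate 2 α := by
  have hc : ∀ x l, l ≠ 1 → ∀ v ∈ cycles K x l, v = 0 := by
    intro x l hl v hv
    match l with
    | 0 => exact Subsingleton.elim _ _
    | 1 => exact absurd rfl hl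
    | l + 2 =>
      have := hv.1
      rwa [tangent_eq_bot h] at this
  have hc1 : ∀ (x : K.lev 0) (v : (K.lev 1).model), v ∈ cycles K x 1 := fun x v =>
    ⟨(Submodule.mem_iInf _).2 fun _ => Subsingleton.elim (α := (K.lev 0).model) _ _,
      Subsingleton.elim (α := (K.lev 0).model) _ _⟩
  have hb : ∀ x, boundaries K x 1 = ⊥ := fun x => by
    rw [boundaries, tangent_eq_bot h, Submodule.map_bot]
  refine ⟨fun x l r hlr v hv => ?_, fun x l r hlr w hw => ?_, fun x l hl v hv => ?_⟩
  · by_cases h1 : l = 1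
    · subst h1
      obtain rfl : r = 1 := by omega
      rw [hb, Submodule.mem_bot]
      refine ⟨fun h2 => hl x v fun w => h2 w (hc1 x w), ?_⟩
      rintro rfl w -
      exact imForm_zero_left _ _ _ _
    · obtain rfl := hc x l h1 v hv
      exact ⟨fun _ => zero_mem _, fun _ w _ => imForm_zero_left _ _ _ _⟩
  · by_cases h1 : r = 1
    · subst h1
      obtain rfl : l = 1 := by omega
      rw [hb, Submodule.mem_bot]
      refine ⟨fun h2 => hr x w fun v => h2 v (hc1 x v), ?_⟩
      rintro rfl v -
      exact imForm_zero_right _ _ _ _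
    · obtain rfl := hc x r h1 w hw
      exact ⟨fun _ => zero_mem _, fun _ v _ => imForm_zero_right _ _ _ _⟩
  · rw [hc x l (by omega) v hv]
    exact zero_mem _

theorem basePoint_succ (K : SMfd.{u}) {l : ℕ} (i : Fin (l + 1)) (x : K.lev 0) :
    basePoint K (l + 1) x = K.degen i (basePoint K l x) :=
  K.map_comp_apply (SimplexCategory.const (.mk l) (.mk 0) 0).op (SimplexCategory.σ i).op x

/-- The IM-form of a `2`-shifted `2`-form on `1`-simplices. -/
theorem imForm_one_one (η : Form (K.lev 2) 2) (x : K.lev 0) (v w : (K.lev 1).model) :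
    imForm K (l := 1) (r := 1) rfl η x v w =
      η (basePoint K 2 x) ![Mfd.tmap (K.degen 1) (basePoint K 1 x) v,
        Mfd.tmap (K.degen 0) (basePoint K 1 x) w] +
      η (basePoint K 2 x) ![Mfd.tmap (K.degen 1) (basePoint K 1 x) w,
        Mfd.tmap (K.degen 0) (basePoint K 1 x) v] := by
  have hs : ∀ σ : Equiv.Perm (Fin 2), IsShuffle 1 σ := fun σ =>
    ⟨fun i j h1 h2 => by omega, fun i j h1 h2 => by omega⟩
  -- `collapse` jumps at the elements of `A`; for `A = {0}` it identifies the vertices 1 and 2, so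
  -- it is `σ 1`, and for `A = {1}` it is `σ 0`.
  have c0 : ∀ (A : Finset (Fin 2)) (hA : A.card ≤ 1), A = {0} →
      collapse A hA = SimplexCategory.σ (1 : Fin 2) := by
    rintro A hA rfl
    ext k : 3
    revert k
    decide +revert
  have c1 : ∀ (A : Finset (Fin 2)) (hA : A.card ≤ 1), A = {1} →
      collapse A hA = SimplexCategory.σ (0 : Fin 2) := by
    rintro A hA rfl
    ext k : 3
    revert k
    decide +revert
  have a1 : shuffleFst 1 (1 : Equiv.Perm (Fin 2)) = {0} := by decide
  have a2 : shuffleSnd 1 (1 : Equiv.Perm (Fin 2)) = {1} := by decide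
  have a3 : shuffleFst 1 (Equiv.swap 0 1 : Equiv.Perm (Fin 2)) = {1} := by decide
  have a4 : shuffleSnd 1 (Equiv.swap 0 1 : Equiv.Perm (Fin 2)) = {0} := by decide
  have hsw : ∀ a b : (K.lev 2).model, η (basePoint K 2 x) ![a, b] =
      -η (basePoint K 2 x) ![b, a] := by
    intro a b
    refine (congrArg (η (basePoint K 2 x)) ?_).trans
      ((η (basePoint K 2 x)).map_swap ![b, a] (i := 0) (j := 1) (by decide))
    funext i
    fin_cases i <;> rfl
  classical
  rw [imForm, Finset.filter_true_of_mem fun σ _ => hs σ,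
    Fintype.sum_eq_add (1 : Equiv.Perm (Fin 2)) (Equiv.swap 0 1) (by decide)
      fun σ hσ => absurd hσ (by revert σ; decide)]
  rw [c0 _ _ a1, c1 _ _ a2, c1 _ _ a3, c0 _ _ a4, Equiv.Perm.sign_one,
    Equiv.Perm.sign_swap (by decide)]
  simp only [Units.val_one, Int.cast_one, one_mul, Units.val_neg, Int.cast_neg, neg_mul]
  congr 1
  rw [hsw, neg_neg]
  rfl

end SMfd

namespace SMfd

variable {K : SMfd.{u}}

theorem degen_smooth (K : SMfd.{u}) {l : ℕ} (i : Fin (l + 1)) : Mfd.Smooth (K.degen i) :=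
  (K.σ i).smooth

theorem imForm_sub {l r m : ℕ} (h : l + r = m) (η ζ : Form (K.lev m) 2) (x : K.lev 0)
    (v : (K.lev l).model) (w : (K.lev r).model) :
    imForm K h (η - ζ) x v w = imForm K h η x v w - imForm K h ζ x v w := by
  rw [imForm, imForm, imForm, ← Finset.sum_sub_distrib]
  exact Finset.sum_congr rfl fun σ _ => mul_sub _ _ _

end SMfd

/-! ### The combined cocycle identity and the non-degeneracy criterion -/

namespace Integration

open SMfd

variable {𝔤 : Type*} [LieRing 𝔤] [LieAlgebra ℝ 𝔤] {T : ManinTriple 𝔤} {I : Integration.{u} T}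
  {M : Mfd.{u}} {K : SMfd.{u}}

/-- Four cocycle identities, for `(m, p, nq)`, `(p, n, q)`, `(r, s, q)` and `(m, r, sq)`, are
combined with alternating signs; the products match because `pn = rs`. With `m, p, n, q, r, s` the
images in `G` of `a₃, h₃, a₁, h₁, a₂, h₂` this is `ω̄ - Φ^*Ω = δβ`. -/
theorem polar_mul_mul {m p n q r s : M → I.G} (hm : Mfd.Smooth (N := I.G.toMfd) m)
    (hp : Mfd.Smooth (N := I.G.toMfd) p) (hn : Mfd.Smooth (N := I.G.toMfd) n)
    (hq : Mfd.Smooth (N := I.G.toMfd) q) (hr : Mfd.Smooth (N := I.G.toMfd) r)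
    (hs : Mfd.Smooth (N := I.G.toMfd) s) (h : ∀ x, p x * n x = r x * s x)
    (hmr : I.polar m r = 0) (hsq : I.polar s q = 0) :
    I.polar p n - I.polar r s - I.polar (fun x => m x * p x) (fun x => n x * q x) =
      I.polar n q - I.polar (fun x => m x * r x) (fun x => s x * q x) + I.polar m p := by
  have c1 := polar_cocycle hm hp (LieGrp.smooth_mul hn hq)
  have c2 := polar_cocycle hp hn hq
  have c3 := polar_cocycle hr hs hq
  have c4 := polar_cocycle hm hr (LieGrp.smooth_mul hs hq)
  have e1 : (fun x => p x * n x) = fun x => r x * s x := funext h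
  have e2 : (fun x => p x * (n x * q x)) = fun x => r x * (s x * q x) := funext fun x => by
    rw [← mul_assoc, h, mul_assoc]
  rw [e2] at c1
  rw [e1] at c2
  rw [hsq] at c3
  rw [hmr] at c4
  have c := congrArg₂ (· - ·) (congrArg₂ (· + ·) (congrArg₂ (· - ·) c1 c2) c3) c4
  beta_reduce at c
  rw [← sub_eq_zero]
  refine Eq.trans ?_ (c.trans (by simp))
  abel

variable (I) in
theorem bijective_thetaL {f : M → I.G} (hf : Mfd.Etale (N := I.G.toMfd) f) (x : M) :
    Function.Bijective (I.thetaL f x) := by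
  have e1 : Module.finrank ℝ M.model = Module.finrank ℝ I.G.model :=
    (hf.tequiv x).toLinearEquiv.finrank_eq
  have e2 : Module.finrank ℝ I.G.model = Module.finrank ℝ 𝔤 :=
    LinearEquiv.finrank_eq (I.lieG.toLinearEquiv : I.G.model ≃ₗ[ℝ] 𝔤)
  let g : I.G.model →ₗ[ℝ] 𝔤 := I.lieG.toLinearEquiv.toLinearMap
  have : FiniteDimensional ℝ 𝔤 := Module.Finite.of_surjective g I.lieG.toLinearEquiv.surjective
  have inj : Function.Injective (I.thetaL f x) := by
    rw [injective_iff_map_eq_zero]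
    exact fun v hv => hf.eq_zero (I.thetaL_eq_zero_iff.1 hv)
  exact ⟨inj, (LinearMap.injective_iff_surjective_of_finrank_eq_finrank (e1.trans e2)).1 inj⟩

/-- An étale `f` makes the Maurer–Cartan form an isomorphism onto `𝔤`, so the radical of the IM-form
is that of the pairing. -/
theorem isNondegenerate_of_etale [Subsingleton (K.lev 0).model]
    (h : ∀ l j, HornProj K (l + 1) j Mfd.Etale) {α : Cochain K} {f : K.lev 1 → I.G}
    (hf : Mfd.Etale (N := I.G.toMfd) f)
    (hα : ∀ x v w, imForm K (l := 1) (r := 1) rfl (α 2 2) x v w =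
      2 * T.B (I.thetaL f (basePoint K 1 x) v) (I.thetaL f (basePoint K 1 x) w)) :
    IsNondegenerate 2 α := by
  refine isNondegenerate_two h (fun x v hv => ?_) fun x w hw => ?_
  · obtain ⟨inj, surj⟩ := I.bijective_thetaL hf (basePoint K 1 x)
    refine inj ((T.nondegenerate.1 _ fun b => ?_).trans (map_zero _).symm)
    obtain ⟨w, rfl⟩ := surj b
    have := hv w
    rw [hα] at this
    linarith
  · obtain ⟨inj, surj⟩ := I.bijective_thetaL hf (basePoint K 1 x)
    refine inj ((T.nondegenerate.2 _ fun b => ?_).trans (map_zero _).symm)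
    obtain ⟨v, rfl⟩ := surj b
    have := hw v
    rw [hα] at this
    linarith

theorem thetaL_degen {f : K.lev 2 → I.G} (hf : Mfd.Smooth (N := I.G.toMfd) f) (i : Fin 2)
    (x : K.lev 0) (v : (K.lev 1).model) :
    I.thetaL f (basePoint K 2 x) (Mfd.tmap (K.degen i) (basePoint K 1 x) v) =
      I.thetaL (fun z => f (K.degen i z)) (basePoint K 1 x) v := by
  rw [K.basePoint_succ i x]
  exact (thetaL_comp hf (K.degen_smooth i) _ v).symm

theorem thetaR_degen {f : K.lev 2 → I.G} (hf : Mfd.Smooth (N := I.G.toMfd) f) (i : Fin 2)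
    (x : K.lev 0) (v : (K.lev 1).model) :
    I.thetaR f (basePoint K 2 x) (Mfd.tmap (K.degen i) (basePoint K 1 x) v) =
      I.thetaR (fun z => f (K.degen i z)) (basePoint K 1 x) v := by
  rw [K.basePoint_succ i x]
  exact (thetaR_comp hf (K.degen_smooth i) _ v).symm

theorem imForm_polar {f g : K.lev 2 → I.G} (hf : Mfd.Smooth (N := I.G.toMfd) f)
    (hg : Mfd.Smooth (N := I.G.toMfd) g) (x : K.lev 0) (v w : (K.lev 1).model) :
    imForm K (l := 1) (r := 1) rfl (I.polar f g) x v w =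
      T.B (I.thetaL (fun z => f (K.degen 1 z)) (basePoint K 1 x) v)
          (I.thetaR (fun z => g (K.degen 0 z)) (basePoint K 1 x) w) -
        T.B (I.thetaL (fun z => f (K.degen 0 z)) (basePoint K 1 x) w)
          (I.thetaR (fun z => g (K.degen 1 z)) (basePoint K 1 x) v) +
      (T.B (I.thetaL (fun z => f (K.degen 1 z)) (basePoint K 1 x) w)
          (I.thetaR (fun z => g (K.degen 0 z)) (basePoint K 1 x) v) -
        T.B (I.thetaL (fun z => f (K.degen 0 z)) (basePoint K 1 x) v)
          (I.thetaR (fun z => g (K.degen 1 z)) (basePoint K 1 x) w)) := by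
  rw [imForm_one_one, polar_apply, polar_apply]
  simp only [Matrix.cons_val_zero, Matrix.cons_val_one, thetaL_degen hf, thetaR_degen hg]

theorem thetaR_eq_thetaL {f : M → I.G} (hf : Mfd.Smooth (N := I.G.toMfd) f) {x : M} (h : f x = 1)
    (v : M.model) : I.thetaR f x v = I.thetaL f x v := by
  rw [thetaR_eq hf, h, adj_one]

/-! ### The symplectic structure of the nerve -/

/-- The products along the edges of the simplices of the nerve. -/
abbrev nerveEdge {n : ℕ} (i k : Fin (n + 1)) : I.G.nerve.lev n → I.G := fun g =>
  LieGrp.edge (G := I.G) (n := n) g i k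

theorem smooth_nerveEdge {n : ℕ} (i k : Fin (n + 1)) :
    Mfd.Smooth (N := I.G.toMfd) (nerveEdge (I := I) i k) :=
  LieGrp.smooth_edge i k

theorem nerveEdge_self {n : ℕ} (i : Fin (n + 1)) : nerveEdge (I := I) i i = fun _ => 1 :=
  funext fun g => LieGrp.edge_self (G := I.G) (n := n) g i

theorem nerveEdge_mul {n : ℕ} (i j k : Fin (n + 1)) :
    (fun g => nerveEdge (I := I) i j g * nerveEdge (I := I) j k g) = nerveEdge (I := I) i k :=
  funext fun g => LieGrp.edge_mul (G := I.G) (n := n) g i j k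

theorem nerveEdge_face {n : ℕ} (m : Fin (n + 2)) (i k : Fin (n + 1)) :
    (fun g => nerveEdge (I := I) i k (I.G.nerve.face m g)) =
      nerveEdge (I := I) (m.succAbove i) (m.succAbove k) :=
  funext fun g => LieGrp.edge_face m g i k

theorem nerveEdge_degen {n : ℕ} (m : Fin (n + 1)) (i k : Fin (n + 2)) :
    (fun g => nerveEdge (I := I) i k (I.G.nerve.degen m g)) =
      nerveEdge (I := I) (m.predAbove i) (m.predAbove k) :=
  funext fun g => LieGrp.edge_nerveOp (G := I.G) (n := n) _ g i k

theorem pullback_face_polar_nerveEdge {n : ℕ} (m : Fin (n + 2)) (i j k l : Fin (n + 1)) :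
    Form.pullback (I.G.nerve.face m) (I.polar (nerveEdge i j) (nerveEdge k l)) =
      I.polar (nerveEdge (m.succAbove i) (m.succAbove j))
        (nerveEdge (m.succAbove k) (m.succAbove l)) := by
  rw [pullback_polar (smooth_nerveEdge _ _) (smooth_nerveEdge _ _) (I.G.nerve.face_smooth m),
    nerveEdge_face, nerveEdge_face]

theorem Omega_eq : I.Omega = I.polar (nerveEdge 0 1) (nerveEdge 1 2) := by
  have h : ∀ m : Fin 3, (fun g : I.G.nerve.lev 2 => (I.G.nerve.face m g : Fin 1 → I.G) 0) =
      nerveEdge (I := I) (m.succAbove 0) (m.succAbove 1) := fun m =>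
    (funext fun g => (LieGrp.edge_castSucc_succ (I.G.nerve.face m g : Fin 1 → I.G) 0).symm).trans
      (nerveEdge_face m 0 1)
  rw [Omega, h, h]
  rfl

theorem Theta_eq : I.Theta = I.cartan (nerveEdge 0 1) :=
  congrArg I.cartan (funext fun g : I.G.nerve.lev 1 =>
    (LieGrp.edge_castSucc_succ (G := I.G) (n := 1) g 0).symm)

theorem isSmooth_Omega : Form.IsSmooth I.Omega := by
  rw [Omega_eq]
  exact isSmooth_polar (smooth_nerveEdge _ _) (smooth_nerveEdge _ _)

theorem isSmooth_Theta : Form.IsSmooth I.Theta := by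
  rw [Theta_eq]
  exact isSmooth_cartan (smooth_nerveEdge _ _)

/-- This is the cocycle identity for the three consecutive edges of a 3-simplex; likewise
`simplicialDiff_Theta` is `deRham_polar` for the two edges of a 2-simplex. -/
theorem simplicialDiff_Omega : simplicialDiff I.G.nerve I.Omega = 0 := by
  have c := polar_cocycle (I := I) (M := I.G.nerve.lev 3) (smooth_nerveEdge 0 1)
    (smooth_nerveEdge 1 2) (smooth_nerveEdge 2 3)
  rw [nerveEdge_mul, nerveEdge_mul] at c
  rw [simplicialDiff_two, Omega_eq]
  simp only [pullback_face_polar_nerveEdge]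
  exact c

theorem simplicialDiff_Theta : simplicialDiff I.G.nerve I.Theta = Form.deRham I.Omega := by
  have e : ∀ m : Fin 3, Form.pullback (I.G.nerve.face m) I.Theta =
      I.cartan (nerveEdge (m.succAbove 0) (m.succAbove 1)) := fun m => by
    rw [Theta_eq, pullback_cartan (smooth_nerveEdge _ _) (I.G.nerve.face_smooth m), nerveEdge_face]
  rw [simplicialDiff_one, e, e, e, Omega_eq,
    deRham_polar (smooth_nerveEdge _ _) (smooth_nerveEdge _ _), nerveEdge_mul]
  rfl

theorem deRham_Theta : Form.deRham I.Theta = 0 := by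
  rw [Theta_eq]
  exact deRham_cartan (smooth_nerveEdge _ _)

theorem OmegaTotal_eq_zero {p q : ℕ} (h1 : ¬(p = 2 ∧ q = 2)) (h2 : ¬(p = 1 ∧ q = 3)) :
    I.OmegaTotal p q = 0 := by
  unfold OmegaTotal
  split
  · exact absurd ⟨rfl, rfl⟩ h1
  · exact absurd ⟨rfl, rfl⟩ h2
  · rfl

theorem isShiftedForm_OmegaTotal : IsShiftedForm 2 2 I.OmegaTotal where
  smooth p q := by
    by_cases h1 : p = 2 ∧ q = 2
    · obtain ⟨rfl, rfl⟩ := h1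
      exact isSmooth_Omega
    by_cases h2 : p = 1 ∧ q = 3
    · obtain ⟨rfl, rfl⟩ := h2
      exact isSmooth_Theta.neg
    rw [OmegaTotal_eq_zero h1 h2]
    exact Form.isSmooth_zero
  support p q h := OmegaTotal_eq_zero (by omega) (by omega)
  normalised p q i := by
    by_cases h1 : p = 1 ∧ q = 2
    · obtain ⟨rfl, rfl⟩ := h1
      change Form.pullback _ I.Omega = 0
      rw [Omega_eq, pullback_polar (smooth_nerveEdge _ _) (smooth_nerveEdge _ _)
        (I.G.nerve.degen_smooth i), nerveEdge_degen, nerveEdge_degen]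
      -- The degeneracy `s_0` makes the edge `01` constant and `s_1` the edge `12`, so one argument
      -- of `polar` is constant.
      fin_cases i
      · exact (congrArg (fun e => I.polar e _) (nerveEdge_self 0)).trans (polar_const_left _ _)
      · exact (congrArg (I.polar _) (nerveEdge_self 1)).trans (polar_const_right _ _)
    by_cases h2 : p = 0 ∧ q = 3
    · obtain ⟨rfl, rfl⟩ := h2
      change Form.pullback _ (-I.Theta) = 0
      rw [Form.pullback_neg, Theta_eq, pullback_cartan (smooth_nerveEdge _ _)
        (I.G.nerve.degen_smooth i), nerveEdge_degen, Subsingleton.elim (α := Fin 1) (Fin.predAbove i 1)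
        (Fin.predAbove i 0), nerveEdge_self, cartan_const, neg_zero]
    rw [OmegaTotal_eq_zero (by omega) (by omega), Form.pullback_zero]

theorem totalDiff_OmegaTotal : totalDiff I.OmegaTotal = 0 := by
  have hd : ∀ p q, ¬(p = 2 ∧ q = 2) → Form.deRham (I.OmegaTotal p q) = 0 := fun p q h1 => by
    by_cases h2 : p = 1 ∧ q = 3
    · obtain ⟨rfl, rfl⟩ := h2
      exact (Form.deRham_neg isSmooth_Theta).trans (by rw [deRham_Theta, neg_zero])
    rw [OmegaTotal_eq_zero h1 h2, Form.deRham_zero]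
  have hs : ∀ p q, ¬(p = 1 ∧ q = 3) → simplicialDiff I.G.nerve (I.OmegaTotal p q) = 0 :=
    fun p q h2 => by
      by_cases h1 : p = 2 ∧ q = 2
      · obtain ⟨rfl, rfl⟩ := h1
        exact simplicialDiff_Omega
      rw [OmegaTotal_eq_zero h1 h2, simplicialDiff_zero]
  funext p q
  match p, q with
  | 0, 0 => rfl
  | 0, q + 1 => exact hd 0 q (by omega)
  | p + 1, 0 => exact hs p 0 (by omega)
  | p + 1, q + 1 =>
    by_cases h : p = 1 ∧ q = 2
    · obtain ⟨rfl, rfl⟩ := h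
      change simplicialDiff I.G.nerve (-I.Theta) + (-1 : ℝ) ^ 2 • Form.deRham I.Omega = 0
      rw [simplicialDiff_neg, simplicialDiff_Theta, neg_one_sq, one_smul, neg_add_cancel]
    change simplicialDiff I.G.nerve (I.OmegaTotal p (q + 1)) +
      (-1 : ℝ) ^ (p + 1) • Form.deRham (I.OmegaTotal (p + 1) q) = 0
    rw [hs _ _ (by omega), hd _ _ (by omega), smul_zero, add_zero]

theorem etale_nerveEdge : Mfd.Etale (N := I.G.toMfd) (nerveEdge (I := I) (0 : Fin 2) 1) := by
  refine Mfd.etale_of_bijective (smooth_nerveEdge _ _) fun x => ?_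
  have e : nerveEdge (I := I) (0 : Fin 2) 1 = fun g : I.G.toMfd.pow 1 => g 0 :=
    funext fun g => LieGrp.edge_castSucc_succ (G := I.G) (n := 1) g 0
  have h : ∀ v : Fin 1 → I.G.model, Mfd.tmap (M := I.G.nerve.lev 1) (N := I.G.toMfd)
      (nerveEdge (I := I) (0 : Fin 2) 1) x v = v 0 := fun v => by
    rw [e]
    exact Mfd.tmap_coord (M := I.G.toMfd) 0 x v
  refine ⟨fun v w hvw => funext fun i => ?_, fun a => ⟨fun _ => a, h _⟩⟩
  rw [Subsingleton.elim i 0]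
  exact (h v).symm.trans (hvw.trans (h w))

theorem isNondegenerate_OmegaTotal : IsNondegenerate 2 I.OmegaTotal := by
  refine isNondegenerate_of_etale (LieGrp.hornProj_nerve I.G) etale_nerveEdge fun x v w => ?_
  change imForm _ _ I.Omega _ _ _ = _
  have h1 : nerveEdge (I := I) (0 : Fin 2) 1 (basePoint I.G.nerve 1 x) = 1 :=
    (LieGrp.edge_nerveOp (G := I.G) (n := 0) _ x 0 1).trans (LieGrp.edge_self (G := I.G) (n := 0) x 0)
  have d : ∀ m i k, (fun z => nerveEdge (I := I) i k (I.G.nerve.degen (l := 1) m z)) =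
    nerveEdge (I := I) (m.predAbove i) (m.predAbove k) := fun m i k => nerveEdge_degen m i k
  rw [Omega_eq, imForm_polar (smooth_nerveEdge _ _) (smooth_nerveEdge _ _)]
  simp only [d]
  -- The edge `01` is constant after `s_0`, which removes two of the four terms. At the base point
  -- left and right forms agree, and the two remaining terms are equal by symmetry of the pairing.
  have e1 : I.thetaL (nerveEdge (I := I) (Fin.predAbove (0 : Fin 2) 0) (Fin.predAbove (0 : Fin 2) 1))
      (basePoint I.G.nerve 1 x) = 0 :=
    (congrArg (fun e => I.thetaL e _) (nerveEdge_self (0 : Fin 2))).trans (thetaL_const _ _)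
  rw [e1, LinearMap.zero_apply, LinearMap.zero_apply, map_zero, LinearMap.zero_apply,
    LinearMap.zero_apply, sub_zero, sub_zero]
  have e2 : ∀ v, I.thetaR (nerveEdge (I := I) (Fin.predAbove (0 : Fin 2) 1)
      (Fin.predAbove (0 : Fin 2) 2)) (basePoint I.G.nerve 1 x) v =
      I.thetaL (nerveEdge (I := I) (0 : Fin 2) 1) (basePoint I.G.nerve 1 x) v :=
    fun v => thetaR_eq_thetaL (smooth_nerveEdge _ _) h1 v
  have e3 : I.thetaL (nerveEdge (I := I) (Fin.predAbove (1 : Fin 2) 0) (Fin.predAbove (1 : Fin 2) 1))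
      (basePoint I.G.nerve 1 x) =
      I.thetaL (nerveEdge (I := I) (0 : Fin 2) 1) (basePoint I.G.nerve 1 x) := rfl
  rw [e2, e2, e3, T.symm (I.thetaL _ _ w), two_mul]

variable (I) in
theorem isShiftedSymplectic_nerve : IsShiftedSymplectic 2 2 I.G.nerve I.OmegaTotal :=
  ⟨(LieGrp.isLocalLieGroup_nerve I.G).1, isShiftedForm_OmegaTotal, totalDiff_OmegaTotal,
    isNondegenerate_OmegaTotal⟩

end Integration

/-! ### The symplectic structure of the codiagonal and the Morita equivalence -/

namespace Integration

open SMfd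

variable {𝔤 : Type*} [LieRing 𝔤] [LieAlgebra ℝ 𝔤] {T : ManinTriple 𝔤} {I : Integration.{u} T}

/-- The values in `G` of the horizontal edges. -/
def edgeA {n : ℕ} (t : Triple n) : I.gamma.lev n → I.G := fun s => I.φm (I.gammaBar.a t s)

/-- The values in `G` of the vertical edges. -/
def edgeH {n : ℕ} (t : Triple n) : I.gamma.lev n → I.G := fun s => I.φp (I.gammaBar.h t s)

theorem smooth_edgeA {n : ℕ} (t : Triple n) : Mfd.Smooth (N := I.G.toMfd) (edgeA (I := I) t) :=
  I.smooth_φm (I.smooth_a t)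

theorem smooth_edgeH {n : ℕ} (t : Triple n) : Mfd.Smooth (N := I.G.toMfd) (edgeH (I := I) t) :=
  I.smooth_φp (I.smooth_h t)

theorem edgeA_self {n : ℕ} (i j : Fin (n + 1)) (h : i ≤ j) :
    edgeA (I := I) ⟨i, j, j, h, le_rfl⟩ = fun _ => 1 :=
  funext fun s => (congrArg I.φm (Staircase.a_self (I := I) (n := n) s i j h)).trans I.φm.map_one

theorem edgeH_self {n : ℕ} (i j : Fin (n + 1)) (h : i ≤ j) :
    edgeH (I := I) ⟨i, i, j, le_rfl, h⟩ = fun _ => 1 :=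
  funext fun s => (congrArg I.φp (Staircase.h_self (I := I) (n := n) s i j h)).trans I.φp.map_one

theorem edgeH_mul_edgeA (s : I.gamma.lev 2) :
    edgeH ⟨0, 1, 1, by decide, by decide⟩ s * edgeA ⟨1, 1, 2, by decide, by decide⟩ s =
      edgeA ⟨0, 1, 2, by decide, by decide⟩ s * edgeH ⟨0, 1, 2, by decide, by decide⟩ s :=
  Staircase.square (I := I) (n := 2) s 0 1 1 2 (by decide) (by decide) (by decide)

theorem nerveEdge_gammaNerve {n : ℕ} (i k : Fin (n + 1)) (h : i ≤ k) :
    (fun s => nerveEdge i k (level I.gammaNerve n s)) =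
      fun s => edgeA (I := I) ⟨i, i, k, le_rfl, h⟩ s * edgeH ⟨i, k, k, h, le_rfl⟩ s :=
  funext fun s => Staircase.edge_toNerve (I := I) (n := n) s i k h

theorem omega_eq : I.gammaBar.omega =
    I.polar (edgeH ⟨0, 1, 1, by decide, by decide⟩) (edgeA ⟨1, 1, 2, by decide, by decide⟩) -
      I.polar (edgeA ⟨0, 1, 2, by decide, by decide⟩) (edgeH ⟨0, 1, 2, by decide, by decide⟩) :=
  congrArg₂ _
    (congrArg₂ (pairForm T.B) (thetaLp_eq (I.smooth_h _)) (thetaRm_eq (I.smooth_a _)))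
    (congrArg₂ (pairForm T.B) (thetaLm_eq (I.smooth_a _)) (thetaRp_eq (I.smooth_h _)))

theorem beta_eq : I.gammaBar.beta =
    I.polar (edgeA ⟨0, 0, 1, by decide, by decide⟩) (edgeH ⟨0, 1, 1, by decide, by decide⟩) :=
  congrArg₂ (pairForm T.B) (thetaLm_eq (I.smooth_a _)) (thetaRp_eq (I.smooth_h _))

theorem isSmooth_omega : Form.IsSmooth I.gammaBar.omega := by
  rw [omega_eq]
  exact (isSmooth_polar (smooth_edgeH _) (smooth_edgeA _)).sub
    (isSmooth_polar (smooth_edgeA _) (smooth_edgeH _))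

theorem isSmooth_beta : Form.IsSmooth I.gammaBar.beta := by
  rw [beta_eq]
  exact isSmooth_polar (smooth_edgeA _) (smooth_edgeH _)

theorem pullback_Omega : Form.pullback (level I.gammaNerve 2) I.Omega =
    I.polar (fun s => edgeA ⟨0, 0, 1, by decide, by decide⟩ s *
        edgeH ⟨0, 1, 1, by decide, by decide⟩ s)
      (fun s => edgeA ⟨1, 1, 2, by decide, by decide⟩ s *
        edgeH ⟨1, 2, 2, by decide, by decide⟩ s) := by
  rw [Omega_eq, pullback_polar (smooth_nerveEdge _ _) (smooth_nerveEdge _ _) (level_smooth _ _),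
    nerveEdge_gammaNerve 0 1 (by decide), nerveEdge_gammaNerve 1 2 (by decide)]

/-- The factors `a₃, a₂` of `H₋` and `h₂, h₁` of `H₊` have vanishing `polar` by isotropy, and the
square relation is `h₃ a₁ = a₂ h₂`; this is the situation of `polar_mul_mul`. -/
theorem omega_sub_pullback_Omega :
    I.gammaBar.omega - Form.pullback (level I.gammaNerve 2) I.Omega =
      simplicialDiff I.gamma I.gammaBar.beta := by
  have hmr : I.polar (edgeA (I := I) (⟨0, 0, 1, by decide, by decide⟩ : Triple 2))
      (edgeA ⟨0, 1, 2, by decide, by decide⟩) = 0 := polar_m_m (I.smooth_a _) (I.smooth_a _)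
  have hsq : I.polar (edgeH (I := I) (⟨0, 1, 2, by decide, by decide⟩ : Triple 2))
      (edgeH ⟨1, 2, 2, by decide, by decide⟩) = 0 := polar_p_p (I.smooth_h _) (I.smooth_h _)
  have key := polar_mul_mul (I := I) (smooth_edgeA _) (smooth_edgeH _) (smooth_edgeA _)
    (smooth_edgeH _) (smooth_edgeA _) (smooth_edgeH _) edgeH_mul_edgeA hmr hsq
  have e1 : ∀ s, edgeA (I := I) (⟨0, 0, 1, by decide, by decide⟩ : Triple 1)
      (I.gamma.face 1 s) = edgeA ⟨0, 0, 1, by decide, by decide⟩ s *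
        edgeA ⟨0, 1, 2, by decide, by decide⟩ s := fun s =>
    (congrArg I.φm (I.gammaBar.face_one s).1).trans (I.φm.map_mul _ _)
  have e2 : ∀ s, edgeH (I := I) (⟨0, 1, 1, by decide, by decide⟩ : Triple 1)
      (I.gamma.face 1 s) = edgeH ⟨0, 1, 2, by decide, by decide⟩ s *
        edgeH ⟨1, 2, 2, by decide, by decide⟩ s := fun s =>
    (congrArg I.φp (I.gammaBar.face_one s).2).trans (I.φp.map_mul _ _)
  have f : ∀ m, Form.pullback (I.gamma.face m) I.gammaBar.beta =
      I.polar (fun s => edgeA ⟨0, 0, 1, by decide, by decide⟩ (I.gamma.face m s))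
        (fun s => edgeH ⟨0, 1, 1, by decide, by decide⟩ (I.gamma.face m s)) := fun m => by
    rw [beta_eq, pullback_polar (smooth_edgeA _) (smooth_edgeH _) (I.gamma.face_smooth m)]
  rw [simplicialDiff_one, omega_eq, pullback_Omega, f, f, f, funext e1, funext e2]
  exact key

/-- In the differential formula for `polar a h` the Cartan forms of both factors vanish by isotropy,
leaving minus that of the product `Φ_1`. -/
theorem pullback_Theta : Form.pullback (level I.gammaNerve 1) I.Theta =
    -Form.deRham I.gammaBar.beta := by
  have h1 : I.cartan (edgeA (I := I) (⟨0, 0, 1, by decide, by decide⟩ : Triple 1)) = 0 :=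
    cartan_m (I.smooth_a _)
  have h2 : I.cartan (edgeH (I := I) (⟨0, 1, 1, by decide, by decide⟩ : Triple 1)) = 0 :=
    cartan_p (I.smooth_h _)
  rw [Theta_eq, pullback_cartan (smooth_nerveEdge _ _) (level_smooth _ _),
    nerveEdge_gammaNerve 0 1 (by decide), beta_eq,
    deRham_polar (smooth_edgeA _) (smooth_edgeH _), h1, h2, zero_sub, add_zero, neg_neg]

/-- Each of the two terms of `ω̄` has as differential minus the Cartan form of its product, and the
two products are equal by the square relation. -/
theorem deRham_omega : Form.deRham I.gammaBar.omega = 0 := by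
  have ha : ∀ t : Triple 2, I.cartan (edgeA (I := I) t) = 0 := fun t => cartan_m (I.smooth_a t)
  have hh : ∀ t : Triple 2, I.cartan (edgeH (I := I) t) = 0 := fun t => cartan_p (I.smooth_h t)
  rw [omega_eq, Form.deRham_sub (isSmooth_polar (smooth_edgeH _) (smooth_edgeA _))
    (isSmooth_polar (smooth_edgeA _) (smooth_edgeH _)), deRham_polar (smooth_edgeH _)
    (smooth_edgeA _), deRham_polar (smooth_edgeA _) (smooth_edgeH _), funext edgeH_mul_edgeA,
    ha, ha, hh, hh, sub_self]

/-- `ω̄` is the sum of `δβ` and the pullback of the `δ`-closed form `Ω`. -/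
theorem simplicialDiff_omega : simplicialDiff I.gamma I.gammaBar.omega = 0 := by
  rw [← sub_add_cancel I.gammaBar.omega (Form.pullback (level I.gammaNerve 2) I.Omega),
    omega_sub_pullback_Omega, simplicialDiff_add, simplicialDiff_simplicialDiff,
    simplicialDiff_pullback, simplicialDiff_Omega, Form.pullback_zero, add_zero]

theorem omegaTotal_eq_zero {p q : ℕ} (h : ¬(p = 2 ∧ q = 2)) : I.gammaBar.omegaTotal p q = 0 := by
  unfold GammaBar.omegaTotal
  split
  · exact absurd ⟨rfl, rfl⟩ h
  · rfl

theorem betaTotal_eq_zero {p q : ℕ} (h : ¬(p = 1 ∧ q = 2)) : I.gammaBar.betaTotal p q = 0 := by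
  unfold GammaBar.betaTotal
  split
  · exact absurd ⟨rfl, rfl⟩ h
  · rfl

theorem isShiftedForm_omegaTotal : IsShiftedForm 2 2 I.gammaBar.omegaTotal where
  smooth p q := by
    by_cases h : p = 2 ∧ q = 2
    · obtain ⟨rfl, rfl⟩ := h
      exact isSmooth_omega
    rw [omegaTotal_eq_zero h]
    exact Form.isSmooth_zero
  support p q h := omegaTotal_eq_zero (by omega)
  normalised p q i := by
    by_cases h : p = 1 ∧ q = 2
    · obtain ⟨rfl, rfl⟩ := h
      change Form.pullback _ I.gammaBar.omega = 0
      rw [omega_eq, Form.pullback_sub, pullback_polar (smooth_edgeH _) (smooth_edgeA _)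
        (I.gamma.degen_smooth i), pullback_polar (smooth_edgeA _) (smooth_edgeH _)
        (I.gamma.degen_smooth i), sub_eq_zero]
      fin_cases i
      · exact ((congrArg (fun e => I.polar e _) (edgeH_self 0 0 le_rfl)).trans
          (polar_const_left _ _)).trans ((congrArg (I.polar _) (edgeH_self 0 1 (by decide))).trans
          (polar_const_right _ _)).symm
      · exact ((congrArg (I.polar _) (edgeA_self 1 1 le_rfl)).trans
          (polar_const_right _ _)).trans ((congrArg (fun e => I.polar e _)
          (edgeA_self 0 1 (by decide))).trans (polar_const_left _ _)).symm
    rw [omegaTotal_eq_zero (by omega), Form.pullback_zero]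

theorem isShiftedForm_betaTotal : IsShiftedForm 1 2 I.gammaBar.betaTotal where
  smooth p q := by
    by_cases h : p = 1 ∧ q = 2
    · obtain ⟨rfl, rfl⟩ := h
      exact isSmooth_beta
    rw [betaTotal_eq_zero h]
    exact Form.isSmooth_zero
  support p q h := betaTotal_eq_zero (by omega)
  normalised p q i := by
    by_cases h : p = 0 ∧ q = 2
    · obtain ⟨rfl, rfl⟩ := h
      change Form.pullback _ I.gammaBar.beta = 0
      rw [beta_eq, pullback_polar (smooth_edgeA _) (smooth_edgeH _) (I.gamma.degen_smooth i)]
      fin_cases i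
      exact (congrArg (fun e => I.polar e _) (edgeA_self 0 0 le_rfl)).trans (polar_const_left _ _)
    rw [betaTotal_eq_zero (by omega), Form.pullback_zero]

theorem totalDiff_omegaTotal : totalDiff I.gammaBar.omegaTotal = 0 := by
  have hd : ∀ p q, Form.deRham (I.gammaBar.omegaTotal p q) = 0 := fun p q => by
    by_cases h : p = 2 ∧ q = 2
    · obtain ⟨rfl, rfl⟩ := h
      exact deRham_omega
    rw [omegaTotal_eq_zero h, Form.deRham_zero]
  have hs : ∀ p q, simplicialDiff I.gamma (I.gammaBar.omegaTotal p q) = 0 := fun p q => by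
    by_cases h : p = 2 ∧ q = 2
    · obtain ⟨rfl, rfl⟩ := h
      exact simplicialDiff_omega
    rw [omegaTotal_eq_zero h, simplicialDiff_zero]
  funext p q
  match p, q with
  | 0, 0 => rfl
  | 0, q + 1 => exact hd 0 q
  | p + 1, 0 => exact hs p 0
  | p + 1, q + 1 =>
    change simplicialDiff I.gamma (I.gammaBar.omegaTotal p (q + 1)) +
      (-1 : ℝ) ^ (p + 1) • Form.deRham (I.gammaBar.omegaTotal (p + 1) q) = 0
    rw [hs, hd, smul_zero, add_zero]

/-- At the base point the Maurer–Cartan form of `Φ_1` is the sum of its components in `𝔥₋` and `𝔥₊`.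
Each of the two terms of `ω̄` contributes the cross pairings of these components once, and by
isotropy the cross pairings are the whole of `⟨θ(v), θ(w)⟩`. -/
theorem isNondegenerate_omegaTotal : IsNondegenerate 2 I.gammaBar.omegaTotal := by
  refine isNondegenerate_of_etale (fun l j => hornProj_of_etale I.gammaNerve I.etale_gammaNerve
    (LieGrp.isSubmanifold_horn l j)) (etale_nerveEdge.comp (I.etale_gammaNerve 1)) fun x v w => ?_
  change imForm _ _ I.gammaBar.omega _ _ _ = _
  set m := edgeA (I := I) (⟨0, 0, 1, by decide, by decide⟩ : Triple 1) with hm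
  set p := edgeH (I := I) (⟨0, 1, 1, by decide, by decide⟩ : Triple 1) with hp
  set b := basePoint I.gamma 1 x
  have sm : Mfd.Smooth (N := I.G.toMfd) m := smooth_edgeA _
  have sp : Mfd.Smooth (N := I.G.toMfd) p := smooth_edgeH _
  have m1 : m b = 1 := congrFun (edgeA_self (I := I) (n := 0) 0 0 le_rfl) x
  have p1 : p b = 1 := congrFun (edgeH_self (I := I) (n := 0) 0 0 le_rfl) x
  have hθ : ∀ v, I.thetaL (fun s => nerveEdge 0 1 (level I.gammaNerve 1 s)) b v =
      I.thetaL m b v + I.thetaL p b v := fun v => by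
    rw [nerveEdge_gammaNerve 0 1 (by decide), thetaL_mul sm sp, p1, inv_one, adj_one]
  have Hm : ∀ v, I.thetaL m b v ∈ T.hm := fun v => thetaL_m_mem (I.smooth_a _) _ _
  have Hp : ∀ v, I.thetaL p b v ∈ T.hp := fun v => thetaL_p_mem (I.smooth_h _) _ _
  have a0 : I.thetaL (fun z => edgeH (⟨0, 1, 1, by decide, by decide⟩ : Triple 2)
      (I.gamma.degen 0 z)) b = 0 :=
    (congrArg (fun e => I.thetaL e b) (edgeH_self 0 0 le_rfl)).trans (thetaL_const _ _)
  have a1 : I.thetaL (fun z => edgeA (⟨0, 1, 2, by decide, by decide⟩ : Triple 2)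
      (I.gamma.degen 1 z)) b = 0 :=
    (congrArg (fun e => I.thetaL e b) (edgeA_self 0 1 (by decide))).trans (thetaL_const _ _)
  have a2 : I.thetaL (fun z => edgeH (⟨0, 1, 1, by decide, by decide⟩ : Triple 2)
      (I.gamma.degen 1 z)) b = I.thetaL p b := rfl
  have a3 : I.thetaL (fun z => edgeA (⟨0, 1, 2, by decide, by decide⟩ : Triple 2)
      (I.gamma.degen 0 z)) b = I.thetaL m b := rfl
  have a4 : ∀ v, I.thetaR (fun z => edgeA (⟨1, 1, 2, by decide, by decide⟩ : Triple 2)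
      (I.gamma.degen 0 z)) b v = I.thetaL m b v := fun v => thetaR_eq_thetaL sm m1 v
  have a5 : ∀ v, I.thetaR (fun z => edgeH (⟨0, 1, 2, by decide, by decide⟩ : Triple 2)
      (I.gamma.degen 1 z)) b v = I.thetaL p b v := fun v => thetaR_eq_thetaL sp p1 v
  rw [omega_eq, imForm_sub, imForm_polar (smooth_edgeH _) (smooth_edgeA _),
    imForm_polar (smooth_edgeA _) (smooth_edgeH _), a0, a1, a2, a3, a4, a4, a5, a5, hθ, hθ]
  simp only [map_add, LinearMap.add_apply, LinearMap.zero_apply, map_zero,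
    T.isotropic_p _ (Hp v) _ (Hp w), T.isotropic_m _ (Hm v) _ (Hm w),
    T.symm (I.thetaL m b _) (I.thetaL p b _)]
  ring

variable (I) in
theorem isShiftedSymplectic_gamma : IsShiftedSymplectic 2 2 I.gamma I.gammaBar.omegaTotal :=
  ⟨I.isLocalLieGroup_gamma.1, isShiftedForm_omegaTotal, totalDiff_omegaTotal,
    isNondegenerate_omegaTotal⟩

theorem omegaTotal_sub_pullback_OmegaTotal :
    pullback (𝟙 I.gamma) I.gammaBar.omegaTotal - pullback I.gammaNerve I.OmegaTotal =
      totalDiff I.gammaBar.betaTotal := by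
  have hd : ∀ p q, ¬(p = 1 ∧ q = 2) → Form.deRham (I.gammaBar.betaTotal p q) = 0 := fun p q h => by
    rw [betaTotal_eq_zero h, Form.deRham_zero]
  have hs : ∀ p q, ¬(p = 1 ∧ q = 2) → simplicialDiff I.gamma (I.gammaBar.betaTotal p q) = 0 :=
    fun p q h => by rw [betaTotal_eq_zero h, simplicialDiff_zero]
  have hz : ∀ p q, ¬(p = 2 ∧ q = 2) → ¬(p = 1 ∧ q = 3) → (pullback (𝟙 I.gamma)
      I.gammaBar.omegaTotal - pullback I.gammaNerve I.OmegaTotal) p q = 0 := fun p q h1 h2 => by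
    change Form.pullback _ (I.gammaBar.omegaTotal p q) - Form.pullback _ (I.OmegaTotal p q) = 0
    rw [omegaTotal_eq_zero h1, OmegaTotal_eq_zero h1 h2, Form.pullback_zero, Form.pullback_zero,
      sub_zero]
  funext p q
  match p, q with
  | 0, 0 => exact hz 0 0 (by omega) (by omega)
  | 0, q + 1 => exact (hz 0 (q + 1) (by omega) (by omega)).trans (hd 0 q (by omega)).symm
  | p + 1, 0 => exact (hz (p + 1) 0 (by omega) (by omega)).trans (hs p 0 (by omega)).symm
  | p + 1, q + 1 =>
    change _ = simplicialDiff I.gamma (I.gammaBar.betaTotal p (q + 1)) +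
      (-1 : ℝ) ^ (p + 1) • Form.deRham (I.gammaBar.betaTotal (p + 1) q)
    by_cases h1 : p = 1 ∧ q = 1
    · obtain ⟨rfl, rfl⟩ := h1
      rw [hd _ _ (by omega), smul_zero, add_zero]
      exact (congrArg (· - _) (Form.pullback_id I.gammaBar.omega)).trans omega_sub_pullback_Omega
    by_cases h2 : p = 0 ∧ q = 2
    · obtain ⟨rfl, rfl⟩ := h2
      rw [hs _ _ (by omega)]
      refine Eq.trans ?_ (zero_add _).symm
      -- In bidegree `(1, 3)` the sign of `-Θ` in `Ω_•` meets the sign of `d` on `K_1`: the claim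
      -- reads `Φ^*Θ = -dβ`.
      change 0 - -Form.pullback (level I.gammaNerve 1) I.Theta =
        (-1 : ℝ) ^ (0 + 1) • Form.deRham I.gammaBar.beta
      rw [pullback_Theta, neg_neg, zero_sub, zero_add, pow_one]
      exact (neg_one_smul ℝ (Form.deRham I.gammaBar.beta)).symm
    rw [hz _ _ (by omega) (by omega), hs _ _ (by omega), hd _ _ (by omega), smul_zero, add_zero]

variable (I) in
theorem isSymplecticMorita_gamma : IsSymplecticMorita 2 2 I.gammaBar.omegaTotal I.OmegaTotal
    I.gammaBar.betaTotal (𝟙 I.gamma) I.gammaNerve where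
  left := I.isShiftedSymplectic_gamma
  right := I.isShiftedSymplectic_nerve
  localLie := I.isLocalLieGroup_gamma.1
  form := isShiftedForm_betaTotal
  hypercover_left := isHypercover_two_id I.gamma
  hypercover_right := I.isHypercover_gammaNerve
  eq := omegaTotal_sub_pullback_OmegaTotal

end Integration

end

theorem mainTheorem2 {𝔤 : Type*} [LieRing 𝔤] [LieAlgebra ℝ 𝔤] (T : ManinTriple 𝔤)
    (I : Integration.{u} T) :
    ∃ (K : SMfd.{u}) (P : I.GammaBar K) (Φ : K ⟶ I.G.nerve),
      SMfd.IsLocalLieGroup 2 K ∧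
      SMfd.IsLocalLieGroup 2 I.G.nerve ∧
      (∀ x : K.lev 1, SMfd.level Φ 1 x = ![I.φm (P.a' x) * I.φp (P.h' x)]) ∧
      (∀ x : K.lev 2, SMfd.level Φ 2 x =
        ![I.φm (P.a₃ x) * I.φp (P.h₃ x), I.φm (P.a₁ x) * I.φp (P.h₁ x)]) ∧
      SMfd.IsSymplecticMorita 2 2 P.omegaTotal I.OmegaTotal P.betaTotal (𝟙 K) Φ ∧
      P.omega - Form.pullback (SMfd.level Φ 2) I.Omega = SMfd.simplicialDiff K P.beta ∧
      Form.pullback (SMfd.level Φ 1) I.Theta = -Form.deRham P.beta := by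
  refine ⟨I.gamma, I.gammaBar, I.gammaNerve, I.isLocalLieGroup_gamma,
    LieGrp.isLocalLieGroup_nerve I.G, fun x => ?_, fun x => ?_, I.isSymplecticMorita_gamma,
    Integration.omega_sub_pullback_Omega, Integration.pullback_Theta⟩
  · funext i
    fin_cases i
    rfl
  · funext i
    fin_cases i <;> rfl
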